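/- **Setting.** Let $K\ge 1$, $k_0\in[K]$, $\delta\in(0,1/e)$. For $k\in[K]$ let $\mathcal M_k=(r_k,n,m_k,A_k,B_k,C_k,\Sigma_{w,k},\sigma_{\eta,k}^2I)$ be the linear system $$x_{k,t+1}=A_kx_{k,t}+B_ku_{k,t}+w_{k,t},\qquad y_{k,t}=C_kx_{k,t}+\eta_{k,t},\qquad x_{k,0}=0,$$ with latent dimension $1\le r_k<n$, input dimension $m_k$, observations in $\mathbb R^n$, and independent (over all $k,t$) $u_{k,t}\sim\mathcal N(0,\Sigma_{u,k})$, $w_{k,t}\sim\mathcal N(0,\Sigma_{w,k})$, $\eta_{k,t}\sim\mathcal N(0,\sigma_{\eta,k}^2I)$, where $\Sigma_{u,k}\succ0$ and $\Sigma_{w,k}\succeq0$. The systems are minimal ($(A_k,B_k)$ controllable, $(A_k,C_k)$ observable), share the observer column space ($\mathrm{col}(C_1)=\dots=\mathrm{col}(C_K)$), and satisfy $\|A_k^i\|\le\psi_A\rho_A^{i-1}$ for all $i\ge1$ with common constants $\psi_A\ge1$, $\rho_A\in(0,1)$. From system $k$ one observes $\{u_{k,t}\}_{t=0}^{T_k-1}$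 and $\{y_{k,t}\}_{t=0}^{T_k}$. Put $T_{-k_0}=\sum_{k\ne k_0}T_k$, $r=\max_kr_k$, $m=\max_km_k$; $\|\cdot\|$ is the operator norm, $\sigma_1\ge\sigma_2\ge\cdots$ are singular values, and $\sigma_{\min}$ is the smallest non-zero singular value. **Oracle.** A SYSID oracle with polynomials $p_1,p_2$ is a (measurable) estimator that receives the latent dimension $r$, a confidence level $\delta$ and one input–output trajectory of length $T$, together with functions $\kappa_1,\kappa_2\ge0$ of the system $\mathcal M$, of the inputs $\mathcal U$ (their covariance and number) and of $\delta$ (measurable in the observer matrix), such that for every minimal system $\mathcal M=(r,n,m,A,B,C,\Sigma_w,\Sigma_\eta)$ of any dimensions ($r\ge 1$) with $\|A^i\|\le\psi\rho^{i-1}$ ($i\ge1$) for some $\psi\ge1$, $\rho\in(0,1)$, with $\Sigma_w,\Sigma_\eta\succeq0$ and i.i.d. inputs $\mathcal N(0,\Sigma_u)$, $\Sigma_u\succ0$, every $\delta\in(0,1/e)$ and every $T\ge\max\{1,\kappa_1(\mathcal M,\mathcal U,\delta)\,p_1(r,n,m)\}$: with probability at least $1-\delta$ its output $(\hat A,\hat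 B,\hat C)$ satisfies, for some invertible $S$, $\max\{\|S^{-1}AS-\hat A\|,\|S^{-1}B-\hat B\|,\|CS-\hat C\|\}\le\kappa_2(\mathcal M,\mathcal U,\delta)\,p_2(r,n,m)/\sqrt T$. **Algorithm (for system $k_0$).** (i) Let $\Sigma_y=\sum_{k\ne k_0}\sum_{t=0}^{T_k}y_{k,t}y_{k,t}^\top$, let $\hat r_c$ be the largest $i\in\{1,\dots,n-1\}$ with $\sigma_i(\Sigma_y)-\sigma_{i+1}(\Sigma_y)>T_{-k_0}^{3/4}$ ($0$ if there is none), and let the columns of $\hat\Phi\in\mathbb R^{n\times\hat r_c}$ be the first $\hat r_c$ orthonormal eigenvectors of $\Sigma_y$ (any measurable choice). (ii) Apply the oracle, at confidence level $\delta/2$, to $\{\hat\Phi^\top y_{k_0,t}\}_{t=0}^{T_{k_0}}\cup\{u_{k_0,t}\}_{t=0}^{T_{k_0}-1}$, obtaining $\hat A_{k_0},\hat B_{k_0},\tilde C$. (iii) Put $\hat C_{k_0}=\hat\Phi\tilde C$. Write $\widehat{\mathcal M}_{k_0}=(r_{k_0},\hat r_c,m_{k_0},A_{k_0},B_{k_0},\hat\Phi^\top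 C_{k_0},\Sigma_{w,k_0},\sigma_{\eta,k_0}^2I)$. **Constants.** For a set $s$ of systems let $\psi_C=\max_{k\in s}\|C_k\|$, $\psi_\eta=\max_{k\in s}\sigma_{\eta,k}^2$, $\psi_w=\max_{k\in s}\|\Sigma_{w,k}+B_k\Sigma_{u,k}B_k^\top\|$, each replaced by $1$ if smaller than $1$, and $\phi_u=\min_{k\in s}\sigma_{\min}(\Sigma_{u,k})$, $\phi_C=\min_{k\in s}\sigma_{\min}(C_k)$, $\phi_O=\min_{k\in s}\sigma_{\min}([C_k;C_kA_k;\dots;C_kA_k^{r-1}])$, $\phi_R=\min_{k\in s}\sigma_{\min}([B_k,A_kB_k,\dots,A_k^{r-1}B_k])$, each replaced by $1$ if larger than $1$. Let $$\kappa_4=\frac{\psi_\eta}{\phi_u\phi_C^2\phi_R^2}\sqrt{\log\tfrac1\delta}\quad\text{with }s=[K]\setminus\{k_0\},$$ $$\kappa_3=\max\Big\{\kappa_4^2\frac{\psi_A^2\psi_C^2}{(1-\rho_A^2)\phi_O^2},\ \Big(\frac{\psi_\eta^2\psi_C^2\psi_w\psi_A^2}{(1-\rho_A^2)\phi_u^2\phi_C^4\phi_R^4}\Big)^2\log^2\Big(\frac{\psi_C^2\psi_w\psi_A^4}{1-\rho_A^2}\,r\log\frac{Kr}\delta\Big)\log^4\frac{Kr}\delta\Big\}\quad\text{with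 }s=[K].$$ **Theorem.** There is an absolute constant $c>0$, and for all polynomials $p_1,p_2$ in three variables there are polynomials $q_1,q_2$ in two variables, such that for every oracle with polynomials $p_1,p_2$ and every setting as above with $T_{k_0}\ge1$: if $$T_{-k_0}\ge c\,\kappa_3\,n^2r^3\qquad\text{and}\qquad T_{-k_0}\ge 2(K-1)r,$$ then with probability at least $1-\delta$ the following holds: if $T_{k_0}\ge\kappa_1(\widehat{\mathcal M}_{k_0},\mathcal U_{k_0},\delta/2)\,q_1(r,m)$, then for some invertible $S$ $$\max\big\{\|S^{-1}A_{k_0}S-\hat A_{k_0}\|,\|S^{-1}B_{k_0}-\hat B_{k_0}\|,\|C_{k_0}S-\hat C_{k_0}\|\big\}\le c\Big(\kappa_2(\widehat{\mathcal M}_{k_0},\mathcal U_{k_0},\delta/2)\sqrt{\frac{q_2(r,m)}{T_{k_0}}}+\kappa_4\sqrt{\frac n{T_{-k_0}}}\,\|\hat C_{k_0}\|\Big).$$ -/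

import Mathlib

open MeasureTheory ProbabilityTheory
open scoped Matrix Matrix.Norms.L2Operator

noncomputable section

/-- Matrices carry the (entrywise) product sigma-algebra. -/
instance instMeasurableSpaceRealMatrix {a b : Type*} : MeasurableSpace (Matrix a b ℝ) :=
  inferInstanceAs (MeasurableSpace (a → b → ℝ))

/-- `σ_{i+1}(X)`: the singular values of a real matrix in decreasing order, with multiplicity,
indexed from `0`. -/
def singVal {a b : Type*} [Fintype a] [Fintype b] [DecidableEq a] [DecidableEq b]
    (X : Matrix a b ℝ) (i : ℕ) : ℝ :=
  (Matrix.toEuclideanLin X).singularValues i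

/-- `σ_min(X)`: the minimum non-zero singular value (and `0` for the zero matrix). -/
def sigmaMin {a b : Type*} [Fintype a] [Fintype b] [DecidableEq a] [DecidableEq b]
    (X : Matrix a b ℝ) : ℝ :=
  singVal X (X.rank - 1)

/-- The controllability matrix `[B, AB, …, A^{d-1}B]`. -/
def ctrbMatrix {r m : ℕ} (A : Matrix (Fin r) (Fin r) ℝ) (B : Matrix (Fin r) (Fin m) ℝ) (d : ℕ) :
    Matrix (Fin r) (Fin d × Fin m) ℝ :=
  Matrix.of fun i jl => (A ^ (jl.1 : ℕ) * B) i jl.2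

/-- The observability matrix `[C; CA; …; CA^{d-1}]`. -/
def obsvMatrix {r n : ℕ} (A : Matrix (Fin r) (Fin r) ℝ) (C : Matrix (Fin n) (Fin r) ℝ) (d : ℕ) :
    Matrix (Fin d × Fin n) (Fin r) ℝ :=
  Matrix.of fun il j => (C * A ^ (il.1 : ℕ)) il.2 j

/-- A linear system `x_{t+1} = A x_t + B u_t + w_t`, `y_t = C x_t + η_t`, with `x_0 = 0`,
latent dimension `r`, observation dimension `n`, input dimension `m`, process noise covariance
`Sw` and observation noise covariance `Se`. -/
structure LTISystem (r n m : ℕ) where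
  A : Matrix (Fin r) (Fin r) ℝ
  B : Matrix (Fin r) (Fin m) ℝ
  C : Matrix (Fin n) (Fin r) ℝ
  Sw : Matrix (Fin r) (Fin r) ℝ
  Se : Matrix (Fin n) (Fin n) ℝ

/-- Minimality: `(A, B)` is controllable and `(A, C)` is observable. -/
def IsMinimal {r n m : ℕ} (M : LTISystem r n m) : Prop :=
  (ctrbMatrix M.A M.B r).rank = r ∧ (obsvMatrix M.A M.C r).rank = r

/-- `‖A^i‖ ≤ ψ ρ^{i-1}` for all `i ≥ 1`, with `ψ ≥ 1` and `ρ ∈ (0,1)`. -/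
def IsStableMatrix {r : ℕ} (A : Matrix (Fin r) (Fin r) ℝ) (ψ ρ : ℝ) : Prop :=
  1 ≤ ψ ∧ 0 < ρ ∧ ρ < 1 ∧ ∀ i : ℕ, ‖A ^ (i + 1)‖ ≤ ψ * ρ ^ i

/-- The random variables driving a trajectory of length `T`: inputs `u_0, …, u_{T-1}`,
process noises `w_0, …, w_{T-1}` and observation noises `η_0, …, η_T`. -/
abbrev Noise (r n m T : ℕ) : Type :=
  (Fin T → EuclideanSpace ℝ (Fin m)) × (Fin T → EuclideanSpace ℝ (Fin r)) ×
    (Fin (T + 1) → EuclideanSpace ℝ (Fin n))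

/-- Their joint law: all independent, `u_t ∼ N(0, Su)`, `w_t ∼ N(0, Sw)`, `η_t ∼ N(0, Se)`. -/
def noiseLaw {r n m : ℕ} (M : LTISystem r n m) (Su : Matrix (Fin m) (Fin m) ℝ) (T : ℕ) :
    Measure (Noise r n m T) :=
  (Measure.pi fun _ => multivariateGaussian 0 Su).prod
    ((Measure.pi fun _ => multivariateGaussian 0 M.Sw).prod
      (Measure.pi fun _ => multivariateGaussian 0 M.Se))

/-- The latent states `x_0, …, x_T`. -/
def state {r n m T : ℕ} (M : LTISystem r n m) (ω : Noise r n m T) :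
    Fin (T + 1) → EuclideanSpace ℝ (Fin r) :=
  Fin.induction 0 fun t x =>
    Matrix.toEuclideanLin M.A x + Matrix.toEuclideanLin M.B (ω.1 t) + ω.2.1 t

/-- The observations `y_0, …, y_T`. -/
def output {r n m T : ℕ} (M : LTISystem r n m) (ω : Noise r n m T) :
    Fin (T + 1) → EuclideanSpace ℝ (Fin n) :=
  fun t => Matrix.toEuclideanLin M.C (state M ω t) + ω.2.2 t

/-- An input-output data set: inputs `u_0, …, u_{T-1}` and observations `y_0, …, y_T`. -/
abbrev IOData (n m T : ℕ) : Type :=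
  (Fin T → EuclideanSpace ℝ (Fin m)) × (Fin (T + 1) → EuclideanSpace ℝ (Fin n))

/-- The data set produced by the system. -/
def ioData {r n m T : ℕ} (M : LTISystem r n m) (ω : Noise r n m T) : IOData n m T :=
  (ω.1, output M ω)

/-- A triple of (estimated) parameters `(Â, B̂, Ĉ)`. -/
abbrev Params (r n m : ℕ) : Type :=
  Matrix (Fin r) (Fin r) ℝ × Matrix (Fin r) (Fin m) ℝ × Matrix (Fin n) (Fin r) ℝ

/-- `max{‖S⁻¹AS - Â‖, ‖S⁻¹B - B̂‖, ‖CS - Ĉ‖}`. -/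
def paramError {r n m : ℕ} (M : LTISystem r n m) (S : Matrix (Fin r) (Fin r) ℝ)
    (e : Params r n m) : ℝ :=
  max ‖S⁻¹ * M.A * S - e.1‖ (max ‖S⁻¹ * M.B - e.2.1‖ ‖M.C * S - e.2.2‖)

/-- The value of a polynomial in `(r, n, m)`. -/
def polyVal₃ (p : MvPolynomial (Fin 3) ℝ) (r n m : ℕ) : ℝ :=
  MvPolynomial.eval ![(r : ℝ), (n : ℝ), (m : ℝ)] p

/-- The value of a polynomial in `(r, m)`. -/
def polyVal₂ (q : MvPolynomial (Fin 2) ℝ) (r m : ℕ) : ℝ :=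
  MvPolynomial.eval ![(r : ℝ), (m : ℝ)] q

/-- A system identification oracle with polynomials `p₁, p₂`: an estimator `est` (which knows the
latent dimension and the confidence level), with problem-related constants `κ₁, κ₂` depending on
the system, on the inputs (through their covariance and number) and on the confidence level, such
that for every stable minimal system and every `T ≥ κ₁ p₁(r,n,m)` the parameter error is at most
`κ₂ p₂(r,n,m) / √T` with probability at least `1 - δ`. -/
structure SysIdOracle (p₁ p₂ : MvPolynomial (Fin 3) ℝ) where
  est : (r n m T : ℕ) → (δ : ℝ) → IOData n m T → Params r n m
  κ₁ : {r n m : ℕ} → LTISystem r n m → (Su : Matrix (Fin m) (Fin m) ℝ) → (T : ℕ) → (δ : ℝ) → ℝ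
  κ₂ : {r n m : ℕ} → LTISystem r n m → (Su : Matrix (Fin m) (Fin m) ℝ) → (T : ℕ) → (δ : ℝ) → ℝ
  measurable_est : ∀ (r n m T : ℕ) (δ : ℝ), Measurable (est r n m T δ)
  measurable_κ₁ : ∀ {r n m : ℕ} (M : LTISystem r n m) (Su : Matrix (Fin m) (Fin m) ℝ) (T : ℕ)
    (δ : ℝ), Measurable fun C : Matrix (Fin n) (Fin r) ℝ => κ₁ { M with C := C } Su T δ
  measurable_κ₂ : ∀ {r n m : ℕ} (M : LTISystem r n m) (Su : Matrix (Fin m) (Fin m) ℝ) (T : ℕ)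
    (δ : ℝ), Measurable fun C : Matrix (Fin n) (Fin r) ℝ => κ₂ { M with C := C } Su T δ
  κ₁_nonneg : ∀ {r n m : ℕ} (M : LTISystem r n m) (Su : Matrix (Fin m) (Fin m) ℝ) (T : ℕ)
    (δ : ℝ), 0 ≤ κ₁ M Su T δ
  κ₂_nonneg : ∀ {r n m : ℕ} (M : LTISystem r n m) (Su : Matrix (Fin m) (Fin m) ℝ) (T : ℕ)
    (δ : ℝ), 0 ≤ κ₂ M Su T δ
  guarantee : ∀ {r n m : ℕ} (M : LTISystem r n m) (Su : Matrix (Fin m) (Fin m) ℝ) (T : ℕ)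
    (δ : ℝ), 0 < r → IsMinimal M → (∃ ψ ρ : ℝ, IsStableMatrix M.A ψ ρ) →
    M.Sw.PosSemidef → M.Se.PosSemidef → Su.PosDef → 1 ≤ T → 0 < δ → δ < Real.exp (-1) →
    κ₁ M Su T δ * polyVal₃ p₁ r n m ≤ T →
    ENNReal.ofReal (1 - δ) ≤ noiseLaw M Su T
      {ω | ∃ S : Matrix (Fin r) (Fin r) ℝ, IsUnit S ∧
        paramError M S (est r n m T δ (ioData M ω)) ≤ polyVal₃ p₂ r n m / √T * κ₂ M Su T δ}

/-- `Σ_y = ∑_k ∑_{t=0}^{T_k} y_{k,t} y_{k,t}ᵀ`. -/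
def dataCov {n : ℕ} {I : Type} [Fintype I] {T : I → ℕ}
    (Y : ∀ k, Fin (T k + 1) → EuclideanSpace ℝ (Fin n)) : Matrix (Fin n) (Fin n) ℝ :=
  ∑ k, ∑ t, Matrix.vecMulVec (Y k t) (Y k t)

/-- The estimated rank: the largest `i ∈ {1, …, n-1}` with `σ_i - σ_{i+1} > τ^{3/4}` (and `0` if
there is none). -/
def rankEst {n : ℕ} (X : Matrix (Fin n) (Fin n) ℝ) (τ : ℕ) : ℕ :=
  open Classical in
  Nat.findGreatest (fun i => (τ : ℝ) ^ (3 / 4 : ℝ) < singVal X (i - 1) - singVal X i) (n - 1)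

/-- `f` implements the column space approximation: from the observations `Y` of several
trajectories it computes an `n × p` matrix, `p` being the estimated rank, whose columns are
orthonormal and are the first `p` eigenvectors of `Σ_y`. How eigenvectors are chosen among the
possible ones is left open, as long as the choice is measurable. -/
structure IsColApprox {n : ℕ} {I : Type} [Fintype I] {T : I → ℕ}
    (f : (∀ k, Fin (T k + 1) → EuclideanSpace ℝ (Fin n)) →
      (p : ℕ) × Matrix (Fin n) (Fin p) ℝ) : Prop where
  measurable : Measurable f
  rank_eq : ∀ Y, (f Y).1 = rankEst (dataCov Y) (∑ k, T k)
  orthonormal : ∀ Y, (f Y).2ᵀ * (f Y).2 = 1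
  eigenvector : ∀ Y (j : Fin (f Y).1),
    dataCov Y *ᵥ (f Y).2.col j = singVal (dataCov Y) j • (f Y).2.col j

/-- The data set with its observations projected: `{u_t} ∪ {Φᵀ y_t}`. -/
def projData {n m T p : ℕ} (Φ : Matrix (Fin n) (Fin p) ℝ) (d : IOData n m T) : IOData p m T :=
  (d.1, fun t => Matrix.toEuclideanLin Φᵀ (d.2 t))

/-- The projected system `(A, B, ΦᵀC)`, with noise covariances `Sw` and `Φᵀ Se Φ`
(which is `σ²I` if `Se = σ²I` and `Φ` has orthonormal columns). -/
def projSystem {r n m p : ℕ} (M : LTISystem r n m) (Φ : Matrix (Fin n) (Fin p) ℝ) :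
    LTISystem r p m :=
  { A := M.A, B := M.B, C := Φᵀ * M.C, Sw := M.Sw, Se := Φᵀ * M.Se * Φ }

/-- Project the data, call the oracle, lift the estimated observer: `(Â, B̂, Φ C̃)`. -/
def projFit {p₁ p₂ : MvPolynomial (Fin 3) ℝ} (O : SysIdOracle p₁ p₂) {n m T p : ℕ} (r : ℕ) (δ : ℝ)
    (Φ : Matrix (Fin n) (Fin p) ℝ) (d : IOData n m T) : Params r n m :=
  let e := O.est r p m T δ (projData Φ d)
  (e.1, e.2.1, Φ * e.2.2)

/-- The data of `K` systems with observations in `ℝⁿ`: dimensions, parameters, noise covariances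
`Sw k` and `(σ k)² I`, input covariances `Su k`, and trajectory lengths `T k`. -/
structure MetaProblem (K n : ℕ) where
  r : Fin K → ℕ
  m : Fin K → ℕ
  T : Fin K → ℕ
  A : ∀ k, Matrix (Fin (r k)) (Fin (r k)) ℝ
  B : ∀ k, Matrix (Fin (r k)) (Fin (m k)) ℝ
  C : ∀ k, Matrix (Fin n) (Fin (r k)) ℝ
  Sw : ∀ k, Matrix (Fin (r k)) (Fin (r k)) ℝ
  σ : Fin K → ℝ
  Su : ∀ k, Matrix (Fin (m k)) (Fin (m k)) ℝ

namespace MetaProblem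

variable {K n : ℕ} (P : MetaProblem K n)

/-- The `k`-th system. -/
def sys (k : Fin K) : LTISystem (P.r k) n (P.m k) :=
  { A := P.A k, B := P.B k, C := P.C k, Sw := P.Sw k, Se := (P.σ k) ^ 2 • 1 }

/-- The setting: minimal systems of positive latent dimension smaller than `n`, the same observer
column space, positive semi-definite noise covariances, positive definite input covariances. -/
structure Valid : Prop where
  r_pos : ∀ k, 0 < P.r k
  r_lt : ∀ k, P.r k < n
  minimal : ∀ k, IsMinimal (P.sys k)
  col_eq : ∀ k l, LinearMap.range (P.C k).mulVecLin = LinearMap.range (P.C l).mulVecLin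
  Sw_psd : ∀ k, (P.Sw k).PosSemidef
  Su_pd : ∀ k, (P.Su k).PosDef

/-- The driving random variables of all trajectories, independent across systems. -/
def law : Measure (∀ k, Noise (P.r k) n (P.m k) (P.T k)) :=
  Measure.pi fun k => noiseLaw (P.sys k) (P.Su k) (P.T k)

/-- The observations of all trajectories but the `k₀`-th. -/
def outputsExcept (k₀ : Fin K) (ω : ∀ k, Noise (P.r k) n (P.m k) (P.T k)) :
    ∀ k : {k // k ≠ k₀}, Fin (P.T k + 1) → EuclideanSpace ℝ (Fin n) :=
  fun k => output (P.sys k) (ω k)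

/-- `T_{-k₀} = ∑_{k ≠ k₀} T_k`. -/
def Trest (k₀ : Fin K) : ℕ := ∑ k : {k // k ≠ k₀}, P.T k

/-- `r = max_k r_k`. -/
def rmax : ℕ := Finset.univ.sup P.r

/-- `m = max_k m_k`. -/
def mmax : ℕ := Finset.univ.sup P.m

/-! The constants below are taken over a set `s` of systems; each `ψ` is at least `1` and each
`φ` is at most `1`. -/

variable (s : Finset (Fin K))

def ψC : ℝ := s.fold max 1 fun k => ‖P.C k‖

def ψη : ℝ := s.fold max 1 fun k => (P.σ k) ^ 2

def ψw : ℝ := s.fold max 1 fun k => ‖P.Sw k + P.B k * P.Su k * (P.B k)ᵀ‖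

def φu : ℝ := s.fold min 1 fun k => sigmaMin (P.Su k)

def φC : ℝ := s.fold min 1 fun k => sigmaMin (P.C k)

def φO : ℝ := s.fold min 1 fun k => sigmaMin (obsvMatrix (P.A k) (P.C k) P.rmax)

def φR : ℝ := s.fold min 1 fun k => sigmaMin (ctrbMatrix (P.A k) (P.B k) P.rmax)

/-- `κ₄ = ψη / (φu φC² φR²) √(log (1/δ))`, over the systems `k ≠ k₀`. -/
def κ₄ (k₀ : Fin K) (δ : ℝ) : ℝ :=
  P.ψη {k₀}ᶜ / (P.φu {k₀}ᶜ * P.φC {k₀}ᶜ ^ 2 * P.φR {k₀}ᶜ ^ 2) * √(Real.log (1 / δ))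

/-- `κ₃`, over all systems. -/
def κ₃ (k₀ : Fin K) (ψA ρA δ : ℝ) : ℝ :=
  let ψC := P.ψC Finset.univ
  let ψη := P.ψη Finset.univ
  let ψw := P.ψw Finset.univ
  let φu := P.φu Finset.univ
  let φC := P.φC Finset.univ
  let φO := P.φO Finset.univ
  let φR := P.φR Finset.univ
  let r : ℝ := P.rmax
  max (P.κ₄ k₀ δ ^ 2 * (ψA ^ 2 * ψC ^ 2 / ((1 - ρA ^ 2) * φO ^ 2)))
    ((ψη ^ 2 * ψC ^ 2 * ψw * ψA ^ 2 / ((1 - ρA ^ 2) * φu ^ 2 * φC ^ 4 * φR ^ 4)) ^ 2 *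
      Real.log (ψC ^ 2 * ψw * ψA ^ 4 / (1 - ρA ^ 2) * r * Real.log (K * r / δ)) ^ 2 *
      Real.log (K * r / δ) ^ 4)

end MetaProblem

end

/-!
The theorem follows from a perturbation argument for the pooled sample covariance, whose
probabilistic part is carried out with hands-on Gaussian estimates, and from a transfer of the
oracle guarantee to the projected system.

*The pooled data.* Write `y = z + η`, with `z = C x` the signal and `η` the observation noise. All
signals lie in the common column space `V` of the observers. Since the noise covariances are
multiples of the identity, the noise adds to `Σ_y` a multiple of the identity, up to a
fluctuation. The pooled samples are regular (`SampleRegularity`) with probability at least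
`1 - δ/2` (`measure_not_sampleRegularity_pooled_le_exp`):
* the signal Gram form is bounded below on `V` by the number of samples (`measure_signal_le`). For
  a fixed direction this is a lower tail bound for a Gaussian quadratic form, whose covariance is
  bounded by stability (`integral_sq_signal_le`) and whose mean is bounded below by
  controllability (`le_integral_sq_signal`); a net of fine mesh makes it uniform, and the crude
  Markov bound on the trace that is needed to leave the net only costs a logarithm;
* given the signals, the cross terms between signal and noise are bounded relative to the square
  root of the signal form (`measure_cross_le`), so that no upper bound on the signals is needed;
* the noise Gram form concentrates around a multiple of the identity (`measure_noise_le`).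

*Perturbation.* On regular samples the spectrum of `Σ_y` has a single gap larger than `T^{3/4}`,
at the index `dim V`, so that the rank is estimated correctly, and the top eigenvectors make a
small angle `ε` with `V` (`IsColApprox.isFrameNear`). Here `ε` is a multiple of `κ₄ √(n / T)`. The
numerical conditions follow from `T ≥ c κ₃ n² r³` (`le_of_kappa_le`, `sample_size_conditions`),
only the second term of `κ₃` being needed.

*The oracle.* For a frame `Φ` close to `V` the projected system is minimal, because `Φᵀ` is
injective on `V`, and its observation dimension is `dim V ≤ r`; this is why the polynomials in
`(r, n, m)` turn into polynomials in `(r, m)` (`dominatingPoly`). The trajectory of the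
distinguished system is independent of `Φ`, so the oracle applies with `Φ` frozen
(`exists_measurableSet_projFit`, `MetaProblem.le_law_of_sections`). Lifting the estimated observer
by `Φ` costs the angle `ε`, relative to the size of the estimate (`IsFrameNear.paramError_le`).
-/

/-! ### Product measures -/

/-- A lower bound for the (outer) measure of an arbitrary set by its sections. Since only lower
bounds on outer measures are involved, no measurability is needed: one passes to measurable hulls
of `S` and of the set of bad sections. -/
theorem prod_measure_ge_of_sections {X Y : Type*} [MeasurableSpace X] [MeasurableSpace Y]
    (μ : Measure X) (ν : Measure Y) [IsProbabilityMeasure μ] [IsProbabilityMeasure ν]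
    (A : Set X) (S : Set (X × Y)) (α b : ENNReal) (hA : μ Aᶜ ≤ α)
    (hS : ∀ x ∈ A, b ≤ ν {y | (x, y) ∈ S}) : (1 - α) * b ≤ (μ.prod ν) S := by
  have h1 : (μ.prod ν) S = ∫⁻ x, ν (Prod.mk x ⁻¹' toMeasurable (μ.prod ν) S) ∂μ := by
    rw [← measure_toMeasurable, Measure.prod_apply (measurableSet_toMeasurable _ _)]
  have h2 : 1 - α ≤ μ (toMeasurable μ Aᶜ)ᶜ := by
    rw [prob_compl_eq_one_sub (measurableSet_toMeasurable _ _), measure_toMeasurable]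
    gcongr
  calc (1 - α) * b ≤ μ (toMeasurable μ Aᶜ)ᶜ * b := by gcongr
    _ = ∫⁻ x in (toMeasurable μ Aᶜ)ᶜ, b ∂μ := by
        rw [setLIntegral_const, mul_comm]
    _ ≤ ∫⁻ x in (toMeasurable μ Aᶜ)ᶜ, ν (Prod.mk x ⁻¹' toMeasurable (μ.prod ν) S) ∂μ := by
        refine setLIntegral_mono' (measurableSet_toMeasurable _ _).compl fun x hx => ?_
        have hxA : x ∈ A := by
          by_contra h
          exact hx (subset_toMeasurable _ _ h)
        exact (hS x hxA).trans (measure_mono fun y hy => subset_toMeasurable _ _ hy)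
    _ ≤ ∫⁻ x, ν (Prod.mk x ⁻¹' toMeasurable (μ.prod ν) S) ∂μ := setLIntegral_le_lintegral _ _
    _ = _ := h1.symm

/-- Regrouping a finite product of products of probability spaces into a product of two finite
products. -/
theorem measurePreserving_pi_zip {ι : Type*} [Fintype ι] {X Y : ι → Type*}
    [∀ i, MeasurableSpace (X i)] [∀ i, MeasurableSpace (Y i)] (μ : ∀ i, Measure (X i))
    (ν : ∀ i, Measure (Y i)) [∀ i, IsProbabilityMeasure (μ i)]
    [∀ i, IsProbabilityMeasure (ν i)] :
    MeasurePreserving (fun p : (∀ i, X i) × (∀ i, Y i) => fun i => (p.1 i, p.2 i))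
      ((Measure.pi μ).prod (Measure.pi ν)) (Measure.pi fun i => (μ i).prod (ν i)) := by
  have hm : Measurable (fun p : (∀ i, X i) × (∀ i, Y i) => fun i => (p.1 i, p.2 i)) := by
    fun_prop
  refine ⟨hm, ?_⟩
  symm
  refine Measure.pi_eq_generateFrom (fun i => generateFrom_prod) (fun i => isPiSystem_prod)
    (fun i => ?_) ?_
  · exact
    { set := fun _ => Set.univ
      set_mem := fun _ => ⟨Set.univ, MeasurableSet.univ, Set.univ, MeasurableSet.univ, by simp⟩
      finite := fun _ => by simp
      spanning := Set.iUnion_const _ }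
  · intro s hs
    choose a ha b hb hab using hs
    have hset : (fun p : (∀ i, X i) × (∀ i, Y i) => fun i => (p.1 i, p.2 i)) ⁻¹' (Set.univ.pi s)
        = (Set.univ.pi a) ×ˢ (Set.univ.pi b) := by
      ext p
      simp only [Set.mem_preimage, Set.mem_pi, Set.mem_univ, true_implies, Set.mem_prod, ← hab]
      exact forall_and
    rw [Measure.map_apply hm, hset, Measure.prod_prod, Measure.pi_pi, Measure.pi_pi,
      ← Finset.prod_mul_distrib]
    · refine Finset.prod_congr rfl fun i _ => ?_
      rw [← hab i, Measure.prod_prod]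
    · refine MeasurableSet.univ_pi fun i => ?_
      rw [← hab i]
      exact (ha i).prod (hb i)

/-! ### Gaussian quadratic forms -/

/-- The elementary inequality behind the exponential moments of a squared Gaussian variable. -/
theorem one_le_one_sub_mul_exp {y : ℝ} (h2 : y ≤ 1 / 2) :
    1 ≤ (1 - y) * Real.exp (y + y ^ 2) := by
  rcases le_total 0 y with hy | hy
  · have h := Real.quadratic_le_exp_of_nonneg (x := y + y ^ 2) (by positivity)
    refine le_trans ?_ (mul_le_mul_of_nonneg_left h (by linarith))
    have h3 : y ≤ (1 - y) * (1 + y) ^ 2 / 2 := by nlinarith [mul_nonneg hy hy]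
    nlinarith [mul_le_mul_of_nonneg_left h3 (mul_nonneg hy hy)]
  · have h := Real.add_one_le_exp (y + y ^ 2)
    refine le_trans ?_ (mul_le_mul_of_nonneg_left h (by linarith))
    nlinarith [mul_nonneg (neg_nonneg.2 hy) (mul_nonneg (neg_nonneg.2 hy) (neg_nonneg.2 hy))]

theorem integral_exp_mul_sq_gaussianReal (v : NNReal) {θ : ℝ} (h : 2 * θ * v < 1) :
    ∫ x, Real.exp (θ * x ^ 2) ∂(gaussianReal 0 v) = (√(1 - 2 * θ * v))⁻¹ := by
  rcases eq_or_ne v 0 with rfl | hv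
  · simp
  have hv' : (0 : ℝ) < v := by positivity
  rw [integral_gaussianReal_eq_integral_smul hv]
  have hb : 0 < (1 - 2 * θ * v) / (2 * v) := by
    have : 0 < 1 - 2 * θ * v := by linarith
    positivity
  have : ∀ x : ℝ, gaussianPDFReal 0 v x • Real.exp (θ * x ^ 2)
      = (√(2 * Real.pi * v))⁻¹ * Real.exp (-((1 - 2 * θ * v) / (2 * v)) * x ^ 2) := by
    intro x
    rw [gaussianPDFReal, smul_eq_mul, mul_assoc, ← Real.exp_add]
    congr 2
    field_simp
    ring
  simp_rw [this]
  rw [integral_const_mul, integral_gaussian, ← Real.sqrt_inv, ← Real.sqrt_inv,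
    ← Real.sqrt_mul (by positivity)]
  congr 1
  have : 1 - 2 * θ * v ≠ 0 := by linarith
  field_simp

theorem integrable_exp_mul_sq_gaussianReal (v : NNReal) {θ : ℝ} (h : 2 * θ * v < 1) :
    Integrable (fun x => Real.exp (θ * x ^ 2)) (gaussianReal 0 v) := by
  -- a non-integrable function would have integral zero
  by_contra hc
  have h1 := integral_exp_mul_sq_gaussianReal v h
  rw [integral_undef hc] at h1
  have : 0 < (√(1 - 2 * θ * v))⁻¹ := inv_pos.2 (Real.sqrt_pos.2 (by linarith))
  linarith

theorem integral_exp_mul_sq_gaussianReal_le (v : NNReal) {θ : ℝ} (h : |θ| * v ≤ 1 / 4) :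
    ∫ x, Real.exp (θ * x ^ 2) ∂(gaussianReal 0 v) ≤ Real.exp (θ * v + 2 * θ ^ 2 * v ^ 2) := by
  have h1 : |θ * v| ≤ 1 / 4 := by rwa [abs_mul, NNReal.abs_eq]
  obtain ⟨h2, h3⟩ := abs_le.1 h1
  rw [integral_exp_mul_sq_gaussianReal v (by linarith)]
  have h4 := one_le_one_sub_mul_exp (y := 2 * θ * v) (by linarith)
  have h5 : 0 < 1 - 2 * θ * v := by linarith
  rw [inv_le_iff_one_le_mul₀ (Real.sqrt_pos.2 h5)]
  have h6 : Real.exp (θ * v + 2 * θ ^ 2 * v ^ 2)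
      = √(Real.exp (2 * θ * v + (2 * θ * v) ^ 2)) := by
    rw [← Real.exp_half]
    congr 1
    ring
  rw [h6, ← Real.sqrt_mul (by positivity), mul_comm]
  exact Real.one_le_sqrt.2 h4

section Quadratic

variable {E : Type*} [NormedAddCommGroup E] [InnerProductSpace ℝ E] [FiniteDimensional ℝ E]
  [MeasurableSpace E] [BorelSpace E] (μ : Measure E) [IsGaussian μ]

/-- The exponential moments of the squared norm of a centred Gaussian vector whose covariance has
operator norm at most `lam`. In an eigenbasis of the covariance operator the coordinates are
independent, so that the moment generating function factorizes. -/
theorem integral_exp_mul_normSq_le (hmean : ∀ b : E, ∫ x, inner ℝ b x ∂μ = 0) {lam : ℝ}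
    (hvar : ∀ b : E, ∫ x, (inner ℝ b x) ^ 2 ∂μ ≤ lam * ‖b‖ ^ 2) {θ : ℝ}
    (hθ : |θ| * lam ≤ 1 / 4) :
    Integrable (fun x => Real.exp (θ * ‖x‖ ^ 2)) μ ∧
    ∫ x, Real.exp (θ * ‖x‖ ^ 2) ∂μ
      ≤ Real.exp (θ * (∫ x, ‖x‖ ^ 2 ∂μ) + 2 * θ ^ 2 * lam * (∫ x, ‖x‖ ^ 2 ∂μ)) := by
  have hL2 : MemLp id 2 μ := IsGaussian.memLp_two_id
  have hsym := (isPositive_covarianceOperator (μ := μ)).isSymmetric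
  set e := hsym.eigenvectorBasis rfl with he
  set ev := hsym.eigenvalues rfl with hev
  have hcov : ∀ i j, ∫ x, inner ℝ (e i) x * inner ℝ (e j) x ∂μ = if i = j then ev i else 0 := by
    intro i j
    rw [← covarianceOperator_inner hL2]
    have := hsym.apply_eigenvectorBasis rfl i
    rw [ContinuousLinearMap.coe_coe] at this
    rw [← he, ← hev] at this
    rw [this, real_inner_smul_left, orthonormal_iff_ite.1 e.orthonormal]
    split_ifs <;> simp
  have hev0 : ∀ i, 0 ≤ ev i := fun i => by
    have := hcov i i
    rw [if_pos rfl] at this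
    rw [← this]
    exact integral_nonneg fun x => mul_self_nonneg _
  have hevle : ∀ i, ev i ≤ lam := fun i => by
    have h1 := hcov i i
    have h2 := hvar (e i)
    rw [if_pos rfl] at h1
    simp only [e.norm_eq_one, one_pow, mul_one] at h2
    simpa only [← h1, ← pow_two] using h2
  have hLi : ∀ i, MemLp (fun x => inner ℝ (e i) x) 2 μ := fun i => hL2.const_inner (e i)
  have hgauss : HasGaussianLaw (fun x : E => fun i => inner ℝ (e i) x) μ := by
    have := (IsGaussian.hasGaussianLaw_id (μ := μ)).map
      (ContinuousLinearMap.pi fun i => innerSL ℝ (e i))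
    exact this
  have hindep : iIndepFun (fun i => fun x : E => inner ℝ (e i) x) μ := by
    refine hgauss.iIndepFun_of_covariance_eq_zero fun i j hij => ?_
    rw [covariance_eq_sub (hLi i) (hLi j), hmean, zero_mul, sub_zero]
    have := hcov i j
    rwa [if_neg hij] at this
  have hlaw : ∀ i, μ.map (fun x => inner ℝ (e i) x) = gaussianReal 0 (ev i).toNNReal := by
    intro i
    have h1 := IsGaussian.map_eq_gaussianReal (μ := μ) (innerSL ℝ (e i))
    have h2 : (fun x => inner ℝ (e i) x) = ⇑(innerSL ℝ (e i)) := by ext; simp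
    rw [h2, h1, ← h2, hmean, variance_of_integral_eq_zero (hLi i).aemeasurable (hmean _)]
    congr 2
    have h3 := hcov i i
    rw [if_pos rfl] at h3
    rw [← h3]
    simp only [pow_two]
  have hi : ∀ i, |θ| * ((ev i).toNNReal : ℝ) ≤ 1 / 4 := fun i => by
    rw [Real.coe_toNNReal _ (hev0 i)]
    exact (mul_le_mul_of_nonneg_left (hevle i) (abs_nonneg _)).trans hθ
  have hi2 : ∀ i, 2 * θ * ((ev i).toNNReal : ℝ) < 1 := fun i => by
    have := (mul_le_mul_of_nonneg_right (le_abs_self θ)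
      (NNReal.coe_nonneg (ev i).toNNReal)).trans (hi i)
    rw [mul_assoc]
    linarith
  have hmeas : ∀ i, Measurable fun x : E => inner ℝ (e i) x := fun i => by fun_prop
  have hint : ∀ i, Integrable (fun x => Real.exp (θ * (inner ℝ (e i) x) ^ 2)) μ := fun i => by
    have := integrable_exp_mul_sq_gaussianReal _ (hi2 i)
    rw [← hlaw i] at this
    exact this.comp_measurable (hmeas i)
  have hval : ∀ i, mgf (fun x => (inner ℝ (e i) x) ^ 2) μ θ
      ≤ Real.exp (θ * ev i + 2 * θ ^ 2 * lam * ev i) := fun i => by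
    have h1 := integral_exp_mul_sq_gaussianReal_le _ (hi i)
    rw [← hlaw i, integral_map (hmeas i).aemeasurable (by fun_prop),
      Real.coe_toNNReal _ (hev0 i)] at h1
    refine h1.trans (Real.exp_le_exp.2 ?_)
    have : ev i ^ 2 ≤ lam * ev i := by
      rw [pow_two]; exact mul_le_mul_of_nonneg_right (hevle i) (hev0 i)
    nlinarith [mul_le_mul_of_nonneg_left this (sq_nonneg θ)]
  have hindep2 : iIndepFun (fun i => fun x : E => (inner ℝ (e i) x) ^ 2) μ :=
    hindep.comp (fun _ => fun y : ℝ => y ^ 2) (fun _ => by fun_prop)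
  have hnorm : ∀ x : E, ‖x‖ ^ 2 = (∑ i, fun x : E => (inner ℝ (e i) x) ^ 2) x := fun x => by
    rw [Finset.sum_apply, e.sum_sq_inner_right]
  have htr : ∫ x, ‖x‖ ^ 2 ∂μ = ∑ i, ev i := by
    simp_rw [hnorm, Finset.sum_apply]
    rw [integral_finsetSum _ fun i _ => (hLi i).integrable_sq]
    refine Finset.sum_congr rfl fun i _ => ?_
    have := hcov i i
    rw [if_pos rfl] at this
    simp only [pow_two, this]
  constructor
  · simp_rw [hnorm]
    exact hindep2.integrable_exp_mul_sum (fun i => by fun_prop) (fun i _ => hint i)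
  · have h1 := hindep2.mgf_sum (t := θ) (fun i => by fun_prop) Finset.univ
    rw [mgf] at h1
    simp_rw [hnorm]
    rw [h1]
    simp_rw [← hnorm]
    rw [htr, Finset.mul_sum, Finset.mul_sum, ← Finset.sum_add_distrib, Real.exp_sum]
    exact Finset.prod_le_prod (fun i _ => mgf_nonneg) fun i _ => hval i

/-- A Gaussian sum of squares rarely falls below half of its mean. -/
theorem measure_normSq_le_half_mean_le (hmean : ∀ b : E, ∫ x, inner ℝ b x ∂μ = 0) {lam : ℝ}
    (hlam : 0 < lam) (hvar : ∀ b : E, ∫ x, (inner ℝ b x) ^ 2 ∂μ ≤ lam * ‖b‖ ^ 2) :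
    μ.real {x | ‖x‖ ^ 2 ≤ (∫ x, ‖x‖ ^ 2 ∂μ) / 2}
      ≤ Real.exp (-((∫ x, ‖x‖ ^ 2 ∂μ) / (32 * lam))) := by
  have hθ : |(-(1 / (8 * lam)))| * lam ≤ 1 / 4 := by
    rw [abs_neg, abs_of_pos (by positivity)]
    field_simp
    norm_num
  obtain ⟨h1, h2⟩ := integral_exp_mul_normSq_le μ hmean hvar hθ
  refine (measure_le_le_exp_mul_mgf (X := fun x => ‖x‖ ^ 2) _
    (neg_nonpos.2 (by positivity : (0:ℝ) ≤ 1 / (8 * lam))) h1).trans ?_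
  refine (mul_le_mul_of_nonneg_left h2 (Real.exp_pos _).le).trans ?_
  rw [← Real.exp_add, Real.exp_le_exp]
  apply le_of_eq
  field_simp
  ring

/-- Two-sided Bernstein-type concentration of a Gaussian sum of squares around its mean. -/
theorem measure_normSq_sub_mean_ge_le (hmean : ∀ b : E, ∫ x, inner ℝ b x ∂μ = 0) {lam τ t : ℝ}
    (hlam : 0 < lam) (hvar : ∀ b : E, ∫ x, (inner ℝ b x) ^ 2 ∂μ ≤ lam * ‖b‖ ^ 2)
    (hτ : ∫ x, ‖x‖ ^ 2 ∂μ ≤ τ) (hτ0 : 0 < τ) (ht : 0 ≤ t) (htτ : t ≤ τ) :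
    μ.real {x | t ≤ |‖x‖ ^ 2 - ∫ x, ‖x‖ ^ 2 ∂μ|} ≤ 2 * Real.exp (-(t ^ 2 / (8 * lam * τ))) := by
  set m := ∫ x, ‖x‖ ^ 2 ∂μ with hm
  set s := t / (4 * lam * τ) with hs
  have hs0 : 0 ≤ s := by positivity
  have hsl : |s| * lam ≤ 1 / 4 := by
    rw [abs_of_nonneg hs0, hs]
    rw [div_mul_eq_mul_div, div_le_iff₀ (by positivity)]
    nlinarith
  have hsl' : |(-s)| * lam ≤ 1 / 4 := by rwa [abs_neg]
  obtain ⟨h1, h2⟩ := integral_exp_mul_normSq_le μ hmean hvar hsl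
  obtain ⟨h3, h4⟩ := integral_exp_mul_normSq_le μ hmean hvar hsl'
  rw [← hm] at h2 h4
  have hq : 2 * s ^ 2 * lam * m ≤ 2 * s ^ 2 * lam * τ := by gcongr
  have hexp : -(s * t) + 2 * s ^ 2 * lam * τ = -(t ^ 2 / (8 * lam * τ)) := by
    rw [hs]; field_simp; ring
  have hu : μ.real {x | m + t ≤ ‖x‖ ^ 2} ≤ Real.exp (-(t ^ 2 / (8 * lam * τ))) := by
    refine (measure_ge_le_exp_mul_mgf (X := fun x => ‖x‖ ^ 2) _ hs0 h1).trans ?_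
    refine (mul_le_mul_of_nonneg_left h2 (Real.exp_pos _).le).trans ?_
    rw [← Real.exp_add, Real.exp_le_exp]
    nlinarith
  have hl : μ.real {x | ‖x‖ ^ 2 ≤ m - t} ≤ Real.exp (-(t ^ 2 / (8 * lam * τ))) := by
    refine (measure_le_le_exp_mul_mgf (X := fun x => ‖x‖ ^ 2) _ (neg_nonpos.2 hs0) h3).trans ?_
    refine (mul_le_mul_of_nonneg_left h4 (Real.exp_pos _).le).trans ?_
    rw [← Real.exp_add, Real.exp_le_exp]
    nlinarith
  have hsub : {x : E | t ≤ |‖x‖ ^ 2 - m|} ⊆ {x | m + t ≤ ‖x‖ ^ 2} ∪ {x | ‖x‖ ^ 2 ≤ m - t} := by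
    intro x hx
    rcases le_abs'.1 (show t ≤ |‖x‖ ^ 2 - m| from hx) with h | h
    · right; simp only [Set.mem_ofPred_eq]; linarith
    · left; simp only [Set.mem_ofPred_eq]; linarith
  have := (measureReal_mono (μ := μ) hsub).trans (measureReal_union_le _ _)
  linarith

end Quadratic

/-- Gaussian tail bound for a centred real Gaussian variable with variance at most `v`. -/
theorem measure_abs_ge_le_of_map_gaussianReal {Ω : Type*} [MeasurableSpace Ω] (P : Measure Ω)
    [IsProbabilityMeasure P] {X : Ω → ℝ} (w : NNReal)
    (hX : P.map X = gaussianReal 0 w) {v t : ℝ} (hv : 0 < v) (hw : (w : ℝ) ≤ v) (ht : 0 ≤ t) :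
    P.real {ω | t ≤ |X ω|} ≤ 2 * Real.exp (-(t ^ 2 / (2 * v))) := by
  have hXm : AEMeasurable X P := AEMeasurable.of_map_ne_zero (by
    rw [hX]; exact IsProbabilityMeasure.ne_zero _)
  have hint : ∀ s : ℝ, Integrable (fun ω => Real.exp (s * X ω)) P := fun s => by
    have := integrable_exp_mul_gaussianReal (μ := 0) (v := w) s
    rw [← hX] at this
    exact this.comp_aemeasurable hXm
  have hmgf : ∀ s : ℝ, mgf X P s ≤ Real.exp (v * s ^ 2 / 2) := fun s => by
    rw [mgf_gaussianReal hX]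
    refine Real.exp_le_exp.2 ?_
    have := mul_le_mul_of_nonneg_right hw (sq_nonneg s)
    linarith
  have hu : P.real {ω | t ≤ X ω} ≤ Real.exp (-(t ^ 2 / (2 * v))) := by
    refine (measure_ge_le_exp_mul_mgf t (by positivity : 0 ≤ t / v) (hint _)).trans ?_
    refine (mul_le_mul_of_nonneg_left (hmgf _) (Real.exp_pos _).le).trans ?_
    rw [← Real.exp_add, Real.exp_le_exp]
    apply le_of_eq
    field_simp
    ring
  have hl : P.real {ω | X ω ≤ -t} ≤ Real.exp (-(t ^ 2 / (2 * v))) := by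
    refine (measure_le_le_exp_mul_mgf (-t) (neg_nonpos.2 (by positivity : 0 ≤ t / v))
      (hint _)).trans ?_
    refine (mul_le_mul_of_nonneg_left (hmgf _) (Real.exp_pos _).le).trans ?_
    rw [← Real.exp_add, Real.exp_le_exp]
    apply le_of_eq
    field_simp
    ring
  have hsub : {ω | t ≤ |X ω|} ⊆ {ω | t ≤ X ω} ∪ {ω | X ω ≤ -t} := by
    intro ω hω
    rcases le_abs'.1 (show t ≤ |X ω| from hω) with h | h
    · right; exact h
    · left; exact h
  have := (measureReal_mono (μ := P) hsub).trans (measureReal_union_le _ _)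
  linarith

/-! ### Nets -/

/-- A `1/2`-net of the unit ball with at most `5 ^ dim` points, by a maximal separated set. -/
theorem exists_half_net (E : Type*) [NormedAddCommGroup E] [NormedSpace ℝ E]
    [FiniteDimensional ℝ E] :
    ∃ s : Finset E, s.card ≤ 5 ^ Module.finrank ℝ E ∧ (∀ y ∈ s, ‖y‖ ≤ 1) ∧
      ∀ x : E, ‖x‖ ≤ 1 → ∃ y ∈ s, ‖x - y‖ ≤ 1 / 2 := by
  classical
  let good : Finset E → Prop := fun s =>
    (∀ y ∈ s, ‖y‖ ≤ 1) ∧ ∀ c ∈ s, ∀ d ∈ s, c ≠ d → 1 / 2 ≤ ‖c - d‖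
  have hcard : ∀ s, good s → s.card ≤ 5 ^ Module.finrank ℝ E := by
    intro s hs
    have hinj : Function.Injective (fun x : E => (2 : ℝ) • x) :=
      smul_right_injective E (two_ne_zero)
    rw [← Finset.card_image_of_injective s hinj]
    refine Besicovitch.card_le_of_separated _ ?_ ?_
    · intro c hc
      obtain ⟨y, hy, rfl⟩ := Finset.mem_image.1 hc
      have := hs.1 y hy
      simp only [norm_smul, Real.norm_ofNat]
      linarith
    · intro c hc d hd hcd
      obtain ⟨y, hy, rfl⟩ := Finset.mem_image.1 hc
      obtain ⟨z, hz, rfl⟩ := Finset.mem_image.1 hd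
      have := hs.2 y hy z hz (fun h => hcd (by rw [h]))
      simp only [← smul_sub, norm_smul, Real.norm_ofNat]
      linarith
  set A : Set ℕ := {k | ∃ s, good s ∧ s.card = k} with hA
  have hbdd : BddAbove A := ⟨5 ^ Module.finrank ℝ E, by rintro _ ⟨s, hs, rfl⟩; exact hcard s hs⟩
  have hne : A.Nonempty := ⟨0, ∅, ⟨by simp, by simp⟩, by simp⟩
  obtain ⟨s, hs, hsc⟩ := Nat.sSup_mem hne hbdd
  refine ⟨s, hcard s hs, hs.1, fun x hx => ?_⟩
  by_contra! hfar
  have hxs : x ∉ s := fun h => by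
    have := hfar x h
    simp at this
    linarith
  have hgood : good (insert x s) := by
    refine ⟨fun y hy => ?_, fun c hc d hd hcd => ?_⟩
    · rcases Finset.mem_insert.1 hy with rfl | hy
      · exact hx
      · exact hs.1 y hy
    · rcases Finset.mem_insert.1 hc with hcx | hcs <;>
        rcases Finset.mem_insert.1 hd with hdx | hds
      · exact absurd (hcx.trans hdx.symm) hcd
      · rw [hcx]; exact (hfar d hds).le
      · rw [hdx, norm_sub_rev]; exact (hfar c hcs).le
      · exact hs.2 c hcs d hds hcd
  have := le_csSup hbdd (show (insert x s).card ∈ A from ⟨_, hgood, rfl⟩)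
  rw [← hsc, Finset.card_insert_of_notMem hxs] at this
  omega

/-- Finer nets, by iterated rescaling of a `1/2`-net. -/
theorem exists_dyadic_net (E : Type*) [NormedAddCommGroup E] [NormedSpace ℝ E]
    [FiniteDimensional ℝ E] (j : ℕ) :
    ∃ s : Finset E, s.card ≤ 5 ^ (j * Module.finrank ℝ E) ∧
      ∀ x : E, ‖x‖ ≤ 1 → ∃ y ∈ s, ‖x - y‖ ≤ (1 / 2) ^ j := by
  classical
  induction j with
  | zero => exact ⟨{0}, by simp, fun x hx => ⟨0, by simp, by simpa using hx⟩⟩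
  | succ j ih =>
    obtain ⟨s, hs1, hs2⟩ := ih
    obtain ⟨t, ht1, -, ht3⟩ := exists_half_net E
    refine ⟨(s ×ˢ t).image (fun p => p.1 + (1 / 2 : ℝ) ^ j • p.2), ?_, fun x hx => ?_⟩
    · refine Finset.card_image_le.trans ?_
      rw [Finset.card_product, add_mul, one_mul, pow_add]
      exact Nat.mul_le_mul hs1 ht1
    · obtain ⟨y, hy, hxy⟩ := hs2 x hx
      obtain ⟨z, hz, hxz⟩ := ht3 ((2 : ℝ) ^ j • (x - y)) (by
        rw [norm_smul, norm_pow, Real.norm_ofNat]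
        calc (2 : ℝ) ^ j * ‖x - y‖ ≤ 2 ^ j * (1 / 2) ^ j := by gcongr
          _ = 1 := by rw [← mul_pow]; norm_num)
      refine ⟨_, Finset.mem_image.2 ⟨(y, z), Finset.mk_mem_product hy hz, rfl⟩, ?_⟩
      have h1 : x - (y + (1 / 2 : ℝ) ^ j • z)
          = (1 / 2 : ℝ) ^ j • ((2 : ℝ) ^ j • (x - y) - z) := by
        rw [smul_sub, smul_smul, ← mul_pow]
        norm_num
        abel
      rw [h1, norm_smul, norm_pow, pow_succ]
      have : ‖(1 / 2 : ℝ)‖ = 1 / 2 := by norm_num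
      rw [this]
      gcongr

/-- A bilinear form that is at most `t` in absolute value on a product of `1/2`-nets of the two
unit balls is at most `4 t` on the product of the balls. -/
theorem abs_bilin_le_of_half_nets {E F : Type*} [NormedAddCommGroup E] [InnerProductSpace ℝ E]
    [FiniteDimensional ℝ E] [NormedAddCommGroup F] [InnerProductSpace ℝ F]
    [FiniteDimensional ℝ F] (B : E →ₗ[ℝ] F →ₗ[ℝ] ℝ) (s : Finset E) (u : Finset F)
    (hs : ∀ x : E, ‖x‖ ≤ 1 → ∃ y ∈ s, ‖x - y‖ ≤ 1 / 2)
    (hu : ∀ x : F, ‖x‖ ≤ 1 → ∃ y ∈ u, ‖x - y‖ ≤ 1 / 2) {t : ℝ}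
    (ht : ∀ x ∈ s, ∀ y ∈ u, |B x y| ≤ t) (x : E) (y : F) :
    |B x y| ≤ 4 * t * ‖x‖ * ‖y‖ := by
  -- the operator norm of the form is attained up to the net errors
  let Bc : E →L[ℝ] F →L[ℝ] ℝ := LinearMap.toContinuousLinearMap
    ((LinearMap.toContinuousLinearMap : (F →ₗ[ℝ] ℝ) ≃ₗ[ℝ] _).toLinearMap ∘ₗ B)
  have hBc : ∀ x y, Bc x y = B x y := fun _ _ => rfl
  have hnn : 0 ≤ t := by
    obtain ⟨x0, hx0, -⟩ := hs 0 (by simp)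
    obtain ⟨y0, hy0, -⟩ := hu 0 (by simp)
    exact (abs_nonneg _).trans (ht x0 hx0 y0 hy0)
  have h1 : ∀ a ∈ s, ‖Bc a‖ ≤ 2 * t := by
    intro a ha
    have key : ‖Bc a‖ ≤ t + ‖Bc a‖ / 2 := by
      refine ContinuousLinearMap.opNorm_le_of_unit_norm (by positivity) fun y hy => ?_
      obtain ⟨y', hy', hyy⟩ := hu y hy.le
      have e1 : Bc a y = Bc a y' + Bc a (y - y') := by rw [map_sub]; ring
      rw [e1]
      refine (norm_add_le _ _).trans (add_le_add (ht a ha y' hy') ?_)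
      refine ((Bc a).le_opNorm _).trans ?_
      have := mul_le_mul_of_nonneg_left hyy (norm_nonneg (Bc a))
      linarith
    linarith
  have h2 : ‖Bc‖ ≤ 4 * t := by
    have key : ‖Bc‖ ≤ 2 * t + ‖Bc‖ / 2 := by
      refine ContinuousLinearMap.opNorm_le_of_unit_norm (by positivity) fun x hx => ?_
      obtain ⟨x', hx', hxx⟩ := hs x hx.le
      have e1 : Bc x = Bc x' + Bc (x - x') := by rw [map_sub]; abel
      rw [e1]
      refine (norm_add_le _ _).trans (add_le_add (h1 x' hx') ?_)
      refine (Bc.le_opNorm _).trans ?_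
      have := mul_le_mul_of_nonneg_left hxx (norm_nonneg Bc)
      linarith
    linarith
  rw [← hBc, ← Real.norm_eq_abs]
  refine (Bc.le_opNorm₂ x y).trans ?_
  gcongr

/-! ### Singular values -/

section SingularValues

variable {E F : Type*} [NormedAddCommGroup E] [InnerProductSpace ℝ E] [FiniteDimensional ℝ E]
  [NormedAddCommGroup F] [InnerProductSpace ℝ F] [FiniteDimensional ℝ F]

/-- A positive operator has an orthonormal basis of eigenvectors whose eigenvalues are its singular
values in decreasing order. -/
theorem exists_orthonormalBasis_apply_eq_singularValues (S : E →ₗ[ℝ] E) (hS : S.IsPositive)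
    {n : ℕ} (hn : Module.finrank ℝ E = n) :
    ∃ e : OrthonormalBasis (Fin n) ℝ E, ∀ i, S (e i) = S.singularValues i • e i := by
  set e := S.isSymmetric_adjoint_comp_self.eigenvectorBasis hn with he
  refine ⟨e, fun i => ?_⟩
  have hadj : LinearMap.adjoint S = S :=
    LinearMap.isSelfAdjoint_iff'.1 ((LinearMap.isSymmetric_iff_isSelfAdjoint S).1 hS.isSymmetric)
  have h1 : S (S (e i)) = (S.singularValues i ^ 2) • e i := by
    have := S.isSymmetric_adjoint_comp_self.apply_eigenvectorBasis hn i
    rw [LinearMap.comp_apply, ← S.sq_singularValues_fin hn i] at this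
    rw [← LinearMap.congr_fun hadj (S (e i))]
    exact this
  rcases (S.singularValues_nonneg i).eq_or_lt with h0 | hpos
  · rw [← h0, zero_smul]
    have : inner ℝ (S (e i)) (S (e i)) = 0 := by
      rw [hS.isSymmetric (e i) (S (e i)), h1, ← h0]
      simp
    exact inner_self_eq_zero.1 this
  -- `u` is an eigenvector of the positive operator `S` for a negative eigenvalue, hence zero
  · set u := S (e i) - S.singularValues i • e i with hu
    have h2 : S u = -(S.singularValues i • u) := by
      rw [hu, map_sub, h1, map_smul, smul_sub, smul_smul, pow_two]
      abel
    have h3 : 0 ≤ inner ℝ u (S u) := by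
      rw [← hS.isSymmetric]
      exact hS.re_inner_nonneg_left u
    rw [h2, inner_neg_right, real_inner_smul_right, real_inner_self_eq_norm_sq] at h3
    have h4 : ‖u‖ ^ 2 ≤ 0 := by
      by_contra hc
      have := mul_pos hpos (not_le.1 hc)
      linarith
    have h5 : u = 0 := by
      rw [← norm_eq_zero]
      exact pow_eq_zero_iff two_ne_zero |>.1 (le_antisymm h4 (sq_nonneg _))
    exact sub_eq_zero.1 h5

/-- On the range of `T`, the adjoint expands by at least the smallest non-zero singular value. -/
theorem singularValues_mul_norm_le_norm_adjoint (T : E →ₗ[ℝ] F) (v : E) :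
    T.singularValues (Module.finrank ℝ (LinearMap.range T) - 1) * ‖T v‖
      ≤ ‖LinearMap.adjoint T (T v)‖ := by
  set σ := T.singularValues (Module.finrank ℝ (LinearMap.range T) - 1) with hσ
  have hσ0 : 0 ≤ σ := T.singularValues_nonneg _
  set e := T.isSymmetric_adjoint_comp_self.eigenvectorBasis rfl with he
  have h1 : ∀ i, LinearMap.adjoint T (T (e i)) = (T.singularValues i ^ 2) • e i := fun i => by
    have := T.isSymmetric_adjoint_comp_self.apply_eigenvectorBasis rfl i
    rw [LinearMap.comp_apply, ← T.sq_singularValues_fin rfl i] at this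
    exact this
  have h2 : ∀ i, inner ℝ (e i) (LinearMap.adjoint T (T v))
      = T.singularValues i ^ 2 * inner ℝ (e i) v := fun i => by
    rw [LinearMap.adjoint_inner_right, ← LinearMap.adjoint_inner_left, h1, real_inner_smul_left]
  have h3 : ‖T v‖ ^ 2 = ∑ i : Fin (Module.finrank ℝ E),
      T.singularValues i ^ 2 * (inner ℝ (e i) v) ^ 2 := by
    rw [← real_inner_self_eq_norm_sq, ← LinearMap.adjoint_inner_right, ← e.sum_inner_mul_inner]
    refine Finset.sum_congr rfl fun i _ => ?_
    rw [h2, real_inner_comm]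
    ring
  have h4 : ‖LinearMap.adjoint T (T v)‖ ^ 2
      = ∑ i : Fin (Module.finrank ℝ E),
        T.singularValues i ^ 2 * (T.singularValues i ^ 2 * (inner ℝ (e i) v) ^ 2) := by
    rw [← e.sum_sq_inner_right]
    refine Finset.sum_congr rfl fun i _ => ?_
    rw [h2]
    ring
  refine (sq_le_sq₀ (by positivity) (norm_nonneg _)).1 ?_
  rw [mul_pow, h3, h4, Finset.mul_sum]
  refine Finset.sum_le_sum fun i _ => ?_
  rcases Nat.lt_or_ge i (Module.finrank ℝ (LinearMap.range T)) with hi | hi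
  · have : σ ≤ T.singularValues i := T.singularValues_antitone (by omega)
    gcongr
  · rw [T.singularValues_eq_zero_iff_le_finrank_range.2 hi]
    simp

variable {S : E →ₗ[ℝ] E} {n : ℕ} {e : OrthonormalBasis (Fin n) ℝ E}

theorem inner_apply_eq_sum_singularValues
    (he : ∀ i, S (e i) = S.singularValues i • e i) (hS : S.IsPositive) (v : E) :
    inner ℝ v (S v) = ∑ i : Fin n, S.singularValues i * (inner ℝ (e i) v) ^ 2 := by
  rw [← e.sum_inner_mul_inner]
  refine Finset.sum_congr rfl fun i _ => ?_
  rw [← hS.isSymmetric, he, real_inner_smul_left, real_inner_comm]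
  ring

/-- Courant-Fischer, lower bound. -/
theorem le_singularValues_of_forall_le (hS : S.IsPositive) (V : Submodule ℝ E) {i : ℕ}
    (hi : i < Module.finrank ℝ V) {c : ℝ} (hc : ∀ a ∈ V, c * ‖a‖ ^ 2 ≤ inner ℝ a (S a)) :
    c ≤ S.singularValues i := by
  obtain ⟨e, he⟩ := exists_orthonormalBasis_apply_eq_singularValues S hS rfl
  have hin : i < Module.finrank ℝ E := hi.trans_le (Submodule.finrank_le V)
  -- a vector of `V` orthogonal to the first `i` eigenvectors exists by dimension count
  let f : V →ₗ[ℝ] (Fin i → ℝ) := LinearMap.pi fun j =>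
    (innerₛₗ ℝ (e ⟨j, j.2.trans hin⟩)) ∘ₗ V.subtype
  obtain ⟨a, ha, ha0⟩ := Submodule.exists_mem_ne_zero_of_ne_bot
    (LinearMap.ker_ne_bot_of_finrank_lt (f := f) (by simpa using hi))
  have haz : ∀ j : Fin (Module.finrank ℝ E), (j : ℕ) < i → inner ℝ (e j) (a : E) = 0 :=
    fun j hj => congrFun (LinearMap.mem_ker.1 ha) ⟨j, hj⟩
  have hpos : 0 < ‖(a : E)‖ ^ 2 := by
    have : (a : E) ≠ 0 := fun h => ha0 (Subtype.ext h)
    positivity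
  refine le_of_mul_le_mul_right ?_ hpos
  refine (hc a a.2).trans ?_
  rw [inner_apply_eq_sum_singularValues he hS, ← e.sum_sq_inner_right (a : E), Finset.mul_sum]
  refine Finset.sum_le_sum fun j _ => ?_
  rcases Nat.lt_or_ge j i with hj | hj
  · rw [haz j hj]; simp
  · exact mul_le_mul_of_nonneg_right (S.singularValues_antitone hj) (sq_nonneg _)

/-- Courant-Fischer, upper bound. -/
theorem singularValues_le_of_forall_le (hS : S.IsPositive) (V : Submodule ℝ E) {i : ℕ}
    (hin : i < Module.finrank ℝ E) (hi : Module.finrank ℝ E ≤ Module.finrank ℝ V + i) {c : ℝ}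
    (hc : ∀ a ∈ V, inner ℝ a (S a) ≤ c * ‖a‖ ^ 2) :
    S.singularValues i ≤ c := by
  obtain ⟨e, he⟩ := exists_orthonormalBasis_apply_eq_singularValues S hS rfl
  -- a vector of `V` orthogonal to the last eigenvectors exists by dimension count
  let f : V →ₗ[ℝ] (Fin (Module.finrank ℝ E - 1 - i) → ℝ) := LinearMap.pi fun j =>
    (innerₛₗ ℝ (e ⟨i + 1 + j, by omega⟩)) ∘ₗ V.subtype
  obtain ⟨a, ha, ha0⟩ := Submodule.exists_mem_ne_zero_of_ne_bot
    (LinearMap.ker_ne_bot_of_finrank_lt (f := f) (by simp; omega))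
  have haz : ∀ j : Fin (Module.finrank ℝ E), i < (j : ℕ) → inner ℝ (e j) (a : E) = 0 := by
    intro j hj
    have := congrFun (LinearMap.mem_ker.1 ha) ⟨j - (i + 1), by omega⟩
    have hje : (⟨i + 1 + (j - (i + 1)), by omega⟩ : Fin (Module.finrank ℝ E)) = j :=
      Fin.ext (by simp; omega)
    simpa [f, hje] using this
  have hpos : 0 < ‖(a : E)‖ ^ 2 := by
    have : (a : E) ≠ 0 := fun h => ha0 (Subtype.ext h)
    positivity
  refine le_of_mul_le_mul_right ?_ hpos
  refine le_trans ?_ (hc a a.2)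
  rw [inner_apply_eq_sum_singularValues he hS, ← e.sum_sq_inner_right (a : E), Finset.mul_sum]
  refine Finset.sum_le_sum fun j _ => ?_
  rcases Nat.lt_or_ge i j with hj | hj
  · rw [haz j hj]; simp
  · exact mul_le_mul_of_nonneg_right (S.singularValues_antitone hj) (sq_nonneg _)

end SingularValues

theorem range_toEuclideanLin_finrank {a b : Type*} [Fintype a] [Fintype b] [DecidableEq a]
    [DecidableEq b] (X : Matrix a b ℝ) :
    Module.finrank ℝ (LinearMap.range (Matrix.toEuclideanLin X)) = X.rank := by
  rw [Matrix.rank_eq_finrank_range_toLin X (EuclideanSpace.basisFun a ℝ).toBasis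
    (EuclideanSpace.basisFun b ℝ).toBasis, Matrix.toEuclideanLin_eq_toLin_orthonormal]

theorem sigmaMin_nonneg {a b : Type*} [Fintype a] [Fintype b] [DecidableEq a]
    [DecidableEq b] (X : Matrix a b ℝ) : 0 ≤ sigmaMin X :=
  LinearMap.singularValues_nonneg _ _

theorem sigmaMin_pos {a b : Type*} [Fintype a] [Fintype b] [DecidableEq a]
    [DecidableEq b] (X : Matrix a b ℝ) (h : 0 < X.rank) : 0 < sigmaMin X := by
  rw [sigmaMin, singVal, LinearMap.singularValues_pos_iff_lt_finrank_range,
    range_toEuclideanLin_finrank]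
  omega

theorem sigmaMin_mul_norm_le {a b : Type*} [Fintype a] [Fintype b] [DecidableEq a]
    [DecidableEq b] (X : Matrix a b ℝ) (y : EuclideanSpace ℝ a)
    (hy : y ∈ LinearMap.range (Matrix.toEuclideanLin X)) :
    sigmaMin X * ‖y‖ ≤ ‖Matrix.toEuclideanLin Xᵀ y‖ := by
  obtain ⟨v, rfl⟩ := hy
  have h := singularValues_mul_norm_le_norm_adjoint (Matrix.toEuclideanLin X) v
  rw [range_toEuclideanLin_finrank, ← Matrix.toEuclideanLin_conjTranspose_eq_adjoint,
    Matrix.conjTranspose_eq_transpose_of_trivial] at h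
  exact h

theorem isPositive_toEuclideanLin {a : Type*} [Fintype a] [DecidableEq a] {X : Matrix a a ℝ}
    (hX : X.PosSemidef) : (Matrix.toEuclideanLin X).IsPositive :=
  Matrix.isPositive_toEuclideanLin_iff.2 hX

theorem sigmaMin_mul_norm_sq_le {m : ℕ} {X : Matrix (Fin m) (Fin m) ℝ} (hX : X.PosDef)
    (v : EuclideanSpace ℝ (Fin m)) :
    sigmaMin X * ‖v‖ ^ 2 ≤ inner ℝ v (Matrix.toEuclideanLin X v) := by
  have hpos := isPositive_toEuclideanLin hX.posSemidef
  obtain ⟨e, he⟩ := exists_orthonormalBasis_apply_eq_singularValues _ hpos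
    (finrank_euclideanSpace_fin (𝕜 := ℝ) (n := m))
  rw [inner_apply_eq_sum_singularValues he hpos, ← e.sum_sq_inner_right v, Finset.mul_sum]
  refine Finset.sum_le_sum fun i _ => ?_
  refine mul_le_mul_of_nonneg_right ?_ (sq_nonneg _)
  rw [sigmaMin, singVal, Matrix.rank_of_isUnit X hX.isUnit, Fintype.card_fin]
  exact LinearMap.singularValues_antitone _ (by omega)

/-! ### Signal plus noise: rank estimation and eigenspace perturbation -/

/-- Samples `y i = z i + η i` in a Euclidean space, the signals `z i` lying in the subspace `V`, for
which the three regularity estimates behind the perturbation analysis hold: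
* the signal Gram form is at least `μ₀` on `V`;
* the signal-noise cross term is bounded *relative to the size of the signal form*, so that no upper
  bound on the signal enters;
* the noise Gram form is within `ν` of the multiple `m` of the identity. -/
structure SampleRegularity {E I : Type*} [NormedAddCommGroup E] [InnerProductSpace ℝ E] [Fintype I]
    (V : Submodule ℝ E) (z η : I → E) (μ₀ s m ν : ℝ) : Prop where
  signal_mem : ∀ i, z i ∈ V
  signal_lower : ∀ a ∈ V, μ₀ * ‖a‖ ^ 2 ≤ ∑ i, (inner ℝ (z i) a) ^ 2
  cross : ∀ a b : E, |∑ i, inner ℝ (z i) a * inner ℝ (η i) b|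
    ≤ s * √(∑ i, (inner ℝ (z i) a) ^ 2) * ‖b‖
  noise : ∀ a b : E, |∑ i, inner ℝ (η i) a * inner ℝ (η i) b - m * inner ℝ a b|
    ≤ ν * ‖a‖ * ‖b‖

namespace SampleRegularity

variable {E I : Type*} [NormedAddCommGroup E] [InnerProductSpace ℝ E] [Fintype I]
  {V : Submodule ℝ E} {z η : I → E} {μ₀ s m ν : ℝ} {S : E →ₗ[ℝ] E}

theorem gram_lower (h : SampleRegularity V z η μ₀ s m ν)
    (hS : ∀ v w, inner ℝ v (S w) = ∑ i, inner ℝ (z i + η i) v * inner ℝ (z i + η i) w) (v : E) :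
    ∑ i, (inner ℝ (z i) v) ^ 2 - 2 * (s * √(∑ i, (inner ℝ (z i) v) ^ 2) * ‖v‖)
      + (m - ν) * ‖v‖ ^ 2 ≤ inner ℝ v (S v) := by
  have h1 : inner ℝ v (S v) = ∑ i, (inner ℝ (z i) v) ^ 2
      + 2 * ∑ i, inner ℝ (z i) v * inner ℝ (η i) v + ∑ i, inner ℝ (η i) v * inner ℝ (η i) v := by
    rw [hS, Finset.mul_sum, ← Finset.sum_add_distrib, ← Finset.sum_add_distrib]
    refine Finset.sum_congr rfl fun i _ => ?_
    rw [inner_add_left]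
    ring
  have h2 := (abs_le.1 (h.cross v v)).1
  have h3 := (abs_le.1 (h.noise v v)).1
  rw [real_inner_self_eq_norm_sq] at h3
  rw [h1]
  nlinarith

theorem isPositive
    (hS : ∀ v w, inner ℝ v (S w) = ∑ i, inner ℝ (z i + η i) v * inner ℝ (z i + η i) w) :
    S.IsPositive := by
  refine ⟨fun v w => ?_, fun v => ?_⟩
  · rw [real_inner_comm, hS, hS]
    exact Finset.sum_congr rfl fun i _ => mul_comm _ _
  · rw [real_inner_comm, hS]
    exact Finset.sum_nonneg fun i _ => mul_self_nonneg _

/-- The singular values indexed by the dimension of `V` are large. -/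
theorem le_singularValues [FiniteDimensional ℝ E] (h : SampleRegularity V z η μ₀ s m ν)
    (hS : ∀ v w, inner ℝ v (S w) = ∑ i, inner ℝ (z i + η i) v * inner ℝ (z i + η i) w)
    (hs : 0 ≤ s) (hsμ : 64 * s ^ 2 ≤ μ₀) (hν : 4 * ν ≤ μ₀) {i : ℕ}
    (hi : i < Module.finrank ℝ V) : m + μ₀ / 2 ≤ S.singularValues i := by
  refine le_singularValues_of_forall_le (isPositive hS) V hi fun a ha => ?_
  refine le_trans ?_ (h.gram_lower hS a)
  have h1 := h.signal_lower a ha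
  set W := ∑ i, (inner ℝ (z i) a) ^ 2 with hW
  have hW0 : 0 ≤ W := Finset.sum_nonneg fun i _ => sq_nonneg _
  have h2 : s * ‖a‖ ≤ √W / 8 := by
    refine (sq_le_sq₀ (by positivity) (by positivity)).1 ?_
    rw [div_pow, Real.sq_sqrt hW0]
    nlinarith [mul_le_mul_of_nonneg_right hsμ (sq_nonneg ‖a‖)]
  have h3 : s * √W * ‖a‖ ≤ W / 8 := by
    have := mul_le_mul_of_nonneg_right h2 (Real.sqrt_nonneg W)
    nlinarith [Real.mul_self_sqrt hW0]
  nlinarith [mul_le_mul_of_nonneg_right hν (sq_nonneg ‖a‖)]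

/-- The remaining singular values are close to `m`. -/
theorem singularValues_mem [FiniteDimensional ℝ E] (h : SampleRegularity V z η μ₀ s m ν)
    (hS : ∀ v w, inner ℝ v (S w) = ∑ i, inner ℝ (z i + η i) v * inner ℝ (z i + η i) w)
    {i : ℕ} (hi : Module.finrank ℝ V ≤ i) (hin : i < Module.finrank ℝ E) :
    m - s ^ 2 - ν ≤ S.singularValues i ∧ S.singularValues i ≤ m + ν := by
  constructor
  · refine le_singularValues_of_forall_le (isPositive hS) ⊤ (by simpa using hin) fun a _ => ?_
    refine le_trans ?_ (h.gram_lower hS a)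
    set W := ∑ i, (inner ℝ (z i) a) ^ 2 with hW
    have hW0 : 0 ≤ W := Finset.sum_nonneg fun i _ => sq_nonneg _
    nlinarith [Real.sq_sqrt hW0, sq_nonneg (√W - s * ‖a‖)]
  · have hdim := V.finrank_add_finrank_orthogonal
    refine singularValues_le_of_forall_le (isPositive hS) Vᗮ hin (by omega) fun a ha => ?_
    have hza : ∀ i, inner ℝ (z i) a = 0 := fun i =>
      Submodule.inner_right_of_mem_orthogonal (h.signal_mem i) ha
    have h1 : inner ℝ a (S a) = ∑ i, inner ℝ (η i) a * inner ℝ (η i) a := by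
      rw [hS]
      refine Finset.sum_congr rfl fun i _ => ?_
      rw [inner_add_left, hza, zero_add]
    have h3 := (abs_le.1 (h.noise a a)).2
    rw [real_inner_self_eq_norm_sq] at h3
    rw [h1]
    nlinarith

/-- Perturbation of the leading eigenspace: combinations of orthonormal eigenvectors for eigenvalues
at least `m + μ₀ / 2` have a small component orthogonal to `V`.

With `v = ∑ j, b j / (θ j - m) • φ j` one has `(S - m) v = ∑ j, b j • φ j`, and a vector orthogonal
to `V` only sees the noise contributions to `(S - m) v`. The cross term is controlled by the signal
form at `v`, which in turn is bounded by the quadratic form of `S - m` at `v`. -/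
theorem inner_eigenvectors_le (h : SampleRegularity V z η μ₀ s m ν)
    (hS : ∀ v w, inner ℝ v (S w) = ∑ i, inner ℝ (z i + η i) v * inner ℝ (z i + η i) w)
    (hμ : 0 < μ₀) (hs : 0 ≤ s) (hsμ : 64 * s ^ 2 ≤ μ₀) (hν : 4 * ν ≤ μ₀) (hν0 : 0 ≤ ν) {p : ℕ}
    {φ : Fin p → E} (hφ : Orthonormal ℝ φ) {θ : Fin p → ℝ} (hθ : ∀ j, m + μ₀ / 2 ≤ θ j)
    (hφθ : ∀ j, S (φ j) = θ j • φ j) {e : E} (he : e ∈ Vᗮ) (b : EuclideanSpace ℝ (Fin p)) :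
    inner ℝ e (∑ j, b j • φ j) ≤ (2 * s / √(μ₀ / 2) + ν / (μ₀ / 2)) * ‖e‖ * ‖b‖ := by
  set μ := μ₀ / 2 with hμdef
  have hμp : 0 < μ := by positivity
  have hθm : ∀ j, μ ≤ θ j - m := fun j => by linarith [hθ j]
  have hθp : ∀ j, 0 < θ j - m := fun j => hμp.trans_le (hθm j)
  set v : E := ∑ j, (b j / (θ j - m)) • φ j with hv
  have hSv : S v = m • v + ∑ j, b j • φ j := by
    rw [hv, map_sum, Finset.smul_sum, ← Finset.sum_add_distrib]
    refine Finset.sum_congr rfl fun j _ => ?_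
    rw [map_smul, hφθ, smul_smul, smul_smul, ← add_smul]
    congr 1
    have := (hθp j).ne'
    field_simp
    ring
  have hb2 : ‖b‖ ^ 2 = ∑ j, b j ^ 2 := EuclideanSpace.real_norm_sq_eq b
  have hvn : ‖v‖ ^ 2 ≤ ‖b‖ ^ 2 / μ ^ 2 := by
    have : ‖v‖ ^ 2 = ∑ j, (b j / (θ j - m)) ^ 2 := by
      rw [← real_inner_self_eq_norm_sq, hv, hφ.inner_sum]
      simp [pow_two]
    rw [this, hb2, Finset.sum_div]
    refine Finset.sum_le_sum fun j _ => ?_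
    rw [div_pow]
    have := hθm j
    gcongr
  have hvn' : ‖v‖ ≤ ‖b‖ / μ := by
    refine (sq_le_sq₀ (norm_nonneg _) (by positivity)).1 ?_
    rwa [div_pow]
  have hvS : inner ℝ v (S v) ≤ m * ‖v‖ ^ 2 + ‖b‖ ^ 2 / μ := by
    rw [hSv, inner_add_right, real_inner_smul_right, real_inner_self_eq_norm_sq]
    gcongr
    rw [hv, hφ.inner_sum, hb2, Finset.sum_div]
    refine Finset.sum_le_sum fun j _ => ?_
    simp only [conj_trivial]
    rw [div_mul_eq_mul_div, ← pow_two]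
    have := hθm j
    gcongr
  have hlow := h.gram_lower hS v
  set W := ∑ i, (inner ℝ (z i) v) ^ 2 with hW
  have hW0 : 0 ≤ W := Finset.sum_nonneg fun i _ => sq_nonneg _
  have hWb : W ≤ 4 * (‖b‖ ^ 2 / μ) := by
    have e1 : ν * ‖v‖ ^ 2 ≤ (‖b‖ ^ 2 / μ) / 2 := by
      calc ν * ‖v‖ ^ 2 ≤ (μ / 2) * (‖b‖ ^ 2 / μ ^ 2) := by
            gcongr; linarith
        _ = (‖b‖ ^ 2 / μ) / 2 := by field_simp
    have e2 : s ^ 2 * ‖v‖ ^ 2 ≤ (‖b‖ ^ 2 / μ) / 32 := by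
      calc s ^ 2 * ‖v‖ ^ 2 ≤ (μ / 32) * (‖b‖ ^ 2 / μ ^ 2) := by
            gcongr; linarith
        _ = (‖b‖ ^ 2 / μ) / 32 := by field_simp
    nlinarith [Real.sq_sqrt hW0, sq_nonneg (√W - 2 * (s * ‖v‖))]
  have hWs : √W ≤ 2 * (‖b‖ / √μ) := by
    refine Real.sqrt_le_iff.2 ⟨by positivity, ?_⟩
    rw [mul_pow, div_pow, Real.sq_sqrt hμp.le]
    linarith
  have hze : ∀ i, inner ℝ (z i) e = 0 := fun i =>
    Submodule.inner_right_of_mem_orthogonal (h.signal_mem i) he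
  have hmain : inner ℝ e (∑ j, b j • φ j) = ∑ i, inner ℝ (z i) v * inner ℝ (η i) e
      + (∑ i, inner ℝ (η i) e * inner ℝ (η i) v - m * inner ℝ e v) := by
    have e1 : ∑ j, b j • φ j = S v - m • v := by rw [hSv]; abel
    rw [e1, inner_sub_right, hS, real_inner_smul_right, ← add_sub_assoc, ← Finset.sum_add_distrib]
    congr 1
    refine Finset.sum_congr rfl fun i _ => ?_
    rw [inner_add_left, inner_add_left, hze, zero_add]
    ring
  rw [hmain]
  have c1 := (le_abs_self _).trans (h.cross v e)
  have c2 := (le_abs_self _).trans (h.noise e v)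
  rw [← hW] at c1
  calc _ ≤ s * √W * ‖e‖ + ν * ‖e‖ * ‖v‖ := add_le_add c1 c2
    _ ≤ s * (2 * (‖b‖ / √μ)) * ‖e‖ + ν * ‖e‖ * (‖b‖ / μ) := by gcongr
    _ = _ := by ring

end SampleRegularity

/-- The rank estimator finds the dimension of the signal subspace. -/
theorem rankEst_eq_of_gap {n d : ℕ} (X : Matrix (Fin n) (Fin n) ℝ) (τ : ℕ) (hd : 1 ≤ d)
    (hdn : d ≤ n - 1) {lo hi : ℝ} (hgap : (τ : ℝ) ^ (3 / 4 : ℝ) < singVal X (d - 1) - hi)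
    (hbulk : hi - lo ≤ (τ : ℝ) ^ (3 / 4 : ℝ))
    (hmem : ∀ i, d ≤ i → i < n → lo ≤ singVal X i ∧ singVal X i ≤ hi) :
    rankEst X τ = d := by
  classical
  rw [rankEst, Nat.findGreatest_eq_iff]
  refine ⟨hdn, fun _ => ?_, fun k hk hkn => ?_⟩
  · have := (hmem d le_rfl (by omega)).2
    linarith
  · have h1 := (hmem (k - 1) (by omega) (by omega)).2
    have h2 := (hmem k (by omega) (by omega)).1
    linarith

/-- If an isometric image of `ℝᵈ` is within angle `ε ≤ 1/2` of the `d`-dimensional subspace `V`,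
then projecting `V` on it is injective and loses little. -/
theorem norm_sub_proj_le_of_close {E : Type*} [NormedAddCommGroup E] [InnerProductSpace ℝ E]
    [FiniteDimensional ℝ E] (V : Submodule ℝ E) {d : ℕ} (hd : Module.finrank ℝ V = d)
    (Φ : EuclideanSpace ℝ (Fin d) →ₗ[ℝ] E)
    (hΦ : ∀ b, LinearMap.adjoint Φ (Φ b) = b) {ε : ℝ} (hε0 : 0 ≤ ε) (hε : ε ≤ 1 / 2)
    (hclose : ∀ e ∈ Vᗮ, ∀ b, inner ℝ e (Φ b) ≤ ε * ‖e‖ * ‖b‖) {x : E} (hx : x ∈ V) :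
    ‖x - Φ (LinearMap.adjoint Φ x)‖ ≤ 2 * ε * ‖LinearMap.adjoint Φ x‖ ∧
      (LinearMap.adjoint Φ x = 0 → x = 0) := by
  have hiso : ∀ b, ‖Φ b‖ = ‖b‖ := fun b => by
    have : ‖Φ b‖ ^ 2 = ‖b‖ ^ 2 := by
      rw [← real_inner_self_eq_norm_sq, ← LinearMap.adjoint_inner_right, hΦ,
        real_inner_self_eq_norm_sq]
    exact (pow_left_inj₀ (norm_nonneg _) (norm_nonneg _) two_ne_zero).1 this
  have hadj : ∀ y, ‖LinearMap.adjoint Φ y‖ ≤ ‖y‖ := fun y => by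
    have h1 : ‖LinearMap.adjoint Φ y‖ ^ 2 ≤ ‖LinearMap.adjoint Φ y‖ * ‖y‖ := by
      rw [← real_inner_self_eq_norm_sq, LinearMap.adjoint_inner_right]
      refine (real_inner_le_norm _ _).trans ?_
      rw [hiso]
    rcases (norm_nonneg (LinearMap.adjoint Φ y)).eq_or_lt with h0 | h0
    · rw [← h0]; exact norm_nonneg _
    · rw [pow_two] at h1
      exact le_of_mul_le_mul_left h1 h0
  have hcontr : ∀ y, ‖y - Φ (LinearMap.adjoint Φ y)‖ ≤ ‖y‖ := fun y => by
    refine (sq_le_sq₀ (norm_nonneg _) (norm_nonneg _)).1 ?_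
    rw [norm_sub_sq_real, ← LinearMap.adjoint_inner_left, real_inner_self_eq_norm_sq, hiso]
    nlinarith [sq_nonneg ‖LinearMap.adjoint Φ y‖]
  have hperp : ∀ b, ‖Φ b - V.starProjection (Φ b)‖ ≤ ε * ‖b‖ := fun b => by
    set e := Φ b - V.starProjection (Φ b) with he
    have hmem : e ∈ Vᗮ := V.sub_starProjection_mem_orthogonal (Φ b)
    have h1 : inner ℝ e (Φ b) = ‖e‖ ^ 2 := by
      have e1 : Φ b = e + V.starProjection (Φ b) := by rw [he]; abel
      rw [e1, inner_add_right, real_inner_self_eq_norm_sq,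
        Submodule.inner_left_of_mem_orthogonal (V.starProjection_apply_mem _) hmem, add_zero]
    have h2 := hclose e hmem b
    rw [h1] at h2
    rcases (norm_nonneg e).eq_or_lt with h0 | h0
    · rw [← h0]; positivity
    · rw [mul_right_comm, pow_two] at h2
      exact le_of_mul_le_mul_right h2 h0
  -- the projection of the frame to `V` is injective, hence onto by dimension
  set f : EuclideanSpace ℝ (Fin d) →ₗ[ℝ] V := (V.orthogonalProjectionOnto : E →ₗ[ℝ] V) ∘ₗ Φ with hf
  have hfapp : ∀ b, (f b : E) = V.starProjection (Φ b) := fun b => rfl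
  have hinj : Function.Injective f := by
    rw [← LinearMap.ker_eq_bot, LinearMap.ker_eq_bot']
    intro b hb
    have h1 := hperp b
    rw [← hfapp, hb, ZeroMemClass.coe_zero, sub_zero, hiso] at h1
    have h2 := mul_le_mul_of_nonneg_right hε (norm_nonneg b)
    have h3 : ‖b‖ = 0 := by linarith [norm_nonneg b]
    exact norm_eq_zero.1 h3
  have hsurj : Function.Surjective f :=
    (LinearMap.injective_iff_surjective_of_finrank_eq_finrank (by simp [hd])).1 hinj
  obtain ⟨b, hb⟩ := hsurj ⟨x, hx⟩
  set e := Φ b - V.starProjection (Φ b) with he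
  have hxe : x = Φ b - e := by
    rw [he, ← hfapp, hb]
    abel
  have he2 : ‖e‖ ≤ ε * ‖b‖ := hperp b
  have hax : LinearMap.adjoint Φ x = b - LinearMap.adjoint Φ e := by rw [hxe, map_sub, hΦ]
  have hlow : ‖b‖ ≤ 2 * ‖LinearMap.adjoint Φ x‖ := by
    rw [hax]
    have h1 := norm_sub_norm_le b (LinearMap.adjoint Φ e)
    have h2 := hadj e
    have h3 := mul_le_mul_of_nonneg_right hε (norm_nonneg b)
    linarith
  constructor
  · have h1 : x - Φ (LinearMap.adjoint Φ x) = -(e - Φ (LinearMap.adjoint Φ e)) := by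
      rw [hax, hxe, map_sub]
      abel
    rw [h1, norm_neg]
    refine (hcontr e).trans (he2.trans ?_)
    nlinarith
  · intro h0
    rw [h0, norm_zero, mul_zero] at hlow
    have hb0 : b = 0 := norm_le_zero_iff.1 hlow
    rw [hxe, norm_le_zero_iff.1 (he2.trans (by rw [hb0]; simp)), hb0]
    simp

/-! ### Uniform estimates for Gaussian noise and Gaussian signals -/

section InnerVec

variable {Ω E I : Type*} [NormedAddCommGroup Ω] [NormedSpace ℝ Ω] [NormedAddCommGroup E]
  [InnerProductSpace ℝ E]

/-- The vector of coordinates `⟪x i, a⟫`, as a continuous linear map of the random parameter. -/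
noncomputable def innerVec (x : I → Ω →L[ℝ] E) (a : E) : Ω →L[ℝ] EuclideanSpace ℝ I :=
  (EuclideanSpace.equiv I ℝ).symm.toContinuousLinearMap.comp
    (ContinuousLinearMap.pi fun i => (innerSL ℝ a).comp (x i))

theorem innerVec_apply (x : I → Ω →L[ℝ] E) (a : E) (ω : Ω) (i : I) :
    innerVec x a ω i = inner ℝ (x i ω) a := real_inner_comm _ _

variable [Fintype I]

theorem inner_innerVec (x : I → Ω →L[ℝ] E) (a : E) (b : EuclideanSpace ℝ I) (ω : Ω) :
    inner ℝ b (innerVec x a ω) = ∑ i, b i * inner ℝ (x i ω) a := by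
  rw [PiLp.inner_apply]
  refine Finset.sum_congr rfl fun i _ => ?_
  rw [innerVec_apply]
  exact mul_comm _ _

theorem norm_sq_innerVec (x : I → Ω →L[ℝ] E) (a : E) (ω : Ω) :
    ‖innerVec x a ω‖ ^ 2 = ∑ i, (inner ℝ (x i ω) a) ^ 2 := by
  rw [EuclideanSpace.real_norm_sq_eq]
  simp_rw [innerVec_apply]

end InnerVec

/-- The linear map sending `a` to the vector of coordinates `⟪x i, a⟫`. -/
noncomputable def coordMap {E I : Type*} [NormedAddCommGroup E] [InnerProductSpace ℝ E]
    [Fintype I] (x : I → E) : E →ₗ[ℝ] EuclideanSpace ℝ I :=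
  (EuclideanSpace.equiv I ℝ).symm.toLinearMap ∘ₗ LinearMap.pi fun i => innerₛₗ ℝ (x i)

theorem coordMap_apply {E I : Type*} [NormedAddCommGroup E] [InnerProductSpace ℝ E]
    [Fintype I] (x : I → E) (a : E) (i : I) : coordMap x a i = inner ℝ (x i) a := rfl

theorem norm_coordMap {E I : Type*} [NormedAddCommGroup E] [InnerProductSpace ℝ E]
    [Fintype I] (x : I → E) (a : E) : ‖coordMap x a‖ = √(∑ i, (inner ℝ (x i) a) ^ 2) := by
  rw [EuclideanSpace.norm_eq]
  simp [coordMap_apply]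

section Uniform

variable {Ω : Type*} [NormedAddCommGroup Ω] [NormedSpace ℝ Ω] [MeasurableSpace Ω] [BorelSpace Ω]
  {P : Measure Ω} {I : Type*} [Fintype I] {E : Type*} [NormedAddCommGroup E]
  [InnerProductSpace ℝ E]

theorem map_eq_gaussianReal_of_mean_zero [IsGaussian P]
    (hmean : ∀ L : Ω →L[ℝ] ℝ, ∫ ω, L ω ∂P = 0)
    (L : Ω →L[ℝ] ℝ) : P.map L = gaussianReal 0 (∫ ω, L ω ^ 2 ∂P).toNNReal := by
  rw [IsGaussian.map_eq_gaussianReal L, hmean,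
    variance_of_integral_eq_zero L.continuous.aemeasurable (hmean L)]

theorem integral_inner_map_innerVec (hmean : ∀ L : Ω →L[ℝ] ℝ, ∫ ω, L ω ∂P = 0)
    (x : I → Ω →L[ℝ] E) (a : E) (b : EuclideanSpace ℝ I) :
    ∫ y, inner ℝ b y ∂(P.map (innerVec x a)) = 0 := by
  rw [integral_map (innerVec x a).continuous.aemeasurable (by fun_prop)]
  exact hmean ((innerSL ℝ b).comp (innerVec x a))

theorem integral_inner_sq_map_innerVec (x : I → Ω →L[ℝ] E) (a : E) (b : EuclideanSpace ℝ I) :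
    ∫ y, (inner ℝ b y) ^ 2 ∂(P.map (innerVec x a))
      = ∫ ω, (∑ i, b i * inner ℝ (x i ω) a) ^ 2 ∂P := by
  rw [integral_map (innerVec x a).continuous.aemeasurable (by fun_prop)]
  simp only [inner_innerVec]

theorem integrable_inner_sq [IsGaussian P] (x : Ω →L[ℝ] E) (a : E) :
    Integrable (fun ω => (inner ℝ (x ω) a) ^ 2) P := by
  have := (IsGaussian.memLp_dual P ((innerSL ℝ a).comp x) 2 (by simp)).integrable_sq
  refine this.congr (Filter.Eventually.of_forall fun ω => ?_)
  simp [real_inner_comm]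

variable [IsGaussian P]

theorem integral_norm_sq_map_innerVec (x : I → Ω →L[ℝ] E) (a : E) :
    ∫ y, ‖y‖ ^ 2 ∂(P.map (innerVec x a)) = ∑ i, ∫ ω, (inner ℝ (x i ω) a) ^ 2 ∂P := by
  rw [integral_map (innerVec x a).continuous.aemeasurable (by fun_prop)]
  simp_rw [norm_sq_innerVec]
  exact integral_finsetSum _ fun i _ => integrable_inner_sq (x i) a

/-- White-noise bound for the cross term, for fixed signals: the coefficient vectors `(⟪z i, a⟫)_i`
range over a subspace of dimension at most `dim E`, so that two half-nets suffice. -/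
theorem measure_cross_le [FiniteDimensional ℝ E] (hmean : ∀ L : Ω →L[ℝ] ℝ, ∫ ω, L ω ∂P = 0)
    (η : I → Ω →L[ℝ] E) (v : I → ℝ)
    (hη : ∀ g : I → E, ∫ ω, (∑ i, inner ℝ (η i ω) (g i)) ^ 2 ∂P = ∑ i, v i * ‖g i‖ ^ 2)
    {lam : ℝ} (hlam : 0 < lam) (hv : ∀ i, v i ≤ lam) (z : I → E) {t : ℝ} (ht : 0 ≤ t) :
    P.real {ω | ¬ ∀ a b : E, |∑ i, inner ℝ (z i) a * inner ℝ (η i ω) b|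
        ≤ 4 * t * √(∑ i, (inner ℝ (z i) a) ^ 2) * ‖b‖}
      ≤ 25 ^ Module.finrank ℝ E * (2 * Real.exp (-(t ^ 2 / (2 * lam)))) := by
  classical
  set U := LinearMap.range (coordMap z) with hU
  obtain ⟨su, hsu1, hsu2, hsu3⟩ := exists_half_net U
  obtain ⟨se, hse1, hse2, hse3⟩ := exists_half_net E
  have hdimU : Module.finrank ℝ U ≤ Module.finrank ℝ E := LinearMap.finrank_range_le _
  have hsub : {ω | ¬ ∀ a b : E, |∑ i, inner ℝ (z i) a * inner ℝ (η i ω) b|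
        ≤ 4 * t * √(∑ i, (inner ℝ (z i) a) ^ 2) * ‖b‖}
      ⊆ ⋃ p ∈ su ×ˢ se, {ω | t ≤ |∑ i, inner ℝ (η i ω) ((p.1 : EuclideanSpace ℝ I) i • p.2)|} := by
    intro ω hω
    by_contra hc
    refine hω fun a b => ?_
    let B : U →ₗ[ℝ] E →ₗ[ℝ] ℝ :=
      LinearMap.mk₂ ℝ (fun (u : U) (b : E) => ∑ i, (u : EuclideanSpace ℝ I) i * inner ℝ (η i ω) b)
        (fun u u' b => by simp [add_mul, Finset.sum_add_distrib])
        (fun r u b => by simp [Finset.mul_sum, mul_assoc])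
        (fun u b b' => by simp [inner_add_right, mul_add, Finset.sum_add_distrib])
        (fun r u b => by simp [real_inner_smul_right, Finset.mul_sum, mul_left_comm])
    have hB : ∀ x ∈ su, ∀ y ∈ se, |B x y| ≤ t := by
      intro x hx y hy
      by_contra hlt
      refine hc (Set.mem_biUnion (Finset.mk_mem_product hx hy) ?_)
      have : B x y = ∑ i, inner ℝ (η i ω) ((x : EuclideanSpace ℝ I) i • y) := by
        simp [B, real_inner_smul_right]
      rw [this] at hlt
      exact (not_le.1 hlt).le
    have := abs_bilin_le_of_half_nets B su se hsu3 hse3 hB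
      ⟨coordMap z a, LinearMap.mem_range_self _ _⟩ b
    rw [Submodule.coe_norm, norm_coordMap] at this
    exact this
  refine (measureReal_mono hsub (measure_ne_top _ _)).trans
    ((measureReal_biUnion_finset_le _ _).trans ?_)
  have hpt : ∀ p ∈ su ×ˢ se,
      P.real {ω | t ≤ |∑ i, inner ℝ (η i ω) ((p.1 : EuclideanSpace ℝ I) i • p.2)|}
        ≤ 2 * Real.exp (-(t ^ 2 / (2 * lam))) := by
    intro p hp
    obtain ⟨hp1, hp2⟩ := Finset.mem_product.1 hp
    let L : Ω →L[ℝ] ℝ := ∑ i, (innerSL ℝ ((p.1 : EuclideanSpace ℝ I) i • p.2)).comp (η i)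
    have hL : ∀ ω, L ω = ∑ i, inner ℝ (η i ω) ((p.1 : EuclideanSpace ℝ I) i • p.2) := by
      intro ω
      simp only [L, sum_apply]
      exact Finset.sum_congr rfl fun i _ => real_inner_comm _ _
    have hvar : ((∫ ω, L ω ^ 2 ∂P).toNNReal : ℝ) ≤ lam := by
      rw [Real.coe_toNNReal _ (integral_nonneg fun ω => sq_nonneg _)]
      simp_rw [hL]
      rw [hη]
      have h1 : ‖(p.1 : EuclideanSpace ℝ I)‖ ^ 2 ≤ 1 := by
        have := hsu2 p.1 hp1
        rw [Submodule.coe_norm] at this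
        exact pow_le_one₀ (norm_nonneg _) this
      have h2 : ‖p.2‖ ^ 2 ≤ 1 := pow_le_one₀ (norm_nonneg _) (hse2 p.2 hp2)
      calc ∑ i, v i * ‖(p.1 : EuclideanSpace ℝ I) i • p.2‖ ^ 2
          ≤ ∑ i, lam * ((p.1 : EuclideanSpace ℝ I) i) ^ 2 := by
            refine Finset.sum_le_sum fun i _ => ?_
            rw [norm_smul, mul_pow, Real.norm_eq_abs, sq_abs]
            refine mul_le_mul (hv i) ?_ (by positivity) hlam.le
            exact mul_le_of_le_one_right (sq_nonneg _) h2
        _ = lam * ‖(p.1 : EuclideanSpace ℝ I)‖ ^ 2 := by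
            rw [← Finset.mul_sum, EuclideanSpace.real_norm_sq_eq]
        _ ≤ lam := mul_le_of_le_one_right hlam.le h1
    have := measure_abs_ge_le_of_map_gaussianReal P _ (map_eq_gaussianReal_of_mean_zero hmean L)
      hlam hvar ht
    simp_rw [hL] at this
    exact this
  refine (Finset.sum_le_card_nsmul _ _ _ hpt).trans ?_
  rw [nsmul_eq_mul]
  refine mul_le_mul_of_nonneg_right ?_ (by positivity)
  rw [Finset.card_product]
  have h5 : su.card ≤ 5 ^ Module.finrank ℝ E :=
    hsu1.trans (Nat.pow_le_pow_right (by norm_num) hdimU)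
  have : su.card * se.card ≤ 25 ^ Module.finrank ℝ E := by
    calc su.card * se.card ≤ 5 ^ Module.finrank ℝ E * 5 ^ Module.finrank ℝ E :=
          Nat.mul_le_mul h5 hse1
      _ = 25 ^ Module.finrank ℝ E := by rw [← mul_pow]; norm_num
  exact_mod_cast this

/-- Concentration of the noise Gram form around a multiple of the identity, in operator norm, by
polarization on pairs of points of a half-net. -/
theorem measure_noise_le [FiniteDimensional ℝ E] (hmean : ∀ L : Ω →L[ℝ] ℝ, ∫ ω, L ω ∂P = 0)
    (η : I → Ω →L[ℝ] E) (v : I → ℝ)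
    (hη : ∀ g : I → E, ∫ ω, (∑ i, inner ℝ (η i ω) (g i)) ^ 2 ∂P = ∑ i, v i * ‖g i‖ ^ 2)
    (hv0 : ∀ i, 0 ≤ v i) {lam : ℝ} (hlam : 0 < lam) (hv : ∀ i, v i ≤ lam) {τ t : ℝ} (hτ0 : 0 < τ)
    (hτ : ∑ i, v i ≤ τ) (ht : 0 ≤ t) (htτ : t ≤ τ) :
    P.real {ω | ¬ ∀ a b : E, |∑ i, inner ℝ (η i ω) a * inner ℝ (η i ω) b - (∑ i, v i) * inner ℝ a b|
        ≤ 8 * t * ‖a‖ * ‖b‖}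
      ≤ 25 ^ Module.finrank ℝ E * (4 * Real.exp (-(t ^ 2 / (8 * lam * τ)))) := by
  classical
  obtain ⟨s, hs1, hs2, hs3⟩ := exists_half_net E
  let Q : Ω → E → ℝ := fun ω c => ∑ i, (inner ℝ (η i ω) c) ^ 2 - (∑ i, v i) * ‖c‖ ^ 2
  have hsub : {ω | ¬ ∀ a b : E,
        |∑ i, inner ℝ (η i ω) a * inner ℝ (η i ω) b - (∑ i, v i) * inner ℝ a b|
          ≤ 8 * t * ‖a‖ * ‖b‖}
      ⊆ ⋃ p ∈ s ×ˢ s, ({ω | t ≤ |Q ω ((1 / 2 : ℝ) • (p.1 + p.2))|}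
          ∪ {ω | t ≤ |Q ω ((1 / 2 : ℝ) • (p.1 - p.2))|}) := by
    intro ω hω
    by_contra hc
    refine hω fun a b => ?_
    let B : E →ₗ[ℝ] E →ₗ[ℝ] ℝ := LinearMap.mk₂ ℝ
      (fun a b => ∑ i, inner ℝ (η i ω) a * inner ℝ (η i ω) b - (∑ i, v i) * inner ℝ a b)
      (fun u u' b => by
        simp only [inner_add_right, inner_add_left, add_mul, mul_add, Finset.sum_add_distrib]; ring)
      (fun r u b => by
        simp only [real_inner_smul_right, real_inner_smul_left, smul_eq_mul, mul_sub,
          Finset.mul_sum, mul_assoc, mul_left_comm, Finset.sum_mul])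
      (fun u b b' => by
        simp only [inner_add_right, mul_add, Finset.sum_add_distrib]; ring)
      (fun r u b => by
        simp only [real_inner_smul_right, smul_eq_mul, mul_sub,
          Finset.mul_sum, mul_left_comm, Finset.sum_mul])
    have hpol : ∀ x y, B x y = Q ω ((1 / 2 : ℝ) • (x + y)) - Q ω ((1 / 2 : ℝ) • (x - y)) := by
      intro x y
      have h1 : ∀ i, inner ℝ (η i ω) x * inner ℝ (η i ω) y
          = (inner ℝ (η i ω) ((1 / 2 : ℝ) • (x + y))) ^ 2
            - (inner ℝ (η i ω) ((1 / 2 : ℝ) • (x - y))) ^ 2 := by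
        intro i
        simp only [real_inner_smul_right, inner_add_right, inner_sub_right]
        ring
      have h2 : inner ℝ x y = ‖(1 / 2 : ℝ) • (x + y)‖ ^ 2 - ‖(1 / 2 : ℝ) • (x - y)‖ ^ 2 := by
        rw [norm_smul, norm_smul, mul_pow, mul_pow, norm_add_sq_real, norm_sub_sq_real]
        norm_num
        ring
      simp only [B, Q, LinearMap.mk₂_apply]
      rw [Finset.sum_congr rfl fun i _ => h1 i, Finset.sum_sub_distrib, h2]
      ring
    have hB : ∀ x ∈ s, ∀ y ∈ s, |B x y| ≤ 2 * t := by
      intro x hx y hy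
      by_contra hlt
      refine hc (Set.mem_biUnion (Finset.mk_mem_product hx hy) ?_)
      by_contra hn
      rw [Set.mem_union, not_or] at hn
      have h1 : |Q ω ((1 / 2 : ℝ) • (x + y))| < t := not_le.1 hn.1
      have h2 : |Q ω ((1 / 2 : ℝ) • (x - y))| < t := not_le.1 hn.2
      refine hlt ?_
      rw [hpol]
      refine (abs_sub _ _).trans ?_
      linarith
    have := abs_bilin_le_of_half_nets B s s hs3 hs3 hB a b
    calc _ = |B a b| := rfl
      _ ≤ _ := this
      _ = _ := by ring
  refine (measureReal_mono hsub (measure_ne_top _ _)).trans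
    ((measureReal_biUnion_finset_le _ _).trans ?_)
  have hpt : ∀ c : E, ‖c‖ ≤ 1 →
      P.real {ω | t ≤ |Q ω c|} ≤ 2 * Real.exp (-(t ^ 2 / (8 * lam * τ))) := by
    intro c hc
    have hc2 : ‖c‖ ^ 2 ≤ 1 := pow_le_one₀ (norm_nonneg _) hc
    have hm : ∫ y, ‖y‖ ^ 2 ∂(P.map (innerVec η c)) = (∑ i, v i) * ‖c‖ ^ 2 := by
      rw [integral_norm_sq_map_innerVec, Finset.sum_mul]
      refine Finset.sum_congr rfl fun i _ => ?_
      have := hη (Pi.single i c)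
      rw [Finset.sum_eq_single i (fun j _ hj => by simp [hj]) (by simp), Pi.single_eq_same] at this
      rw [← this]
      refine integral_congr_ae (Filter.Eventually.of_forall fun ω => ?_)
      simp only
      rw [Finset.sum_eq_single i (fun j _ hj => by simp [hj]) (by simp), Pi.single_eq_same]
    have hsv : 0 ≤ ∑ i, v i := Finset.sum_nonneg fun i _ => hv0 i
    have h1 := measure_normSq_sub_mean_ge_le (P.map (innerVec η c))
      (integral_inner_map_innerVec hmean η c) hlam
      (fun b => by
        simp_rw [integral_inner_sq_map_innerVec, ← real_inner_smul_right]
        rw [hη, EuclideanSpace.real_norm_sq_eq, Finset.mul_sum]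
        refine Finset.sum_le_sum fun i _ => ?_
        rw [norm_smul, mul_pow, Real.norm_eq_abs, sq_abs]
        exact mul_le_mul (hv i) (mul_le_of_le_one_right (sq_nonneg _) hc2) (by positivity) hlam.le)
      (τ := τ) (t := t) (by rw [hm]; exact (mul_le_of_le_one_right hsv hc2).trans hτ) hτ0 ht htτ
    rw [hm, map_measureReal_apply (innerVec η c).continuous.measurable
      (measurableSet_le measurable_const (by fun_prop))] at h1
    refine le_trans (le_of_eq ?_) h1
    congr 1
    ext ω
    simp only [Set.mem_ofPred_eq, Set.mem_preimage, norm_sq_innerVec, Q]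
  have hpt2 : ∀ p ∈ s ×ˢ s, P.real ({ω | t ≤ |Q ω ((1 / 2 : ℝ) • (p.1 + p.2))|}
          ∪ {ω | t ≤ |Q ω ((1 / 2 : ℝ) • (p.1 - p.2))|})
        ≤ 4 * Real.exp (-(t ^ 2 / (8 * lam * τ))) := by
    intro p hp
    obtain ⟨hp1, hp2⟩ := Finset.mem_product.1 hp
    have n1 := hs2 _ hp1
    have n2 := hs2 _ hp2
    have c1 : ‖(1 / 2 : ℝ) • (p.1 + p.2)‖ ≤ 1 := by
      rw [norm_smul, Real.norm_of_nonneg (by norm_num)]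
      linarith [norm_add_le p.1 p.2]
    have c2 : ‖(1 / 2 : ℝ) • (p.1 - p.2)‖ ≤ 1 := by
      rw [norm_smul, Real.norm_of_nonneg (by norm_num)]
      linarith [norm_sub_le p.1 p.2]
    have := measureReal_union_le (μ := P) {ω | t ≤ |Q ω ((1 / 2 : ℝ) • (p.1 + p.2))|}
      {ω | t ≤ |Q ω ((1 / 2 : ℝ) • (p.1 - p.2))|}
    linarith [hpt _ c1, hpt _ c2]
  refine (Finset.sum_le_card_nsmul _ _ _ hpt2).trans ?_
  rw [nsmul_eq_mul]
  refine mul_le_mul_of_nonneg_right ?_ (by positivity)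
  rw [Finset.card_product]
  have : s.card * s.card ≤ 25 ^ Module.finrank ℝ E := by
    calc s.card * s.card ≤ 5 ^ Module.finrank ℝ E * 5 ^ Module.finrank ℝ E :=
          Nat.mul_le_mul hs1 hs1
      _ = 25 ^ Module.finrank ℝ E := by rw [← mul_pow]; norm_num
  exact_mod_cast this

/-- Uniform lower bound for a Gaussian signal form on a subspace. For a fixed direction the form
rarely falls below half of its mean. The bound is transferred from a dyadic net of mesh `2⁻ʲ` to
the unit sphere of `V` by the crude Markov bound on the trace of the form, which only enters
through `j`. -/
theorem measure_signal_le [FiniteDimensional ℝ E] (hmean : ∀ L : Ω →L[ℝ] ℝ, ∫ ω, L ω ∂P = 0)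
    (z : I → Ω →L[ℝ] E) (V : Submodule ℝ E) {Γ μ R : ℝ} (hΓ : 0 < Γ) (hμ : 0 < μ)
    (hup : ∀ (a : E) (b : I → ℝ),
      ∫ ω, (∑ i, b i * inner ℝ (z i ω) a) ^ 2 ∂P ≤ Γ * ‖a‖ ^ 2 * ∑ i, b i ^ 2)
    (hlow : ∀ a ∈ V, μ * ‖a‖ ^ 2 ≤ ∑ i, ∫ ω, (inner ℝ (z i ω) a) ^ 2 ∂P)
    (hR : 0 < R) {j : ℕ} (hj : 1 ≤ j) (hRj : 32 * R ≤ 4 ^ j * μ) :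
    P.real {ω | ¬ ∀ a ∈ V, μ / 32 * ‖a‖ ^ 2 ≤ ∑ i, (inner ℝ (z i ω) a) ^ 2}
      ≤ Fintype.card I * Module.finrank ℝ E * Γ / R
        + 5 ^ (j * Module.finrank ℝ V) * Real.exp (-(μ / (32 * Γ))) := by
  classical
  obtain ⟨s, hs1, hs2⟩ := exists_dyadic_net V j
  set e := stdOrthonormalBasis ℝ E with he
  let tr : Ω → ℝ := fun ω => ∑ i, ∑ l, (inner ℝ (z i ω) (e l)) ^ 2
  -- only net points of norm at least `1 / 2` approximate unit vectors
  let good : Finset V := s.filter fun y => y ≠ 0 ∧ 1 / 2 ≤ ‖y‖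
  let tm : V → ℝ := fun y => ∑ i, ∫ ω, (inner ℝ (z i ω) (y : E)) ^ 2 ∂P
  have hsub : {ω | ¬ ∀ a ∈ V, μ / 32 * ‖a‖ ^ 2 ≤ ∑ i, (inner ℝ (z i ω) a) ^ 2}
      ⊆ {ω | R ≤ tr ω} ∪ ⋃ y ∈ good, {ω | ∑ i, (inner ℝ (z i ω) (y : E)) ^ 2 ≤ tm y / 2} := by
    intro ω hω
    by_contra hc
    rw [Set.mem_union, not_or] at hc
    obtain ⟨hc1, hc2⟩ := hc
    have hc1' : tr ω < R := not_le.1 hc1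
    refine hω fun a ha => ?_
    set q := coordMap fun i => z i ω with hq
    have hqn : ∀ x, ‖q x‖ ^ 2 = ∑ i, (inner ℝ (z i ω) x) ^ 2 := fun x => by
      rw [hq, norm_coordMap, Real.sq_sqrt (Finset.sum_nonneg fun i _ => sq_nonneg _)]
    have hqtr : ∀ x, ‖q x‖ ^ 2 ≤ R * ‖x‖ ^ 2 := fun x => by
      rw [hqn]
      refine le_trans ?_ (mul_le_mul_of_nonneg_right hc1'.le (sq_nonneg _))
      rw [Finset.sum_mul]
      refine Finset.sum_le_sum fun i _ => ?_
      rw [e.sum_sq_inner_left, ← mul_pow]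
      exact sq_le_sq' (by
        linarith [neg_abs_le (inner ℝ (z i ω) x), abs_real_inner_le_norm (z i ω) x])
        (real_inner_le_norm _ _)
    -- by homogeneity it is enough to treat unit vectors
    have hunit : ∀ x ∈ V, ‖x‖ = 1 → μ / 32 ≤ ‖q x‖ ^ 2 := by
      intro x hx hx1
      obtain ⟨y, hys, hxy⟩ := hs2 ⟨x, hx⟩ hx1.le
      have hxy' : ‖x - (y : E)‖ ≤ (1 / 2) ^ j := hxy
      have hy2 : 1 / 2 ≤ ‖(y : E)‖ := by
        have h1 : ((1 : ℝ) / 2) ^ j ≤ 1 / 2 :=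
          pow_le_of_le_one (by norm_num) (by norm_num) (by omega)
        have h2 := norm_sub_norm_le x (y : E)
        linarith
      have hy0 : y ≠ 0 := by
        rintro rfl
        norm_num at hy2
      have hgood : y ∈ good := Finset.mem_filter.2 ⟨hys, hy0, hy2⟩
      have h3 : tm y / 2 < ‖q y‖ ^ 2 := by
        rw [hqn]
        by_contra hlt
        exact hc2 (Set.mem_biUnion hgood (not_lt.1 hlt))
      have h4 : μ / 8 ≤ ‖q y‖ ^ 2 := by
        have h5 := hlow y y.2
        have h6 : (1 / 2 : ℝ) ^ 2 ≤ ‖(y : E)‖ ^ 2 := by gcongr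
        have h7 := mul_le_mul_of_nonneg_left h6 hμ.le
        change μ * ‖(y : E)‖ ^ 2 ≤ tm y at h5
        linarith
      have h8 : ‖q (x - y)‖ ^ 2 ≤ μ / 32 := by
        refine (hqtr _).trans ?_
        have h9 : ‖x - (y : E)‖ ^ 2 ≤ ((1 / 2) ^ j) ^ 2 := by gcongr
        have h10 : ((1 / 2 : ℝ) ^ j) ^ 2 * 4 ^ j = 1 := by
          rw [← pow_mul, mul_comm j 2, pow_mul, ← mul_pow]
          norm_num
        have h11 := mul_le_mul_of_nonneg_left hRj (sq_nonneg ((1 / 2 : ℝ) ^ j))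
        have h12 := mul_le_mul_of_nonneg_left h9 hR.le
        have h13 : ((1 / 2 : ℝ) ^ j) ^ 2 * (4 ^ j * μ) = μ := by rw [← mul_assoc, h10, one_mul]
        linarith
      have h14 : ‖q y‖ ≤ ‖q x‖ + ‖q (x - y)‖ := by
        have : q y = q x - q (x - y) := by rw [map_sub]; abel
        rw [this]
        exact norm_sub_le _ _
      have h15 : 2 * ‖q (x - y)‖ ≤ ‖q y‖ := by
        refine (sq_le_sq₀ (by positivity) (norm_nonneg _)).1 ?_
        rw [mul_pow]
        linarith
      have h16 : ‖q y‖ / 2 ≤ ‖q x‖ := by linarith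
      have h17 : (‖q y‖ / 2) ^ 2 ≤ ‖q x‖ ^ 2 := by gcongr
      rw [div_pow] at h17
      linarith
    rw [← hqn]
    rcases eq_or_ne a 0 with rfl | ha0
    · simp
    · have hn : 0 < ‖a‖ := norm_pos_iff.2 ha0
      have h1 := hunit (‖a‖⁻¹ • a) (V.smul_mem _ ha) (by
        rw [norm_smul, norm_inv, norm_norm, inv_mul_cancel₀ hn.ne'])
      rw [map_smul, norm_smul, norm_inv, norm_norm, mul_pow, inv_pow, ← div_eq_inv_mul,
        le_div_iff₀ (by positivity)] at h1
      exact h1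
  refine (measureReal_mono hsub (measure_ne_top _ _)).trans
    ((measureReal_union_le _ _).trans (add_le_add ?_ ?_))
  · have hint : Integrable tr P := integrable_finsetSum _ fun i _ => integrable_finsetSum _
      fun l _ => integrable_inner_sq (z i) (e l)
    have hmark := mul_meas_ge_le_integral_of_nonneg (μ := P) (f := tr)
      (Filter.Eventually.of_forall fun ω => Finset.sum_nonneg fun i _ =>
        Finset.sum_nonneg fun l _ => sq_nonneg _) hint R
    rw [le_div_iff₀ hR, mul_comm]
    refine hmark.trans ?_
    have h1 : ∫ ω, tr ω ∂P = ∑ i, ∑ l, ∫ ω, (inner ℝ (z i ω) (e l)) ^ 2 ∂P := by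
      simp only [tr]
      rw [integral_finsetSum _ fun i _ => integrable_finsetSum _
        fun l _ => integrable_inner_sq (z i) (e l)]
      refine Finset.sum_congr rfl fun i _ => ?_
      rw [integral_finsetSum _ fun l _ => integrable_inner_sq (z i) (e l)]
    rw [h1]
    have h2 : ∀ i l, ∫ ω, (inner ℝ (z i ω) (e l)) ^ 2 ∂P ≤ Γ := fun i l => by
      have := hup (e l) (Pi.single i 1)
      rw [Finset.sum_eq_single i (fun k _ hk => by simp [hk]) (by simp), e.norm_eq_one] at this
      refine le_trans (le_of_eq (integral_congr_ae (Filter.Eventually.of_forall fun ω => ?_)))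
        (this.trans (by simp))
      simp only
      rw [Finset.sum_eq_single i (fun k _ hk => by simp [hk]) (by simp), Pi.single_eq_same, one_mul]
    calc _ ≤ ∑ _i : I, ∑ _l : Fin (Module.finrank ℝ E), Γ :=
          Finset.sum_le_sum fun i _ => Finset.sum_le_sum fun l _ => h2 i l
      _ = _ := by
          simp only [Finset.sum_const, Finset.card_univ, Fintype.card_fin, nsmul_eq_mul]
          ring
  · refine (measureReal_biUnion_finset_le _ _).trans ?_
    have hpt : ∀ y ∈ good, P.real {ω | ∑ i, (inner ℝ (z i ω) (y : E)) ^ 2 ≤ tm y / 2}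
        ≤ Real.exp (-(μ / (32 * Γ))) := by
      intro y hy
      obtain ⟨-, hy0, -⟩ := Finset.mem_filter.1 hy
      have hyn : 0 < ‖(y : E)‖ := norm_pos_iff.2 fun h => hy0 (Subtype.ext h)
      have hm : ∫ x, ‖x‖ ^ 2 ∂(P.map (innerVec z (y : E))) = tm y :=
        integral_norm_sq_map_innerVec z _
      have h1 := measure_normSq_le_half_mean_le (P.map (innerVec z (y : E)))
        (integral_inner_map_innerVec hmean z _) (lam := Γ * ‖(y : E)‖ ^ 2) (by positivity)
        (fun b => by
          rw [integral_inner_sq_map_innerVec, EuclideanSpace.real_norm_sq_eq]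
          exact hup _ _)
      rw [hm, map_measureReal_apply (innerVec z (y : E)).continuous.measurable
        (measurableSet_le (by fun_prop) measurable_const)] at h1
      have hset : (innerVec z (y : E)) ⁻¹' {x | ‖x‖ ^ 2 ≤ tm y / 2}
          = {ω | ∑ i, (inner ℝ (z i ω) (y : E)) ^ 2 ≤ tm y / 2} := by
        ext ω
        simp only [Set.mem_ofPred_eq, Set.mem_preimage, norm_sq_innerVec]
      rw [hset] at h1
      refine h1.trans (Real.exp_le_exp.2 (neg_le_neg ?_))
      rw [div_le_div_iff₀ (by positivity) (by positivity)]
      have h2 : μ * ‖(y : E)‖ ^ 2 ≤ tm y := hlow y y.2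
      have h3 := mul_le_mul_of_nonneg_right h2 (by positivity : 0 ≤ 32 * Γ)
      linarith
    refine (Finset.sum_le_card_nsmul _ _ _ hpt).trans ?_
    rw [nsmul_eq_mul]
    refine mul_le_mul_of_nonneg_right ?_ (Real.exp_pos _).le
    have : good.card ≤ 5 ^ (j * Module.finrank ℝ V) := (Finset.card_filter_le _ _).trans hs1
    exact_mod_cast this

end Uniform

/-! ### Centred Gaussian measures on products -/

/-- All continuous linear functionals have mean zero. -/
def HasMeanZero {F : Type*} [NormedAddCommGroup F] [NormedSpace ℝ F] [MeasurableSpace F]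
    (μ : Measure F) : Prop :=
  ∀ L : F →L[ℝ] ℝ, ∫ x, L x ∂μ = 0

section Products

variable {κ : Type*} [Fintype κ] {F : κ → Type*} [∀ k, NormedAddCommGroup (F k)]
  [∀ k, NormedSpace ℝ (F k)] [∀ k, MeasurableSpace (F k)] [∀ k, BorelSpace (F k)]
  (ν : ∀ k, Measure (F k)) [∀ k, IsGaussian (ν k)]

instance isGaussian_pi [∀ k, CompleteSpace (F k)] [∀ k, SecondCountableTopology (F k)] :
    IsGaussian (Measure.pi ν) := by
  have h1 : iIndepFun (fun k => fun x : ∀ k, F k => x k) (Measure.pi ν) :=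
    iIndepFun_pi (X := fun k => (id : F k → F k)) fun k => aemeasurable_id
  have h2 : ∀ k, HasGaussianLaw (fun x : ∀ k, F k => x k) (Measure.pi ν) := fun k =>
    ⟨by rw [(measurePreserving_eval ν k).map_eq]; infer_instance⟩
  have := (h1.hasGaussianLaw h2).isGaussian_map
  rwa [show (fun x : ∀ k, F k => (fun k => x k)) = id from rfl, Measure.map_id] at this

variable {ν}

theorem HasMeanZero.pi (h : ∀ k, HasMeanZero (ν k)) : HasMeanZero (Measure.pi ν) := by
  classical
  intro L
  have h1 : ∀ x : ∀ k, F k, L x = ∑ k, L.comp (ContinuousLinearMap.single ℝ F k) (x k) := by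
    intro x
    conv_lhs => rw [← Finset.univ_sum_single x]
    rw [map_sum]
    rfl
  simp_rw [h1]
  rw [integral_finsetSum]
  · refine Finset.sum_eq_zero fun k _ => ?_
    have h2 := (measurePreserving_eval ν k).map_eq
    have h3 := integral_map (μ := Measure.pi ν) (φ := Function.eval k)
      (f := L.comp (ContinuousLinearMap.single ℝ F k)) (measurable_pi_apply k).aemeasurable
      (by fun_prop)
    rw [h2, h k] at h3
    exact h3.symm
  · intro k _
    have := (measurePreserving_eval ν k).integrable_comp_of_integrable
      (IsGaussian.integrable_dual (ν k) (L.comp (ContinuousLinearMap.single ℝ F k)))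
    exact this

/-- Second moments of sums of independent centred functionals add up. -/
theorem integral_sq_sum_pi (h : ∀ k, HasMeanZero (ν k)) (f : ∀ k, F k →L[ℝ] ℝ) :
    ∫ x, (∑ k, f k (x k)) ^ 2 ∂(Measure.pi ν) = ∑ k, ∫ y, (f k y) ^ 2 ∂(ν k) := by
  have h1 := variance_sum_pi (μ := ν) (X := fun k => ⇑(f k))
    fun k => IsGaussian.memLp_dual (ν k) (f k) 2 (by simp)
  have hsum : (∑ k, fun x : ∀ k, F k => f k (x k)) = fun x => ∑ k, f k (x k) := by
    ext x; simp
  have hmean : ∫ x, (∑ k, f k (x k)) ∂(Measure.pi ν) = 0 := by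
    have := HasMeanZero.pi h (∑ k, (f k).comp (ContinuousLinearMap.proj k))
    simpa [sum_apply] using this
  have hmeas : Measurable fun x : ∀ k, F k => ∑ k, f k (x k) :=
    Finset.measurable_sum _ fun k _ => (f k).continuous.measurable.comp (measurable_pi_apply k)
  rw [hsum, variance_of_integral_eq_zero hmeas.aemeasurable hmean] at h1
  rw [h1]
  exact Finset.sum_congr rfl fun k _ =>
    variance_of_integral_eq_zero (f k).continuous.aemeasurable (h k (f k))

variable {F₁ F₂ : Type*} [NormedAddCommGroup F₁] [NormedSpace ℝ F₁]
  [SecondCountableTopology F₁] [MeasurableSpace F₁] [BorelSpace F₁] [NormedAddCommGroup F₂]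
  [NormedSpace ℝ F₂] [SecondCountableTopology F₂] [MeasurableSpace F₂]
  [BorelSpace F₂] {ν₁ : Measure F₁} {ν₂ : Measure F₂} [IsGaussian ν₁] [IsGaussian ν₂]

theorem HasMeanZero.prod (h₁ : HasMeanZero ν₁) (h₂ : HasMeanZero ν₂) :
    HasMeanZero (ν₁.prod ν₂) := by
  intro L
  have h : ∀ x : F₁ × F₂, L x = L.comp (.inl ℝ F₁ F₂) x.1 + L.comp (.inr ℝ F₁ F₂) x.2 :=
    fun x => (L.comp_inl_add_comp_inr x).symm
  simp_rw [h]
  rw [integral_add ((IsGaussian.integrable_dual ν₁ _).comp_fst ν₂)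
    ((IsGaussian.integrable_dual ν₂ _).comp_snd ν₁), integral_fun_fst (μ := ν₁) (ν := ν₂)
    (f := fun x => L.comp (.inl ℝ F₁ F₂) x), integral_fun_snd (μ := ν₁) (ν := ν₂)
    (f := fun x => L.comp (.inr ℝ F₁ F₂) x), h₁, h₂]
  simp

theorem integral_sq_add_prod (h₁ : HasMeanZero ν₁) (h₂ : HasMeanZero ν₂) (f : F₁ →L[ℝ] ℝ)
    (g : F₂ →L[ℝ] ℝ) :
    ∫ x, (f x.1 + g x.2) ^ 2 ∂(ν₁.prod ν₂) = ∫ y, (f y) ^ 2 ∂ν₁ + ∫ y, (g y) ^ 2 ∂ν₂ := by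
  have hf := IsGaussian.memLp_dual ν₁ f 2 (by simp)
  have hg := IsGaussian.memLp_dual ν₂ g 2 (by simp)
  have h := variance_add_prod hf hg
  have hmean : ∫ x : F₁ × F₂, (f x.1 + g x.2) ∂(ν₁.prod ν₂) = 0 := by
    have := HasMeanZero.prod h₁ h₂ (f.comp (.fst ℝ F₁ F₂) + g.comp (.snd ℝ F₁ F₂))
    exact this
  rw [variance_of_integral_eq_zero (by fun_prop) hmean,
    variance_of_integral_eq_zero (by fun_prop) (h₁ f),
    variance_of_integral_eq_zero (by fun_prop) (h₂ g)] at h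
  exact h

end Products

section Multivariate

variable {m : ℕ} {S : Matrix (Fin m) (Fin m) ℝ}

theorem hasMeanZero_multivariateGaussian (S : Matrix (Fin m) (Fin m) ℝ) :
    HasMeanZero (multivariateGaussian 0 S) := by
  intro L
  rw [ContinuousLinearMap.integral_comp_comm L IsGaussian.integrable_fun_id,
    integral_id_multivariateGaussian, map_zero]

theorem integral_inner_sq_multivariateGaussian (hS : S.PosSemidef)
    (g : EuclideanSpace ℝ (Fin m)) :
    ∫ x, (inner ℝ x g) ^ 2 ∂(multivariateGaussian 0 S)
      = inner ℝ g (Matrix.toEuclideanLin S g) := by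
  have h := covarianceBilin_multivariateGaussian (μ := 0) hS g g
  rw [covarianceBilin_self IsGaussian.memLp_two_id] at h
  rw [variance_of_integral_eq_zero (X := fun u => inner ℝ g u) (by fun_prop)
    (hasMeanZero_multivariateGaussian S (innerSL ℝ g))] at h
  refine Eq.trans ?_ (h.trans ?_)
  · simp_rw [real_inner_comm g]
  · rw [EuclideanSpace.inner_eq_star_dotProduct, dotProduct_comm]
    rfl

theorem map_toEuclideanLin_multivariateGaussian {n : ℕ} (hS : S.PosSemidef)
    (X : Matrix (Fin n) (Fin m) ℝ) :
    (multivariateGaussian 0 S).map (Matrix.toEuclideanLin X)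
      = multivariateGaussian 0 (X * S * Xᵀ) := by
  have hXS : (X * S * Xᵀ).PosSemidef := by
    have := hS.mul_mul_conjTranspose_same X
    rwa [Matrix.conjTranspose_eq_transpose_of_trivial] at this
  let L := (Matrix.toEuclideanLin X).toContinuousLinearMap
  have hL : ⇑(Matrix.toEuclideanLin X) = ⇑L := rfl
  rw [hL]
  have hadj : ∀ t, L.adjoint t = Matrix.toEuclideanLin Xᵀ t := fun t => by
    refine ext_inner_right ℝ fun v => ?_
    rw [ContinuousLinearMap.adjoint_inner_left, ← hL,
      ← Matrix.conjTranspose_eq_transpose_of_trivial,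
      Matrix.toEuclideanLin_conjTranspose_eq_adjoint, LinearMap.adjoint_inner_left]
  refine Measure.ext_of_charFun ?_
  ext t
  have h1 : charFun ((multivariateGaussian 0 S).map L) t
      = charFun (multivariateGaussian 0 S) (L.adjoint t) := by
    rw [charFun_apply, charFun_apply, integral_map (by fun_prop) (by fun_prop)]
    simp_rw [ContinuousLinearMap.adjoint_inner_right]
  rw [h1, charFun_multivariateGaussian hXS, charFun_multivariateGaussian hS, hadj]
  simp only [inner_zero_right]
  congr 4
  change (Xᵀ *ᵥ t.ofLp) ⬝ᵥ S *ᵥ (Xᵀ *ᵥ t.ofLp) = t.ofLp ⬝ᵥ (X * S * Xᵀ) *ᵥ t.ofLp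
  rw [← Matrix.mulVec_mulVec, ← Matrix.mulVec_mulVec, Matrix.dotProduct_mulVec t.ofLp X,
    ← Matrix.mulVec_transpose]

end Multivariate

/-! ### The signal of a linear system -/

theorem norm_toEuclideanLin_le {a b : Type*} [Fintype a] [Fintype b] [DecidableEq a]
    [DecidableEq b] (X : Matrix a b ℝ) (v : EuclideanSpace ℝ b) :
    ‖Matrix.toEuclideanLin X v‖ ≤ ‖X‖ * ‖v‖ :=
  Matrix.l2_opNorm_mulVec X v

theorem norm_transpose_eq {a b : Type*} [Fintype a] [Fintype b] [DecidableEq a]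
    [DecidableEq b] (X : Matrix a b ℝ) : ‖Xᵀ‖ = ‖X‖ := by
  rw [← Matrix.conjTranspose_eq_transpose_of_trivial, Matrix.l2_opNorm_conjTranspose]

theorem toEuclideanLin_mul_apply {a b c : Type*} [Fintype b] [Fintype c] [DecidableEq b]
    [DecidableEq c] (X : Matrix a b ℝ) (Y : Matrix b c ℝ) (v : EuclideanSpace ℝ c) :
    Matrix.toEuclideanLin (X * Y) v = Matrix.toEuclideanLin X (Matrix.toEuclideanLin Y v) := by
  ext i
  change ((X * Y) *ᵥ v.ofLp) i = (X *ᵥ (Y *ᵥ v.ofLp)) i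
  rw [Matrix.mulVec_mulVec]

theorem inner_toEuclideanLin_left {a b : Type*} [Fintype a] [Fintype b] [DecidableEq a]
    [DecidableEq b] (X : Matrix a b ℝ) (v : EuclideanSpace ℝ b) (w : EuclideanSpace ℝ a) :
    inner ℝ (Matrix.toEuclideanLin X v) w = inner ℝ v (Matrix.toEuclideanLin Xᵀ w) := by
  rw [← Matrix.conjTranspose_eq_transpose_of_trivial,
    Matrix.toEuclideanLin_conjTranspose_eq_adjoint, LinearMap.adjoint_inner_right]

section System

variable {r n m T : ℕ}

/-- The inputs and process noises that drive the latent states. -/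
abbrev Drive (r m T : ℕ) : Type :=
  (Fin T → EuclideanSpace ℝ (Fin m)) × (Fin T → EuclideanSpace ℝ (Fin r))

/-- The joint law of inputs and process noises. -/
noncomputable def driveLaw (M : LTISystem r n m) (Su : Matrix (Fin m) (Fin m) ℝ) (T : ℕ) :
    Measure (Drive r m T) :=
  (Measure.pi fun _ => multivariateGaussian 0 Su).prod
    (Measure.pi fun _ => multivariateGaussian 0 M.Sw)

instance (M : LTISystem r n m) (Su : Matrix (Fin m) (Fin m) ℝ) :
    IsGaussian (driveLaw M Su T) := by
  rw [driveLaw]; infer_instance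

theorem hasMeanZero_driveLaw (M : LTISystem r n m) (Su : Matrix (Fin m) (Fin m) ℝ) :
    HasMeanZero (driveLaw M Su T) :=
  (HasMeanZero.pi fun _ => hasMeanZero_multivariateGaussian _).prod
    (HasMeanZero.pi fun _ => hasMeanZero_multivariateGaussian _)

/-- The latent state is the sum of the past impulses, transported by powers of `A`. -/
theorem state_eq_sum (M : LTISystem r n m) (ω : Noise r n m T) (t : Fin (T + 1)) :
    state M ω t = ∑ s : Fin T, if (s : ℕ) < t then
      Matrix.toEuclideanLin (M.A ^ ((t : ℕ) - 1 - s))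
        (Matrix.toEuclideanLin M.B (ω.1 s) + ω.2.1 s) else 0 := by
  induction t using Fin.induction with
  | zero => simp [state]
  | succ t ih =>
    have h1 : state M ω t.succ = Matrix.toEuclideanLin M.A (state M ω t.castSucc)
        + Matrix.toEuclideanLin M.B (ω.1 t) + ω.2.1 t := by
      simp [state]
    rw [h1, ih, map_sum, add_assoc,
      ← Finset.sum_ite_eq' Finset.univ t
        (fun s => Matrix.toEuclideanLin M.B (ω.1 s) + ω.2.1 s) |>.trans
          (if_pos (Finset.mem_univ t)),
      ← Finset.sum_add_distrib]
    refine Finset.sum_congr rfl fun s _ => ?_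
    rcases lt_trichotomy s t with h | h | h
    · have e1 : (s : ℕ) < t := h
      have e2 : (t : ℕ) - s = (t - 1 - s) + 1 := by omega
      simp only [Fin.val_castSucc, Fin.val_succ, e1, if_true, h.ne, if_false, add_zero,
        show (s : ℕ) < t + 1 by omega, Nat.add_sub_cancel, e2, pow_succ']
      rw [toEuclideanLin_mul_apply]
    · subst h
      simp
    · have e1 : ¬ (s : ℕ) < t := by have : (t : ℕ) < s := h; omega
      have e2 : ¬ (s : ℕ) < t + 1 := by have : (t : ℕ) < s := h; omega
      simp [e1, e2, h.ne']

/-- The response of the observation at time `t`, in direction `a`, to the impulse at time `s`. -/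
noncomputable def impulseDir (M : LTISystem r n m) (a : EuclideanSpace ℝ (Fin n)) (t s : ℕ) :
    EuclideanSpace ℝ (Fin r) :=
  if s < t then Matrix.toEuclideanLin (M.A ^ (t - 1 - s))ᵀ (Matrix.toEuclideanLin M.Cᵀ a) else 0

theorem inner_signal_eq (M : LTISystem r n m) (ω : Noise r n m T) (t : Fin (T + 1))
    (a : EuclideanSpace ℝ (Fin n)) :
    inner ℝ (Matrix.toEuclideanLin M.C (state M ω t)) a
      = ∑ s : Fin T, inner ℝ (Matrix.toEuclideanLin M.B (ω.1 s) + ω.2.1 s)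
          (impulseDir M a t s) := by
  rw [inner_toEuclideanLin_left, state_eq_sum, sum_inner]
  refine Finset.sum_congr rfl fun s _ => ?_
  rw [impulseDir]
  split_ifs
  · rw [inner_toEuclideanLin_left]
  · simp

/-- The signal at time `t` as a continuous linear function of the driving variables. -/
noncomputable def signal (M : LTISystem r n m) (t : Fin (T + 1)) :
    Drive r m T →L[ℝ] EuclideanSpace ℝ (Fin n) :=
  LinearMap.toContinuousLinearMap
    (∑ s : Fin T, if (s : ℕ) < t then
      Matrix.toEuclideanLin M.C ∘ₗ Matrix.toEuclideanLin (M.A ^ ((t : ℕ) - 1 - s)) ∘ₗ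
        (Matrix.toEuclideanLin M.B ∘ₗ
            (LinearMap.proj s : (Fin T → EuclideanSpace ℝ (Fin m)) →ₗ[ℝ] _) ∘ₗ
              LinearMap.fst ℝ _ (Fin T → EuclideanSpace ℝ (Fin r))
          + (LinearMap.proj s : (Fin T → EuclideanSpace ℝ (Fin r)) →ₗ[ℝ] _) ∘ₗ
              LinearMap.snd ℝ (Fin T → EuclideanSpace ℝ (Fin m)) _) else 0)

theorem signal_apply (M : LTISystem r n m) (ω : Noise r n m T) (t : Fin (T + 1)) :
    signal M t (ω.1, ω.2.1) = Matrix.toEuclideanLin M.C (state M ω t) := by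
  rw [state_eq_sum, map_sum, signal, LinearMap.coe_toContinuousLinearMap', LinearMap.sum_apply]
  refine Finset.sum_congr rfl fun s _ => ?_
  split_ifs <;> simp

theorem inner_signal (M : LTISystem r n m) (x : Drive r m T) (t : Fin (T + 1))
    (a : EuclideanSpace ℝ (Fin n)) :
    inner ℝ (signal M t x) a = ∑ s : Fin T,
      inner ℝ (Matrix.toEuclideanLin M.B (x.1 s) + x.2 s) (impulseDir M a t s) := by
  rw [← inner_signal_eq M (x.1, x.2, 0) t a, ← signal_apply]

theorem signal_mem_range (M : LTISystem r n m) (x : Drive r m T) (t : Fin (T + 1)) :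
    signal M t x ∈ LinearMap.range (Matrix.toEuclideanLin M.C) := by
  rw [show signal M t x = _ from signal_apply M (x.1, x.2, 0) t]
  exact LinearMap.mem_range_self _ _

theorem integral_sq_sum_impulse (M : LTISystem r n m) {Su : Matrix (Fin m) (Fin m) ℝ}
    (hSu : Su.PosSemidef) (hSw : M.Sw.PosSemidef) (h : Fin T → EuclideanSpace ℝ (Fin r)) :
    ∫ x, (∑ s, inner ℝ (Matrix.toEuclideanLin M.B (x.1 s) + x.2 s) (h s)) ^ 2 ∂(driveLaw M Su T)
      = ∑ s, inner ℝ (h s) (Matrix.toEuclideanLin (M.Sw + M.B * Su * M.Bᵀ) (h s)) := by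
  have key : ∀ {d : ℕ} {S : Matrix (Fin d) (Fin d) ℝ}, S.PosSemidef →
      ∀ g : Fin T → EuclideanSpace ℝ (Fin d),
      ∫ x, (∑ s, innerSL ℝ (g s) (x s)) ^ 2 ∂(Measure.pi fun _ : Fin T => multivariateGaussian 0 S)
        = ∑ s, inner ℝ (g s) (Matrix.toEuclideanLin S (g s)) := by
    intro d S hS g
    rw [integral_sq_sum_pi (fun _ => hasMeanZero_multivariateGaussian S) fun s => innerSL ℝ (g s)]
    refine Finset.sum_congr rfl fun s _ => ?_
    rw [← integral_inner_sq_multivariateGaussian hS]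
    refine integral_congr_ae (Filter.Eventually.of_forall fun x => ?_)
    simp [real_inner_comm]
  have h1 := integral_sq_add_prod
    (HasMeanZero.pi fun _ : Fin T => hasMeanZero_multivariateGaussian Su)
    (HasMeanZero.pi fun _ : Fin T => hasMeanZero_multivariateGaussian M.Sw)
    (∑ s, (innerSL ℝ (Matrix.toEuclideanLin M.Bᵀ (h s))).comp (ContinuousLinearMap.proj s))
    (∑ s, (innerSL ℝ (h s)).comp (ContinuousLinearMap.proj s))
  simp only [sum_apply, ContinuousLinearMap.comp_apply, ContinuousLinearMap.proj_apply] at h1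
  rw [key hSu, key hSw, ← Finset.sum_add_distrib] at h1
  refine Eq.trans (integral_congr_ae (Filter.Eventually.of_forall fun x => ?_)) (h1.trans ?_)
  · simp only [← Finset.sum_add_distrib]
    congr 1
    refine Finset.sum_congr rfl fun s _ => ?_
    rw [inner_add_left, inner_toEuclideanLin_left]
    simp [real_inner_comm]
  · refine Finset.sum_congr rfl fun s _ => ?_
    rw [map_add, LinearMap.add_apply, inner_add_right, toEuclideanLin_mul_apply,
      toEuclideanLin_mul_apply, add_comm, inner_toEuclideanLin_left, Matrix.transpose_transpose]

/-- The Schur test for a non-negative kernel. -/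
theorem sum_sq_sum_mul_le {α β : Type*} [Fintype α] [Fintype β] (w : α → β → ℝ)
    (hw : ∀ i j, 0 ≤ w i j) {R : ℝ} (hrow : ∀ i, ∑ j, w i j ≤ R) (hcol : ∀ j, ∑ i, w i j ≤ R)
    (b : α → ℝ) : ∑ j, (∑ i, |b i| * w i j) ^ 2 ≤ R ^ 2 * ∑ i, b i ^ 2 := by
  have h1 : ∀ j, (∑ i, |b i| * w i j) ^ 2 ≤ R * ∑ i, w i j * b i ^ 2 := fun j => by
    have hcs := Finset.sum_sq_le_sum_mul_sum_of_sq_le_mul (Finset.univ : Finset α)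
      (r := fun i => |b i| * w i j) (f := fun i => w i j) (g := fun i => w i j * b i ^ 2)
      (fun i _ => hw i j) (fun i _ => mul_nonneg (hw i j) (sq_nonneg _))
      (fun i _ => le_of_eq (by rw [mul_pow, sq_abs]; ring))
    exact hcs.trans (mul_le_mul_of_nonneg_right (hcol j)
      (Finset.sum_nonneg fun i _ => mul_nonneg (hw i j) (sq_nonneg _)))
  calc ∑ j, (∑ i, |b i| * w i j) ^ 2 ≤ ∑ j, R * ∑ i, w i j * b i ^ 2 :=
        Finset.sum_le_sum fun j _ => h1 j
    _ = R * ∑ i, (∑ j, w i j) * b i ^ 2 := by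
        rw [← Finset.mul_sum, Finset.sum_comm]
        simp_rw [Finset.sum_mul]
    _ ≤ R * ∑ i, R * b i ^ 2 := by
        rcases isEmpty_or_nonempty β with hβ | ⟨⟨j⟩⟩
        · simp only [Finset.univ_eq_empty, Finset.sum_empty, zero_mul, Finset.sum_const_zero,
            mul_zero]
          rw [← Finset.mul_sum, ← mul_assoc]
          exact mul_nonneg (mul_self_nonneg R) (Finset.sum_nonneg fun i _ => sq_nonneg _)
        · have hR : 0 ≤ R := (Finset.sum_nonneg fun i _ => hw i j).trans (hcol j)
          gcongr with i
          exact hrow i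
    _ = R ^ 2 * ∑ i, b i ^ 2 := by rw [← Finset.mul_sum]; ring

theorem sum_geometric_le {ψ ρ : ℝ} (hψ : 1 ≤ ψ) (hρ0 : 0 < ρ) (hρ1 : ρ < 1) {α : Type*}
    [DecidableEq α] (S : Finset α) (g : α → ℕ) (hg : Set.InjOn g S) :
    ∑ x ∈ S, ψ * ρ ^ (g x - 1) ≤ 2 * ψ / (1 - ρ) := by
  have hs : Summable fun i : ℕ => ψ * ρ ^ (i - 1) := by
    rw [← summable_nat_add_iff 1]
    simpa using (summable_geometric_of_lt_one hρ0.le hρ1).mul_left ψ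
  have h1 : ∑ x ∈ S, ψ * ρ ^ (g x - 1) = ∑ i ∈ S.image g, ψ * ρ ^ (i - 1) :=
    (Finset.sum_image (f := fun i => ψ * ρ ^ (i - 1)) hg).symm
  rw [h1]
  refine (hs.sum_le_tsum _ fun i _ => by positivity).trans ?_
  rw [hs.tsum_eq_zero_add]
  simp only [Nat.add_sub_cancel, zero_tsub, pow_zero, mul_one]
  rw [tsum_mul_left, tsum_geometric_of_lt_one hρ0.le hρ1, ← div_eq_mul_inv]
  have h2 : 0 < 1 - ρ := by linarith
  have h3 : ψ ≤ ψ / (1 - ρ) := le_div_self (by linarith) h2 (by linarith)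
  have h4 : 2 * ψ / (1 - ρ) = ψ / (1 - ρ) + ψ / (1 - ρ) := by ring
  linarith

theorem IsStableMatrix.norm_pow_le {A : Matrix (Fin r) (Fin r) ℝ} {ψ ρ : ℝ}
    (h : IsStableMatrix A ψ ρ) (i : ℕ) : ‖A ^ i‖ ≤ ψ * ρ ^ (i - 1) := by
  obtain ⟨h1, h2, h3, h4⟩ := h
  cases i with
  | zero =>
    simp only [pow_zero, zero_tsub, mul_one]
    refine le_trans ?_ h1
    rw [Matrix.l2_opNorm_def]
    refine ContinuousLinearMap.opNorm_le_bound _ zero_le_one fun x => ?_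
    rw [one_mul]
    apply le_of_eq
    congr 1
    ext i
    change ((1 : Matrix (Fin r) (Fin r) ℝ) *ᵥ x.ofLp) i = x i
    rw [Matrix.one_mulVec]
  | succ i => exact h4 i

/-- Weighted sums of the signal have variance at most that of a stable filter. -/
theorem integral_sq_signal_le (M : LTISystem r n m) {Su : Matrix (Fin m) (Fin m) ℝ}
    (hSu : Su.PosSemidef) (hSw : M.Sw.PosSemidef) {ψ ρ : ℝ} (hA : IsStableMatrix M.A ψ ρ)
    (a : EuclideanSpace ℝ (Fin n)) (b : Fin (T + 1) → ℝ) :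
    ∫ x, (∑ t, b t * inner ℝ (signal M t x) a) ^ 2 ∂(driveLaw M Su T)
      ≤ ‖M.Sw + M.B * Su * M.Bᵀ‖ * ‖M.C‖ ^ 2 * (2 * ψ / (1 - ρ)) ^ 2 * ‖a‖ ^ 2
        * ∑ t, b t ^ 2 := by
  obtain ⟨hψ, hρ0, hρ1, -⟩ := id hA
  set h : Fin T → EuclideanSpace ℝ (Fin r) := fun s => ∑ t, b t • impulseDir M a t s with hh
  have h1 : ∀ x : Drive r m T, ∑ t, b t * inner ℝ (signal M t x) a
      = ∑ s, inner ℝ (Matrix.toEuclideanLin M.B (x.1 s) + x.2 s) (h s) := by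
    intro x
    simp_rw [inner_signal, hh, inner_sum, real_inner_smul_right, Finset.mul_sum]
    exact Finset.sum_comm
  simp_rw [h1]
  rw [integral_sq_sum_impulse M hSu hSw]
  let w : Fin (T + 1) → Fin T → ℝ := fun t s =>
    if (s : ℕ) < t then ψ * ρ ^ ((t : ℕ) - 1 - s - 1) else 0
  have hw0 : ∀ t s, 0 ≤ w t s := fun t s => by
    simp only [w]; split_ifs <;> positivity
  have hdir : ∀ (t : Fin (T + 1)) (s : Fin T), ‖impulseDir M a t s‖ ≤ w t s * (‖M.C‖ * ‖a‖) := by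
    intro t s
    simp only [w, impulseDir]
    split_ifs
    · refine (norm_toEuclideanLin_le _ _).trans ?_
      rw [norm_transpose_eq]
      have h2 := norm_toEuclideanLin_le M.Cᵀ a
      rw [norm_transpose_eq] at h2
      have := hA.norm_pow_le ((t : ℕ) - 1 - s)
      gcongr
    · simp
  have hrow : ∀ t, ∑ s, w t s ≤ 2 * ψ / (1 - ρ) := by
    intro t
    simp only [w]
    rw [← Finset.sum_filter]
    refine sum_geometric_le hψ hρ0 hρ1 _ (fun s : Fin T => (t : ℕ) - 1 - s) ?_
    intro s hs s' hs' hss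
    have e1 := (Finset.mem_filter.1 hs).2
    have e2 := (Finset.mem_filter.1 hs').2
    simp only at hss
    exact Fin.ext (by omega)
  have hcol : ∀ s, ∑ t, w t s ≤ 2 * ψ / (1 - ρ) := by
    intro s
    simp only [w]
    rw [← Finset.sum_filter]
    refine sum_geometric_le hψ hρ0 hρ1 _ (fun t : Fin (T + 1) => (t : ℕ) - 1 - s) ?_
    intro s hs s' hs' hss
    have e1 := (Finset.mem_filter.1 hs).2
    have e2 := (Finset.mem_filter.1 hs').2
    simp only at hss
    exact Fin.ext (by omega)
  have hhs : ∀ s, ‖h s‖ ≤ (∑ t, |b t| * w t s) * (‖M.C‖ * ‖a‖) := by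
    intro s
    rw [hh, Finset.sum_mul]
    refine (norm_sum_le _ _).trans (Finset.sum_le_sum fun t _ => ?_)
    rw [norm_smul, Real.norm_eq_abs, mul_assoc]
    exact mul_le_mul_of_nonneg_left (hdir t s) (abs_nonneg _)
  set Q := M.Sw + M.B * Su * M.Bᵀ with hQ
  calc ∑ s, inner ℝ (h s) (Matrix.toEuclideanLin Q (h s))
      ≤ ∑ s, ‖Q‖ * ((∑ t, |b t| * w t s) * (‖M.C‖ * ‖a‖)) ^ 2 := by
        refine Finset.sum_le_sum fun s _ => (real_inner_le_norm _ _).trans ?_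
        have h2 := norm_toEuclideanLin_le Q (h s)
        calc ‖h s‖ * ‖Matrix.toEuclideanLin Q (h s)‖ ≤ ‖h s‖ * (‖Q‖ * ‖h s‖) := by gcongr
          _ = ‖Q‖ * ‖h s‖ ^ 2 := by ring
          _ ≤ _ := by
            have := hhs s
            gcongr
    _ = ‖Q‖ * ‖M.C‖ ^ 2 * ‖a‖ ^ 2 * ∑ s, (∑ t, |b t| * w t s) ^ 2 := by
        rw [Finset.mul_sum]
        refine Finset.sum_congr rfl fun s _ => ?_
        ring
    _ ≤ ‖Q‖ * ‖M.C‖ ^ 2 * ‖a‖ ^ 2 * ((2 * ψ / (1 - ρ)) ^ 2 * ∑ t, b t ^ 2) := by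
        gcongr
        exact sum_sq_sum_mul_le w hw0 hrow hcol b
    _ = _ := by ring

theorem rank_ctrbMatrix_eq {A : Matrix (Fin r) (Fin r) ℝ} {B : Matrix (Fin r) (Fin m) ℝ}
    (h : (ctrbMatrix A B r).rank = r) {d : ℕ} (hd : r ≤ d) : (ctrbMatrix A B d).rank = r := by
  refine le_antisymm ((Matrix.rank_le_card_height _).trans (by simp)) ?_
  -- the shorter controllability matrix is a selection of columns of the longer one
  have h1 : ctrbMatrix A B r = (ctrbMatrix A B d).submatrix (Equiv.refl _)
      (fun p : Fin r × Fin m => (Fin.castLE hd p.1, p.2)) := rfl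
  have h2 := Matrix.mul_submatrix_one (Equiv.refl (Fin d × Fin m))
    (fun p : Fin r × Fin m => (Fin.castLE hd p.1, p.2)) (ctrbMatrix A B d)
  have h3 : ctrbMatrix A B r = _ := h1.trans h2.symm
  conv_lhs => rw [← h, h3]
  exact Matrix.rank_mul_le_left _ _

theorem mem_range_toEuclideanLin_of_rank_eq {β : Type*} [Fintype β] [DecidableEq β]
    {X : Matrix (Fin r) β ℝ} (h : X.rank = r) (y : EuclideanSpace ℝ (Fin r)) :
    y ∈ LinearMap.range (Matrix.toEuclideanLin X) := by
  have : LinearMap.range (Matrix.toEuclideanLin X) = ⊤ := by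
    refine Submodule.eq_top_of_finrank_eq ?_
    rw [range_toEuclideanLin_finrank, h, finrank_euclideanSpace_fin]
  rw [this]
  trivial

/-- Persistent excitation: the inputs excite every direction in the column space of the observer,
once the time index exceeds the length of the controllability matrix. -/
theorem le_integral_sq_signal (M : LTISystem r n m) {Su : Matrix (Fin m) (Fin m) ℝ}
    (hSu : Su.PosDef) (hSw : M.Sw.PosSemidef) (hctrb : (ctrbMatrix M.A M.B r).rank = r) {d : ℕ}
    (hd : r ≤ d) {a : EuclideanSpace ℝ (Fin n)}
    (ha : a ∈ LinearMap.range (Matrix.toEuclideanLin M.C)) (t : Fin (T + 1)) (ht : d ≤ t) :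
    sigmaMin Su * sigmaMin (ctrbMatrix M.A M.B d) ^ 2 * sigmaMin M.C ^ 2 * ‖a‖ ^ 2
      ≤ ∫ x, (inner ℝ (signal M t x) a) ^ 2 ∂(driveLaw M Su T) := by
  simp_rw [inner_signal]
  rw [integral_sq_sum_impulse M hSu.posSemidef hSw]
  set c := Matrix.toEuclideanLin M.Cᵀ a with hc
  have h1 : ∀ g : EuclideanSpace ℝ (Fin r), sigmaMin Su * ‖Matrix.toEuclideanLin M.Bᵀ g‖ ^ 2
      ≤ inner ℝ g (Matrix.toEuclideanLin (M.Sw + M.B * Su * M.Bᵀ) g) := by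
    intro g
    have e1 : 0 ≤ inner ℝ g (Matrix.toEuclideanLin M.Sw g) := by
      rw [real_inner_comm]
      exact (isPositive_toEuclideanLin hSw).re_inner_nonneg_left g
    have e2 := sigmaMin_mul_norm_sq_le hSu (Matrix.toEuclideanLin M.Bᵀ g)
    rw [inner_toEuclideanLin_left, Matrix.transpose_transpose] at e2
    rw [map_add, LinearMap.add_apply, inner_add_right, toEuclideanLin_mul_apply,
      toEuclideanLin_mul_apply]
    linarith
  have h2 : ‖Matrix.toEuclideanLin (ctrbMatrix M.A M.B d)ᵀ c‖ ^ 2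
      = ∑ i : Fin d, ‖Matrix.toEuclideanLin M.Bᵀ
          (Matrix.toEuclideanLin (M.A ^ (i : ℕ))ᵀ c)‖ ^ 2 := by
    simp_rw [EuclideanSpace.real_norm_sq_eq]
    rw [Fintype.sum_prod_type]
    refine Finset.sum_congr rfl fun i _ => Finset.sum_congr rfl fun l _ => ?_
    congr 1
    change ((ctrbMatrix M.A M.B d)ᵀ *ᵥ c.ofLp) (i, l) = (M.Bᵀ *ᵥ ((M.A ^ (i : ℕ))ᵀ *ᵥ c.ofLp)) l
    rw [Matrix.mulVec_mulVec, ← Matrix.transpose_mul]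
    rfl
  let f : Fin d → Fin T := fun i => ⟨(t : ℕ) - 1 - i, by have := t.2; have := i.2; omega⟩
  have hf : Function.Injective f := fun i j hij => by
    have := congrArg Fin.val hij
    simp only [f] at this
    exact Fin.ext (by have := i.2; have := j.2; omega)
  have hfi : ∀ i : Fin d, impulseDir M a t (f i) = Matrix.toEuclideanLin (M.A ^ (i : ℕ))ᵀ c := by
    intro i
    have e1 : ((f i : Fin T) : ℕ) < t := by have := i.2; simp only [f]; omega
    have e2 : (t : ℕ) - 1 - (f i : Fin T) = i := by have := i.2; simp only [f]; omega
    rw [impulseDir, if_pos e1, e2]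
  have h3 : sigmaMin M.C * ‖a‖ ≤ ‖c‖ := sigmaMin_mul_norm_le M.C a ha
  have h4 := sigmaMin_mul_norm_le (ctrbMatrix M.A M.B d) c
    (mem_range_toEuclideanLin_of_rank_eq (rank_ctrbMatrix_eq hctrb hd) c)
  have s1 := sigmaMin_nonneg Su
  have s2 := sigmaMin_nonneg (ctrbMatrix M.A M.B d)
  have s3 := sigmaMin_nonneg M.C
  calc sigmaMin Su * sigmaMin (ctrbMatrix M.A M.B d) ^ 2 * sigmaMin M.C ^ 2 * ‖a‖ ^ 2
      = sigmaMin Su * (sigmaMin (ctrbMatrix M.A M.B d) * (sigmaMin M.C * ‖a‖)) ^ 2 := by ring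
    _ ≤ sigmaMin Su * (sigmaMin (ctrbMatrix M.A M.B d) * ‖c‖) ^ 2 := by gcongr
    _ ≤ sigmaMin Su * ‖Matrix.toEuclideanLin (ctrbMatrix M.A M.B d)ᵀ c‖ ^ 2 := by gcongr
    _ = ∑ i : Fin d, sigmaMin Su * ‖Matrix.toEuclideanLin M.Bᵀ (impulseDir M a t (f i))‖ ^ 2 := by
        rw [h2, Finset.mul_sum]
        simp_rw [hfi]
    _ = ∑ s ∈ Finset.univ.map ⟨f, hf⟩,
          sigmaMin Su * ‖Matrix.toEuclideanLin M.Bᵀ (impulseDir M a t s)‖ ^ 2 := by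
        rw [Finset.sum_map]
        rfl
    _ ≤ ∑ s : Fin T, sigmaMin Su * ‖Matrix.toEuclideanLin M.Bᵀ (impulseDir M a t s)‖ ^ 2 :=
        Finset.sum_le_sum_of_subset_of_nonneg (Finset.subset_univ _)
          fun s _ _ => mul_nonneg s1 (sq_nonneg _)
    _ ≤ _ := Finset.sum_le_sum fun s _ => h1 _

end System

/-! ### The pooled data of independent systems -/

theorem sampleRegularity_iff {E I : Type*} [NormedAddCommGroup E] [InnerProductSpace ℝ E]
    [Fintype I] {V : Submodule ℝ E} {z η : I → E} {μ₀ s m ν : ℝ} :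
    SampleRegularity V z η μ₀ s m ν ↔ (∀ i, z i ∈ V) ∧
      (∀ a ∈ V, μ₀ * ‖a‖ ^ 2 ≤ ∑ i, (inner ℝ (z i) a) ^ 2) ∧
      (∀ a b : E, |∑ i, inner ℝ (z i) a * inner ℝ (η i) b|
        ≤ s * √(∑ i, (inner ℝ (z i) a) ^ 2) * ‖b‖) ∧
      (∀ a b : E, |∑ i, inner ℝ (η i) a * inner ℝ (η i) b - m * inner ℝ a b|
        ≤ ν * ‖a‖ * ‖b‖) :=
  ⟨fun h => ⟨h.1, h.2, h.3, h.4⟩, fun h => ⟨h.1, h.2.1, h.2.2.1, h.2.2.2⟩⟩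

theorem isClosed_sampleRegularity {E I X : Type*} [NormedAddCommGroup E] [InnerProductSpace ℝ E]
    [FiniteDimensional ℝ E] [Fintype I] [TopologicalSpace X] (V : Submodule ℝ E) {z η : X → I → E}
    (hz : ∀ i, Continuous fun x => z x i) (hη : ∀ i, Continuous fun x => η x i) (μ₀ s m ν : ℝ) :
    IsClosed {x | SampleRegularity V (z x) (η x) μ₀ s m ν} := by
  simp_rw [sampleRegularity_iff, Set.ofPred_and, Set.ofPred_forall]
  refine .inter (isClosed_iInter fun i => V.closed_of_finiteDimensional.preimage (hz i))
    (.inter (isClosed_iInter fun a => isClosed_iInter fun _ => isClosed_le ?_ ?_)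
    (.inter (isClosed_iInter fun a => isClosed_iInter fun b => isClosed_le ?_ ?_)
    (isClosed_iInter fun a => isClosed_iInter fun b => isClosed_le ?_ ?_))) <;> fun_prop

section Pooled

variable {κ : Type*} {n : ℕ} {r m T : κ → ℕ}

/-- The signals of all the systems, as functions of all the driving variables. -/
noncomputable def pooledSignal (M : ∀ k, LTISystem (r k) n (m k)) (i : Σ k, Fin (T k + 1)) :
    (∀ k, Drive (r k) (m k) (T k)) →L[ℝ] EuclideanSpace ℝ (Fin n) :=
  (signal (M i.1) i.2).comp (ContinuousLinearMap.proj i.1)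

/-- The observation noises of all the systems. -/
noncomputable def pooledNoise (i : Σ k, Fin (T k + 1)) :
    (∀ k, Fin (T k + 1) → EuclideanSpace ℝ (Fin n)) →L[ℝ] EuclideanSpace ℝ (Fin n) :=
  (ContinuousLinearMap.proj i.2).comp
    (ContinuousLinearMap.proj (R := ℝ) (φ := fun k => Fin (T k + 1) → EuclideanSpace ℝ (Fin n)) i.1)

theorem pooledSignal_apply (M : ∀ k, LTISystem (r k) n (m k)) (i : Σ k, Fin (T k + 1))
    (x : ∀ k, Drive (r k) (m k) (T k)) : pooledSignal M i x = signal (M i.1) i.2 (x i.1) := rfl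

theorem pooledNoise_apply (i : Σ k, Fin (T k + 1))
    (x : ∀ k, Fin (T k + 1) → EuclideanSpace ℝ (Fin n)) : pooledNoise i x = x i.1 i.2 := rfl

variable [Fintype κ]

/-- The law of the observation noises of all the systems. -/
noncomputable def pooledNoiseLaw (n : ℕ) (T : κ → ℕ) (σ : κ → ℝ) :
    Measure (∀ k, Fin (T k + 1) → EuclideanSpace ℝ (Fin n)) :=
  Measure.pi fun k => Measure.pi fun _ => multivariateGaussian 0 ((σ k) ^ 2 • 1)

instance (σ : κ → ℝ) : IsGaussian (pooledNoiseLaw n T σ) := by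
  rw [pooledNoiseLaw]; infer_instance

theorem hasMeanZero_pooledNoiseLaw (σ : κ → ℝ) : HasMeanZero (pooledNoiseLaw n T σ) :=
  HasMeanZero.pi fun _ => HasMeanZero.pi fun _ => hasMeanZero_multivariateGaussian _

theorem integral_sq_pooledNoise (σ : κ → ℝ) (g : (Σ k, Fin (T k + 1)) → EuclideanSpace ℝ (Fin n)) :
    ∫ x, (∑ i, inner ℝ (pooledNoise i x) (g i)) ^ 2 ∂(pooledNoiseLaw n T σ)
      = ∑ i, (σ i.1) ^ 2 * ‖g i‖ ^ 2 := by
  simp_rw [Fintype.sum_sigma, pooledNoise_apply]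
  have h1 := integral_sq_sum_pi (κ := κ)
    (ν := fun k => Measure.pi fun _ : Fin (T k + 1) =>
      multivariateGaussian (0 : EuclideanSpace ℝ (Fin n)) ((σ k) ^ 2 • 1))
    (fun k => HasMeanZero.pi fun _ => hasMeanZero_multivariateGaussian _)
    (fun k => ∑ t, (innerSL ℝ (g ⟨k, t⟩)).comp (ContinuousLinearMap.proj t))
  have h2 : ∀ k, ∀ y : Fin (T k + 1) → EuclideanSpace ℝ (Fin n),
      (∑ t, (innerSL ℝ (g ⟨k, t⟩)).comp (ContinuousLinearMap.proj t)) y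
        = ∑ t, inner ℝ (y t) (g ⟨k, t⟩) := by
    intro k y
    simp only [sum_apply, ContinuousLinearMap.comp_apply, ContinuousLinearMap.proj_apply,
      innerSL_apply_apply]
    exact Finset.sum_congr rfl fun t _ => real_inner_comm _ _
  simp_rw [h2] at h1
  refine h1.trans (Finset.sum_congr rfl fun k _ => ?_)
  have h3 := integral_sq_sum_pi (κ := Fin (T k + 1))
    (ν := fun _ => multivariateGaussian (0 : EuclideanSpace ℝ (Fin n)) ((σ k) ^ 2 • 1))
    (fun _ => hasMeanZero_multivariateGaussian _) (fun t => innerSL ℝ (g ⟨k, t⟩))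
  have h4 : ∀ t, ∀ y : EuclideanSpace ℝ (Fin n), innerSL ℝ (g ⟨k, t⟩) y = inner ℝ y (g ⟨k, t⟩) :=
    fun t y => (innerSL_apply_apply ℝ _ _).trans (real_inner_comm _ _)
  simp_rw [h4] at h3
  refine h3.trans (Finset.sum_congr rfl fun t _ => ?_)
  rw [integral_inner_sq_multivariateGaussian (Matrix.PosSemidef.one.smul (sq_nonneg _)), map_smul,
    LinearMap.smul_apply, Matrix.toLpLin_one, LinearMap.id_apply, real_inner_smul_right,
    real_inner_self_eq_norm_sq]

variable (M : ∀ k, LTISystem (r k) n (m k)) (Su : ∀ k, Matrix (Fin (m k)) (Fin (m k)) ℝ)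

theorem hasMeanZero_pi_driveLaw :
    HasMeanZero (Measure.pi fun k => driveLaw (M k) (Su k) (T k)) :=
  HasMeanZero.pi fun _ => hasMeanZero_driveLaw _ _

variable {M Su}

theorem integral_sq_pooledSignal_le (hSu : ∀ k, (Su k).PosSemidef)
    (hSw : ∀ k, (M k).Sw.PosSemidef) {ψ ρ : ℝ} (hA : ∀ k, IsStableMatrix (M k).A ψ ρ) {w c : ℝ}
    (hw : ∀ k, ‖(M k).Sw + (M k).B * Su k * (M k).Bᵀ‖ ≤ w) (hc : ∀ k, ‖(M k).C‖ ≤ c)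
    (a : EuclideanSpace ℝ (Fin n)) (b : (Σ k, Fin (T k + 1)) → ℝ) :
    ∫ x, (∑ i, b i * inner ℝ (pooledSignal M i x) a) ^ 2
        ∂(Measure.pi fun k => driveLaw (M k) (Su k) (T k))
      ≤ w * c ^ 2 * (2 * ψ / (1 - ρ)) ^ 2 * ‖a‖ ^ 2 * ∑ i, b i ^ 2 := by
  simp_rw [Fintype.sum_sigma, pooledSignal_apply]
  have h1 := integral_sq_sum_pi (κ := κ)
    (ν := fun k => driveLaw (M k) (Su k) (T k))
    (fun k => hasMeanZero_driveLaw _ _)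
    (fun k => ∑ t, b ⟨k, t⟩ • (innerSL ℝ a).comp (signal (M k) t))
  have h2 : ∀ k, ∀ y : Drive (r k) (m k) (T k),
      (∑ t, b ⟨k, t⟩ • (innerSL ℝ a).comp (signal (M k) t)) y
        = ∑ t, b ⟨k, t⟩ * inner ℝ (signal (M k) t y) a := by
    intro k y
    simp only [sum_apply, ContinuousLinearMap.comp_apply,
      innerSL_apply_apply, smul_apply, smul_eq_mul]
    exact Finset.sum_congr rfl fun t _ => by rw [real_inner_comm]
  simp_rw [h2] at h1
  rw [h1, Finset.mul_sum]
  refine Finset.sum_le_sum fun k _ =>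
    (integral_sq_signal_le (M k) (hSu k) (hSw k) (hA k) a _).trans ?_
  have := hw k
  have := hc k
  have : 0 ≤ w := (norm_nonneg _).trans (hw k)
  gcongr

theorem sub_le_sum_range_ite (d N : ℕ) :
    (N : ℝ) - d ≤ ∑ t ∈ Finset.range N, if d ≤ t then (1 : ℝ) else 0 := by
  induction N with
  | zero => simp
  | succ N ih =>
    rw [Finset.sum_range_succ]
    push_cast
    split_ifs with h
    · linarith
    · have h1 : (N : ℝ) + 1 ≤ d := by exact_mod_cast not_le.1 h
      have h2 : (0 : ℝ) ≤ ∑ t ∈ Finset.range N, if d ≤ t then (1 : ℝ) else 0 :=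
        Finset.sum_nonneg fun t _ => by split_ifs <;> norm_num
      linarith

/-- The total excitation of a direction in the common observer space: each system contributes once
per time step beyond the length `d` of its controllability matrix. -/
theorem le_sum_integral_sq_pooledSignal (hSu : ∀ k, (Su k).PosDef)
    (hSw : ∀ k, (M k).Sw.PosSemidef) (hctrb : ∀ k, (ctrbMatrix (M k).A (M k).B (r k)).rank = r k)
    {d : ℕ} (hd : ∀ k, r k ≤ d) {V : Submodule ℝ (EuclideanSpace ℝ (Fin n))}
    (hV : ∀ k, LinearMap.range (Matrix.toEuclideanLin (M k).C) = V) {φ : ℝ} (hφ0 : 0 ≤ φ)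
    (hφ : ∀ k, φ ≤ sigmaMin (Su k) * sigmaMin (ctrbMatrix (M k).A (M k).B d) ^ 2
      * sigmaMin (M k).C ^ 2)
    {a : EuclideanSpace ℝ (Fin n)} (ha : a ∈ V) :
    φ * (∑ k, ((T k : ℝ) + 1 - d)) * ‖a‖ ^ 2 ≤ ∑ i : Σ k, Fin (T k + 1),
      ∫ x, (inner ℝ (pooledSignal M i x) a) ^ 2
        ∂(Measure.pi fun k => driveLaw (M k) (Su k) (T k)) := by
  rw [Fintype.sum_sigma, Finset.mul_sum, Finset.sum_mul]
  refine Finset.sum_le_sum fun k _ => ?_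
  have h1 : ∀ t : Fin (T k + 1), (if d ≤ t then (1 : ℝ) else 0) * (φ * ‖a‖ ^ 2)
      ≤ ∫ x, (inner ℝ (pooledSignal M ⟨k, t⟩ x) a) ^ 2
        ∂(Measure.pi fun k => driveLaw (M k) (Su k) (T k)) := by
    intro t
    have h2 : ∫ x, (inner ℝ (pooledSignal M ⟨k, t⟩ x) a) ^ 2
        ∂(Measure.pi fun k => driveLaw (M k) (Su k) (T k))
        = ∫ y, (inner ℝ (signal (M k) t y) a) ^ 2 ∂(driveLaw (M k) (Su k) (T k)) := by
      have hmp := measurePreserving_eval (fun k => driveLaw (M k) (Su k) (T k)) k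
      have h3 := integral_map (μ := Measure.pi fun k => driveLaw (M k) (Su k) (T k))
        (φ := Function.eval k) (f := fun y => (inner ℝ (signal (M k) t y) a) ^ 2)
        (measurable_pi_apply k).aemeasurable
        (Continuous.aestronglyMeasurable (by fun_prop))
      rw [hmp.map_eq] at h3
      exact h3.symm
    rw [h2]
    split_ifs with ht
    · rw [one_mul]
      refine le_trans ?_ (le_integral_sq_signal (M k) (hSu k) (hSw k) (hctrb k) (hd k)
        (by rw [hV]; exact ha) t ht)
      have := hφ k
      gcongr
    · rw [zero_mul]
      exact integral_nonneg fun x => sq_nonneg _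
  refine le_trans ?_ (Finset.sum_le_sum fun t _ => h1 t)
  rw [← Finset.sum_mul, Fin.sum_univ_eq_sum_range (fun t => if d ≤ t then (1 : ℝ) else 0) (T k + 1)]
  have := sub_le_sum_range_ite d (T k + 1)
  push_cast at this
  calc φ * ((T k : ℝ) + 1 - d) * ‖a‖ ^ 2 = ((T k : ℝ) + 1 - d) * (φ * ‖a‖ ^ 2) := by ring
    _ ≤ _ := by gcongr

end Pooled

instance isProbabilityMeasure_noiseLaw {r n m T : ℕ} (M : LTISystem r n m)
    (Su : Matrix (Fin m) (Fin m) ℝ) : IsProbabilityMeasure (noiseLaw M Su T) := by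
  rw [noiseLaw]; infer_instance

section

variable {I E X Y : Type*} [Fintype I] [NormedAddCommGroup E] [InnerProductSpace ℝ E]
  [NormedAddCommGroup X] [NormedSpace ℝ X] [MeasurableSpace X] [BorelSpace X]
  [NormedAddCommGroup Y] [NormedSpace ℝ Y]
  [SecondCountableTopology Y] [MeasurableSpace Y] [BorelSpace Y]

/-- The three estimates of a regular sample, one on the signals, one on the noise given the signals,
and one on the noise, combined. -/
theorem measure_not_sampleRegularity_le (μ : Measure X) (ν : Measure Y) [IsProbabilityMeasure μ]
    [IsProbabilityMeasure ν] (z : I → X →L[ℝ] E) (η : I → Y →L[ℝ] E) {V : Submodule ℝ E}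
    (hV : ∀ i x, z i x ∈ V) {μ₀ s m c α₁ α₂ α₃ : ℝ}
    (h₁ : μ.real {x | ¬ ∀ a ∈ V, μ₀ * ‖a‖ ^ 2 ≤ ∑ i, (inner ℝ (z i x) a) ^ 2} ≤ α₁)
    (h₂ : ∀ w : I → E, ν.real {y | ¬ ∀ a b : E, |∑ i, inner ℝ (w i) a * inner ℝ (η i y) b|
      ≤ s * √(∑ i, (inner ℝ (w i) a) ^ 2) * ‖b‖} ≤ α₂)
    (h₃ : ν.real {y | ¬ ∀ a b : E, |∑ i, inner ℝ (η i y) a * inner ℝ (η i y) b - m * inner ℝ a b|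
      ≤ c * ‖a‖ * ‖b‖} ≤ α₃) :
    (μ.prod ν).real {p | ¬ SampleRegularity V (fun i => z i p.1) (fun i => η i p.2) μ₀ s m c}
      ≤ α₁ + α₂ + α₃ := by
  set B₁ := {x | ¬ ∀ a ∈ V, μ₀ * ‖a‖ ^ 2 ≤ ∑ i, (inner ℝ (z i x) a) ^ 2} with hB₁
  set B₂ := {p : X × Y | ¬ ∀ a b : E, |∑ i, inner ℝ (z i p.1) a * inner ℝ (η i p.2) b|
      ≤ s * √(∑ i, (inner ℝ (z i p.1) a) ^ 2) * ‖b‖} with hB₂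
  set B₃ := {y | ¬ ∀ a b : E, |∑ i, inner ℝ (η i y) a * inner ℝ (η i y) b - m * inner ℝ a b|
      ≤ c * ‖a‖ * ‖b‖} with hB₃
  have hsub : {p : X × Y | ¬ SampleRegularity V (fun i => z i p.1) (fun i => η i p.2) μ₀ s m c}
      ⊆ B₁ ×ˢ Set.univ ∪ B₂ ∪ Set.univ ×ˢ B₃ := by
    intro p hp
    by_contra hcon
    exact hp ⟨fun i => hV i p.1, not_not.1 fun h => hcon (.inl (.inl ⟨h, trivial⟩)),
      not_not.1 fun h => hcon (.inl (.inr h)), not_not.1 fun h => hcon (.inr ⟨trivial, h⟩)⟩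
  have hB₂m : MeasurableSet B₂ := by
    have h : IsClosed {p : X × Y | ∀ a b : E, |∑ i, inner ℝ (z i p.1) a * inner ℝ (η i p.2) b|
        ≤ s * √(∑ i, (inner ℝ (z i p.1) a) ^ 2) * ‖b‖} := by
      simp_rw [Set.ofPred_forall]
      refine isClosed_iInter fun a => isClosed_iInter fun b => isClosed_le ?_ ?_ <;> fun_prop
    exact h.measurableSet.compl
  have hα₂ : 0 ≤ α₂ := measureReal_nonneg.trans (h₂ 0)
  have e₂ : (μ.prod ν).real B₂ ≤ α₂ := by
    refine ENNReal.toReal_le_of_le_ofReal hα₂ ?_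
    rw [Measure.prod_apply hB₂m]
    calc ∫⁻ x, ν (Prod.mk x ⁻¹' B₂) ∂μ ≤ ∫⁻ _, ENNReal.ofReal α₂ ∂μ := by
          refine lintegral_mono fun x => ?_
          rw [← ENNReal.ofReal_toReal (measure_ne_top ν (Prod.mk x ⁻¹' B₂))]
          exact ENNReal.ofReal_le_ofReal (h₂ fun i => z i x)
      _ = ENNReal.ofReal α₂ := by simp
  have e₁ : (μ.prod ν).real (B₁ ×ˢ Set.univ) ≤ α₁ := by
    rw [measureReal_prod_prod]; simpa using h₁
  have e₃ : (μ.prod ν).real (Set.univ ×ˢ B₃) ≤ α₃ := by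
    rw [measureReal_prod_prod]; simpa using h₃
  have := measureReal_mono (μ := μ.prod ν) hsub
  have h4 := measureReal_union_le (μ := μ.prod ν) (B₁ ×ˢ Set.univ ∪ B₂) (Set.univ ×ˢ B₃)
  have h5 := measureReal_union_le (μ := μ.prod ν) (B₁ ×ˢ Set.univ) B₂
  linarith

end

section Pooled

variable {κ : Type*} [Fintype κ] {n : ℕ} {r m T : κ → ℕ} (M : ∀ k, LTISystem (r k) n (m k))
  (Su : ∀ k, Matrix (Fin (m k)) (Fin (m k)) ℝ)

/-- The driving variables and the noises, drawn separately for all systems and then regrouped by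
system, have the joint law of all driving variables. -/
theorem measurePreserving_regroup {σ : κ → ℝ} (hσ : ∀ k, (M k).Se = (σ k) ^ 2 • 1) :
    MeasurePreserving (fun p : (∀ k, Drive (r k) (m k) (T k)) ×
        (∀ k, Fin (T k + 1) → EuclideanSpace ℝ (Fin n)) =>
        fun k => ((p.1 k).1, (p.1 k).2, p.2 k))
      ((Measure.pi fun k => driveLaw (M k) (Su k) (T k)).prod (pooledNoiseLaw n T σ))
      (Measure.pi fun k => noiseLaw (M k) (Su k) (T k)) := by
  have h1 := measurePreserving_pi_zip (fun k => driveLaw (M k) (Su k) (T k))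
    (fun k => Measure.pi fun _ : Fin (T k + 1) =>
      multivariateGaussian (0 : EuclideanSpace ℝ (Fin n)) ((σ k) ^ 2 • 1))
  have h2 : ∀ k, MeasurePreserving (MeasurableEquiv.prodAssoc : Drive (r k) (m k) (T k) ×
        (Fin (T k + 1) → EuclideanSpace ℝ (Fin n)) ≃ᵐ _)
      ((driveLaw (M k) (Su k) (T k)).prod (Measure.pi fun _ : Fin (T k + 1) =>
        multivariateGaussian (0 : EuclideanSpace ℝ (Fin n)) ((σ k) ^ 2 • 1)))
      (noiseLaw (M k) (Su k) (T k)) := by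
    intro k
    rw [noiseLaw, hσ]
    exact measurePreserving_prodAssoc _ _ _
  exact (measurePreserving_pi _ _ h2).comp h1

/-- The samples of the pooled data are regular with high probability, with explicit tails. -/
theorem measure_not_sampleRegularity_pooled_le
    {σ : κ → ℝ} (hσ : ∀ k, (M k).Se = (σ k) ^ 2 • 1)
    (hSu : ∀ k, (Su k).PosDef) (hSw : ∀ k, (M k).Sw.PosSemidef)
    (hctrb : ∀ k, (ctrbMatrix (M k).A (M k).B (r k)).rank = r k)
    {d : ℕ} (hd : ∀ k, r k ≤ d) {V : Submodule ℝ (EuclideanSpace ℝ (Fin n))}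
    (hV : ∀ k, LinearMap.range (Matrix.toEuclideanLin (M k).C) = V) {φ : ℝ} (hφ0 : 0 ≤ φ)
    (hφ : ∀ k, φ ≤ sigmaMin (Su k) * sigmaMin (ctrbMatrix (M k).A (M k).B d) ^ 2
      * sigmaMin (M k).C ^ 2) {ψ ρ : ℝ} (hA : ∀ k, IsStableMatrix (M k).A ψ ρ) {w c : ℝ}
    (hw : ∀ k, ‖(M k).Sw + (M k).B * Su k * (M k).Bᵀ‖ ≤ w) (hc : ∀ k, ‖(M k).C‖ ≤ c)
    {Γ μ R lam τ t t' : ℝ} {j : ℕ} (hΓ : 0 < Γ) (hΓ' : w * c ^ 2 * (2 * ψ / (1 - ρ)) ^ 2 ≤ Γ)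
    (hμ : 0 < μ) (hμ' : μ ≤ φ * (∑ k, ((T k : ℝ) + 1 - d))) (hR : 0 < R) (hj : 1 ≤ j)
    (hRj : 32 * R ≤ 4 ^ j * μ) (hlam : 0 < lam) (hσlam : ∀ k, (σ k) ^ 2 ≤ lam)
    (hτ0 : 0 < τ) (hτ : ∑ i : Σ k, Fin (T k + 1), (σ i.1) ^ 2 ≤ τ) (ht : 0 ≤ t) (ht' : 0 ≤ t')
    (htτ : t' ≤ τ) :
    (Measure.pi fun k => noiseLaw (M k) (Su k) (T k)).real {ω | ¬ SampleRegularity V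
        (fun i : Σ k, Fin (T k + 1) =>
          Matrix.toEuclideanLin (M i.1).C (state (M i.1) (ω i.1) i.2))
        (fun i => (ω i.1).2.2 i.2) (μ / 32) (4 * t) (∑ i : Σ k, Fin (T k + 1), (σ i.1) ^ 2)
        (8 * t')}
      ≤ (Fintype.card (Σ k, Fin (T k + 1)) * n * Γ / R
        + 5 ^ (j * Module.finrank ℝ V) * Real.exp (-(μ / (32 * Γ))))
        + 25 ^ n * (2 * Real.exp (-(t ^ 2 / (2 * lam))))
        + 25 ^ n * (4 * Real.exp (-(t' ^ 2 / (8 * lam * τ)))) := by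
  have h₁ := measure_signal_le (P := Measure.pi fun k => driveLaw (M k) (Su k) (T k))
    (hasMeanZero_pi_driveLaw M Su) (pooledSignal M) V hΓ hμ
    (fun a b => (integral_sq_pooledSignal_le (fun k => (hSu k).posSemidef) hSw hA hw hc a b).trans
      (by gcongr))
    (fun a ha => le_trans (by gcongr)
      (le_sum_integral_sq_pooledSignal hSu hSw hctrb hd hV hφ0 hφ ha)) hR hj hRj
  have h₂ := fun z => measure_cross_le (P := pooledNoiseLaw n T σ) (hasMeanZero_pooledNoiseLaw σ)
    pooledNoise (fun i => (σ i.1) ^ 2) (integral_sq_pooledNoise σ) hlam (fun i => hσlam i.1) z ht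
  have h₃ := measure_noise_le (P := pooledNoiseLaw n T σ) (hasMeanZero_pooledNoiseLaw σ)
    pooledNoise (fun i => (σ i.1) ^ 2) (integral_sq_pooledNoise σ) (fun i => sq_nonneg _) hlam
    (fun i => hσlam i.1) hτ0 hτ ht' htτ
  simp only [finrank_euclideanSpace_fin] at h₁ h₂ h₃
  have h := measure_not_sampleRegularity_le _ _ (pooledSignal M) (pooledNoise (n := n) (T := T))
    (V := V) (fun i x => by rw [← hV i.1]; exact signal_mem_range _ _ _) h₁ h₂ h₃
  refine le_trans (le_of_eq ?_) h
  have hmp := measurePreserving_regroup M Su (T := T) hσ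
  have hmeas : MeasurableSet {ω : ∀ k, Noise (r k) n (m k) (T k) | ¬ SampleRegularity V
      (fun i : Σ k, Fin (T k + 1) => signal (M i.1) i.2 ((ω i.1).1, (ω i.1).2.1))
        (fun i => (ω i.1).2.2 i.2) (μ / 32) (4 * t) (∑ i : Σ k, Fin (T k + 1), (σ i.1) ^ 2)
        (8 * t')} := by
    refine (isClosed_sampleRegularity V (fun i => ?_) (fun i => ?_) _ _ _ _).measurableSet.compl
    · exact (signal (M i.1) i.2).continuous.comp (by fun_prop)
    · fun_prop
  have := hmp.measureReal_preimage hmeas.nullMeasurableSet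
  simp_rw [← signal_apply]
  exact this.symm

end Pooled

/-- The union bound over the nets is absorbed by the exponent. -/
theorem net_tail_le {n : ℕ} (hn : 2 ≤ n) {L x : ℝ} (hL : 1 ≤ L) (hx : 6 * n * L ≤ x) :
    25 ^ n * (4 * Real.exp (-x)) ≤ Real.exp (-L) / 8 := by
  have h1 : (142.5 : ℝ) ≤ Real.exp 5 := by
    have h := Real.exp_one_gt_d9
    calc (142.5 : ℝ) ≤ 2.7182818283 ^ 5 := by norm_num
      _ ≤ Real.exp 1 ^ 5 := by gcongr
      _ = Real.exp 5 := by rw [← Real.exp_nat_mul]; norm_num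
  have h2 : (32 : ℝ) ≤ 5.7 ^ n :=
    le_trans (by norm_num) (pow_le_pow_right₀ (by norm_num : (1 : ℝ) ≤ 5.7) hn)
  have h3 : (25 : ℝ) ^ n * 32 ≤ Real.exp (5 * n) := by
    calc (25 : ℝ) ^ n * 32 ≤ 25 ^ n * 5.7 ^ n := by gcongr
      _ = 142.5 ^ n := by rw [← mul_pow]; norm_num
      _ ≤ Real.exp 5 ^ n := by gcongr
      _ = Real.exp (5 * n) := by rw [← Real.exp_nat_mul]; ring_nf
  have hn1 : (1 : ℝ) ≤ n := by exact_mod_cast (by omega : 1 ≤ n)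
  have h4 : 5 * n + -x ≤ -L := by nlinarith
  calc 25 ^ n * (4 * Real.exp (-x)) = (25 ^ n * 32) * Real.exp (-x) / 8 := by ring
    _ ≤ Real.exp (5 * n) * Real.exp (-x) / 8 := by gcongr
    _ = Real.exp (5 * n + -x) / 8 := by rw [Real.exp_add]
    _ ≤ _ := by gcongr

theorem mesh_exponent_le {d n L i u y : ℝ} (hd : 1 ≤ d) (hn : 1 ≤ n) (hL : 1 ≤ L) (hi : 1 ≤ i)
    (hu : 1 / 4 ≤ u) (hy : y ≤ 8.63 + n + 16 * u + L + i + 1) :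
    2 * (y * d) + 3 + L ≤ 256 * (d * n * L * i * u) := by
  have hnL := one_le_mul_of_one_le_of_one_le hn hL
  have hni := one_le_mul_of_one_le_of_one_le hn hi
  have hLi := one_le_mul_of_one_le_of_one_le hL hi
  have hnLi := one_le_mul_of_one_le_of_one_le hnL hi
  have hd0 : 0 ≤ d := by linarith
  set Q := d * n * L * i with hQ
  have hQ1 : d ≤ Q := by
    calc d = d * 1 := (mul_one d).symm
      _ ≤ d * (n * L * i) := by gcongr
      _ = Q := by rw [hQ]; ring
  have hQ2 : d * n ≤ Q := by
    calc d * n = d * n * 1 := (mul_one _).symm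
      _ ≤ d * n * (L * i) := by gcongr
      _ = Q := by rw [hQ]; ring
  have hQ3 : d * L ≤ Q := by
    calc d * L = d * L * 1 := (mul_one _).symm
      _ ≤ d * L * (n * i) := by gcongr
      _ = Q := by rw [hQ]; ring
  have hQ4 : d * i ≤ Q := by
    calc d * i = d * i * 1 := (mul_one _).symm
      _ ≤ d * i * (n * L) := by gcongr
      _ = Q := by rw [hQ]; ring
  have hQ5 : L ≤ d * L := le_mul_of_one_le_left (by linarith) hd
  have hQ6 : d * u ≤ Q * u := by gcongr
  have hQ7 : Q * (1 / 4) ≤ Q * u := by gcongr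
  have h1 : y * d ≤ (8.63 + n + 16 * u + L + i + 1) * d := by gcongr
  linarith

/-- Choice of the mesh of the net for the signals. The Markov bound on the trace only costs the
logarithm of its constant, multiplied by the dimension. -/
theorem exists_signal_mesh {n d : ℕ} (hn : 1 ≤ n) (hd : 1 ≤ d) {L ℓ G φ τ : ℝ} (hL : 1 ≤ L)
    (hℓ : 1 / 2 ≤ ℓ) (hG : 1 ≤ G) (hGℓ : Real.log (16 * G) ≤ 16 * ℓ ^ 2) (hφ0 : 0 < φ) (hφ1 : φ ≤ 1)
    (hτ : 2 ^ 18 * (G * d * ℓ ^ 2 * n * L) / φ ^ 2 ≤ τ) :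
    ∃ j : ℕ, 1 ≤ j ∧ 2048 * n * (16 * G) / (Real.exp (-L) * φ) ≤ 4 ^ j ∧
      5 ^ (j * d) * Real.exp (-(φ * τ / 2 / (32 * (16 * G)))) ≤ Real.exp (-L) / 16 := by
  have hn1 : (1 : ℝ) ≤ n := by exact_mod_cast hn
  have hd1 : (1 : ℝ) ≤ d := by exact_mod_cast hd
  set x := 2048 * n * (16 * G) / (Real.exp (-L) * φ) with hx
  have hxpos : 0 < x := by positivity
  have hlogx : Real.log x
      = Real.log 2048 + Real.log n + Real.log (16 * G) + L + Real.log (1 / φ) := by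
    rw [hx, Real.log_div (by positivity) (by positivity), Real.log_mul (x := 2048 * (n : ℝ))
      (by positivity) (by positivity), Real.log_mul (x := 2048) (by positivity) (by positivity),
      Real.log_mul (Real.exp_pos _).ne' hφ0.ne', Real.log_exp, one_div, Real.log_inv]
    ring
  have h2048 : Real.log 2048 ≤ 7.63 := by
    rw [show (2048 : ℝ) = 2 ^ 11 by norm_num, Real.log_pow]
    have := Real.log_two_lt_d9
    push_cast
    linarith
  have h2048' : 0 ≤ Real.log 2048 := Real.log_nonneg (by norm_num)
  have hlogn : Real.log n ≤ n := (Real.log_le_sub_one_of_pos (by positivity)).trans (by linarith)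
  have hlogφ : Real.log (1 / φ) ≤ 1 / φ :=
    (Real.log_le_sub_one_of_pos (by positivity)).trans (by linarith)
  have hφ1' : 1 ≤ 1 / φ := by rw [le_div_iff₀ hφ0]; linarith
  have hx1 : 0 < Real.log x := by
    rw [hlogx]
    have e1 := Real.log_nonneg hn1
    have e2 := Real.log_nonneg hφ1'
    have e3 : 0 ≤ Real.log (16 * G) := Real.log_nonneg (by linarith)
    linarith
  -- `4 ≥ e`, so that the logarithm of the required mesh constant is enough
  refine ⟨⌈Real.log x⌉₊, Nat.ceil_pos.2 hx1, ?_, ?_⟩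
  · have e4 : Real.exp 1 ≤ 4 := (Real.exp_one_lt_d9.le).trans (by norm_num)
    calc x = Real.exp (Real.log x) := (Real.exp_log hxpos).symm
      _ ≤ Real.exp (⌈Real.log x⌉₊ * 1) := by
        rw [mul_one]; exact Real.exp_le_exp.2 (Nat.le_ceil _)
      _ = Real.exp 1 ^ ⌈Real.log x⌉₊ := Real.exp_nat_mul _ _
      _ ≤ _ := by gcongr
  · set j := ⌈Real.log x⌉₊ with hj
    have hjx : (j : ℝ) ≤ Real.log x + 1 := (Nat.ceil_lt_add_one hx1.le).le
    have e5 : (5 : ℝ) ≤ Real.exp 2 := by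
      have := Real.exp_one_gt_d9
      calc (5 : ℝ) ≤ 2.7182818283 ^ 2 := by norm_num
        _ ≤ Real.exp 1 ^ 2 := by gcongr
        _ = Real.exp 2 := by rw [← Real.exp_nat_mul]; norm_num
    have e16 : (16 : ℝ) ≤ Real.exp 3 := by
      have := Real.exp_one_gt_d9
      calc (16 : ℝ) ≤ 2.7182818283 ^ 3 := by norm_num
        _ ≤ Real.exp 1 ^ 3 := by gcongr
        _ = Real.exp 3 := by rw [← Real.exp_nat_mul]; norm_num
    have hmain : 2 * ((j : ℝ) * d) + 3 + L ≤ 256 * (d * n * L * (1 / φ) * ℓ ^ 2) :=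
      mesh_exponent_le hd1 hn1 hL hφ1' (by nlinarith) (by linarith)
    have hτ' : 256 * (d * n * L * (1 / φ) * ℓ ^ 2) ≤ φ * τ / 2 / (32 * (16 * G)) := by
      rw [div_div, le_div_iff₀ (by positivity)]
      rw [div_le_iff₀ (by positivity)] at hτ
      have h3 : φ * (256 * ((d : ℝ) * n * L * (1 / φ) * ℓ ^ 2) * (2 * (32 * (16 * G))))
          = 2 ^ 18 * (G * d * ℓ ^ 2 * n * L) := by
        field_simp
        ring
      have h4 : φ * (256 * ((d : ℝ) * n * L * (1 / φ) * ℓ ^ 2) * (2 * (32 * (16 * G))))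
          ≤ φ * (φ * τ) := by rw [h3]; linarith [hτ]
      exact le_of_mul_le_mul_left h4 hφ0
    calc 5 ^ (j * d) * Real.exp (-(φ * τ / 2 / (32 * (16 * G))))
        = (5 ^ (j * d) * 16) * Real.exp (-(φ * τ / 2 / (32 * (16 * G)))) / 16 := by ring
      _ ≤ (Real.exp 2 ^ (j * d) * Real.exp 3) * Real.exp (-(φ * τ / 2 / (32 * (16 * G)))) / 16 := by
          gcongr
      _ = Real.exp (2 * ((j : ℝ) * d) + 3 + -(φ * τ / 2 / (32 * (16 * G)))) / 16 := by
          rw [← Real.exp_nat_mul, Real.exp_add, Real.exp_add]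
          push_cast
          ring_nf
      _ ≤ _ := by
          gcongr
          linarith

section Pooled

variable {κ : Type*} [Fintype κ] {n : ℕ} {r m T : κ → ℕ} {M : ∀ k, LTISystem (r k) n (m k)}
  {Su : ∀ k, Matrix (Fin (m k)) (Fin (m k)) ℝ}

/-- The samples of the pooled data are regular with probability at least `1 - exp (-L) / 2`, once
the total length `τ` of the trajectories is large. -/
theorem measure_not_sampleRegularity_pooled_le_exp
    {σ : κ → ℝ} (hσ : ∀ k, (M k).Se = (σ k) ^ 2 • 1)
    (hSu : ∀ k, (Su k).PosDef) (hSw : ∀ k, (M k).Sw.PosSemidef)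
    (hctrb : ∀ k, (ctrbMatrix (M k).A (M k).B (r k)).rank = r k)
    {d : ℕ} (hd1 : 1 ≤ d) (hd : ∀ k, r k ≤ d) {V : Submodule ℝ (EuclideanSpace ℝ (Fin n))}
    (hVd : Module.finrank ℝ V ≤ d) (hn : 2 ≤ n)
    (hV : ∀ k, LinearMap.range (Matrix.toEuclideanLin (M k).C) = V) {φ : ℝ} (hφ0 : 0 < φ)
    (hφ1 : φ ≤ 1)
    (hφ : ∀ k, φ ≤ sigmaMin (Su k) * sigmaMin (ctrbMatrix (M k).A (M k).B d) ^ 2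
      * sigmaMin (M k).C ^ 2) {ψ ρ : ℝ} (hA : ∀ k, IsStableMatrix (M k).A ψ ρ) {w c : ℝ}
    (hw : ∀ k, ‖(M k).Sw + (M k).B * Su k * (M k).Bᵀ‖ ≤ w) (hc : ∀ k, ‖(M k).C‖ ≤ c)
    {G ℓ L lam τ : ℝ} (hG : 1 ≤ G) (hG' : w * c ^ 2 * (2 * ψ / (1 - ρ)) ^ 2 ≤ 16 * G)
    (hL : 1 ≤ L) (hℓ : 1 / 2 ≤ ℓ) (hGℓ : Real.log (16 * G) ≤ 16 * ℓ ^ 2)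
    (hlam : 0 < lam) (hσlam : ∀ k, (σ k) ^ 2 ≤ lam)
    (hτ1 : τ / 2 ≤ ∑ k, ((T k : ℝ) + 1 - d)) (hτ2 : ∑ k, ((T k : ℝ) + 1) ≤ 2 * τ)
    (hτ3 : 25 * (n * L) ≤ τ) (hτ4 : 2 ^ 18 * (G * d * ℓ ^ 2 * n * L) / φ ^ 2 ≤ τ) :
    (Measure.pi fun k => noiseLaw (M k) (Su k) (T k)).real {ω | ¬ SampleRegularity V
        (fun i : Σ k, Fin (T k + 1) =>
          Matrix.toEuclideanLin (M i.1).C (state (M i.1) (ω i.1) i.2))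
        (fun i => (ω i.1).2.2 i.2) (φ * τ / 64) (4 * √(12 * lam * n * L))
        (∑ i : Σ k, Fin (T k + 1), (σ i.1) ^ 2) (8 * (10 * lam * √(τ * n * L)))}
      ≤ Real.exp (-L) / 2 := by
  obtain ⟨j, hj1, hj2, hj3⟩ := exists_signal_mesh (by omega : 1 ≤ n) hd1 hL hℓ hG hGℓ hφ0 hφ1 hτ4
  have hn1 : (2 : ℝ) ≤ n := by exact_mod_cast hn
  have hτ0 : 0 < τ := lt_of_lt_of_le (by positivity) hτ3
  have hcard : ((Fintype.card (Σ k, Fin (T k + 1)) : ℕ) : ℝ) ≤ 2 * τ := by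
    rw [Fintype.card_sigma]
    push_cast
    simpa using hτ2
  have hsum : ∑ i : Σ k, Fin (T k + 1), (σ i.1) ^ 2 ≤ 2 * τ * lam := by
    calc ∑ i : Σ k, Fin (T k + 1), (σ i.1) ^ 2 ≤ ∑ i : Σ k, Fin (T k + 1), lam :=
          Finset.sum_le_sum fun i _ => hσlam i.1
      _ = (Fintype.card (Σ k, Fin (T k + 1)) : ℕ) * lam := by
          rw [Finset.sum_const, Finset.card_univ, nsmul_eq_mul]
      _ ≤ _ := by gcongr
  have hsq : √(τ * n * L) ≤ τ / 5 := by
    rw [Real.sqrt_le_left (by positivity)]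
    nlinarith
  -- each of the four failure probabilities is at most `exp (-L) / 8`: `R` is chosen for the Markov
  -- bound, `t` and `t'` for the two noise bounds
  have h := measure_not_sampleRegularity_pooled_le (T := T) M Su hσ hSu hSw hctrb hd hV hφ0.le hφ
    hA hw hc
    (Γ := 16 * G) (μ := φ * τ / 2) (R := 32 * τ * n * (16 * G) / Real.exp (-L)) (lam := lam)
    (τ := 2 * τ * lam) (t := √(12 * lam * n * L)) (t' := 10 * lam * √(τ * n * L)) (j := j)
    (by positivity) hG' (by positivity)
    (by
      calc φ * τ / 2 = φ * (τ / 2) := by ring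
        _ ≤ _ := by gcongr)
    (by positivity) hj1
    (by
      rw [div_le_iff₀ (by positivity)] at hj2
      rw [mul_div_assoc', div_le_iff₀ (Real.exp_pos _)]
      calc 32 * (32 * τ * n * (16 * G)) = 2048 * n * (16 * G) * (τ / 2) := by ring
        _ ≤ 4 ^ j * (Real.exp (-L) * φ) * (τ / 2) := by gcongr
        _ = _ := by ring)
    hlam hσlam (by positivity) hsum (by positivity) (by positivity)
    (by nlinarith)
  have e1 : (Fintype.card (Σ k, Fin (T k + 1)) : ℕ) * n * (16 * G)
      / (32 * τ * n * (16 * G) / Real.exp (-L)) ≤ Real.exp (-L) / 16 := by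
    rw [div_div_eq_mul_div, div_le_div_iff₀ (by positivity) (by positivity)]
    calc _ ≤ 2 * τ * n * (16 * G) * Real.exp (-L) * 16 := by gcongr
      _ = _ := by ring
  have e2 : (5 : ℝ) ^ (j * Module.finrank ℝ V) * Real.exp (-(φ * τ / 2 / (32 * (16 * G))))
      ≤ Real.exp (-L) / 16 := by
    refine le_trans ?_ hj3
    gcongr
    norm_num
  have e3 : (25 : ℝ) ^ n * (2 * Real.exp (-(√(12 * lam * n * L) ^ 2 / (2 * lam))))
      ≤ Real.exp (-L) / 8 := by
    refine le_trans ?_ (net_tail_le hn hL (x := 6 * n * L) le_rfl)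
    rw [Real.sq_sqrt (by positivity), show 12 * lam * n * L / (2 * lam) = 6 * n * L by
      field_simp; ring]
    gcongr
    norm_num
  have e4 : (25 : ℝ) ^ n * (4 * Real.exp (-((10 * lam * √(τ * n * L)) ^ 2
      / (8 * lam * (2 * τ * lam))))) ≤ Real.exp (-L) / 8 := by
    refine net_tail_le hn hL ?_
    rw [mul_pow, Real.sq_sqrt (by positivity), le_div_iff₀ (by positivity)]
    have : 0 ≤ lam ^ 2 * τ * n * L := by positivity
    nlinarith
  have e5 : φ * τ / 2 / 32 = φ * τ / 64 := by ring
  rw [e5] at h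
  have := Real.exp_pos (-L)
  linarith

end Pooled

/-! ### The column space approximation on regular samples -/

/-- The columns of `Φ` are an orthonormal frame of dimension `dim V` whose span is close to `V`, in
that the projection error of `x ∈ V` is at most `2ε` times the size of the projection. -/
structure IsFrameNear {n p : ℕ} (V : Submodule ℝ (EuclideanSpace ℝ (Fin n)))
    (Φ : Matrix (Fin n) (Fin p) ℝ) (ε : ℝ) : Prop where
  orthonormal : Φᵀ * Φ = 1
  finrank_eq : Module.finrank ℝ V = p
  norm_sub_le : ∀ x ∈ V, ‖x - Matrix.toEuclideanLin Φ (Matrix.toEuclideanLin Φᵀ x)‖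
    ≤ 2 * ε * ‖Matrix.toEuclideanLin Φᵀ x‖
  injOn : ∀ x ∈ V, Matrix.toEuclideanLin Φᵀ x = 0 → x = 0

theorem inner_toEuclideanLin_dataCov {n : ℕ} {κ : Type} [Fintype κ] {T : κ → ℕ}
    (Y : ∀ k, Fin (T k + 1) → EuclideanSpace ℝ (Fin n)) (v w : EuclideanSpace ℝ (Fin n)) :
    inner ℝ v (Matrix.toEuclideanLin (dataCov Y) w)
      = ∑ i : Σ k, Fin (T k + 1), inner ℝ (Y i.1 i.2) v * inner ℝ (Y i.1 i.2) w := by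
  have h : ∀ y : EuclideanSpace ℝ (Fin n),
      inner ℝ v (Matrix.toEuclideanLin (Matrix.vecMulVec y y) w) = inner ℝ y v * inner ℝ y w := by
    intro y
    have e : Matrix.toEuclideanLin (Matrix.vecMulVec y y) w = (inner ℝ y w) • y := by
      ext i
      change (Matrix.vecMulVec y y *ᵥ w.ofLp) i = _
      rw [Matrix.vecMulVec_mulVec]
      simp [PiLp.inner_apply, dotProduct, mul_comm]
    rw [e, real_inner_smul_right, real_inner_comm v y, mul_comm]
  rw [dataCov, Fintype.sum_sigma]
  simp_rw [map_sum, LinearMap.sum_apply, inner_sum, h]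

theorem toEuclideanLin_transpose_eq_adjoint {a b : Type*} [Fintype a] [Fintype b] [DecidableEq a]
    [DecidableEq b] (X : Matrix a b ℝ) :
    Matrix.toEuclideanLin Xᵀ = LinearMap.adjoint (Matrix.toEuclideanLin X) := by
  rw [← Matrix.conjTranspose_eq_transpose_of_trivial,
    Matrix.toEuclideanLin_conjTranspose_eq_adjoint]

theorem toEuclideanLin_eq_sum_col {n p : ℕ} (Φ : Matrix (Fin n) (Fin p) ℝ)
    (b : EuclideanSpace ℝ (Fin p)) :
    Matrix.toEuclideanLin Φ b = ∑ j, b j • WithLp.toLp 2 (Φ.col j) := by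
  ext i
  change (Φ *ᵥ b.ofLp) i = _
  simp [Matrix.mulVec, dotProduct, mul_comm]

/-- On regular samples the rank is estimated correctly and the eigenvectors are close to `V`. -/
theorem IsColApprox.isFrameNear {n : ℕ} {κ : Type} [Fintype κ] {T : κ → ℕ}
    {f : (∀ k, Fin (T k + 1) → EuclideanSpace ℝ (Fin n)) → (p : ℕ) × Matrix (Fin n) (Fin p) ℝ}
    (hf : IsColApprox f) {Y : ∀ k, Fin (T k + 1) → EuclideanSpace ℝ (Fin n)}
    {V : Submodule ℝ (EuclideanSpace ℝ (Fin n))}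
    {z η : (Σ k, Fin (T k + 1)) → EuclideanSpace ℝ (Fin n)} (hY : ∀ i, Y i.1 i.2 = z i + η i)
    {μ₀ s m ν ε : ℝ} (h : SampleRegularity V z η μ₀ s m ν) (hV1 : 1 ≤ Module.finrank ℝ V)
    (hVn : Module.finrank ℝ V < n) (hμ : 0 < μ₀) (hs : 0 ≤ s) (hsμ : 64 * s ^ 2 ≤ μ₀)
    (hν : 4 * ν ≤ μ₀) (hν0 : 0 ≤ ν)
    (hgap : ((∑ k, T k : ℕ) : ℝ) ^ (3 / 4 : ℝ) < μ₀ / 2 - ν)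
    (hbulk : 2 * ν + s ^ 2 ≤ ((∑ k, T k : ℕ) : ℝ) ^ (3 / 4 : ℝ))
    (hε : 2 * s / √(μ₀ / 2) + ν / (μ₀ / 2) ≤ ε) (hε2 : ε ≤ 1 / 2) :
    IsFrameNear V (f Y).2 ε := by
  have hS : ∀ v w, inner ℝ v (Matrix.toEuclideanLin (dataCov Y) w)
      = ∑ i, inner ℝ (z i + η i) v * inner ℝ (z i + η i) w := by
    intro v w
    rw [inner_toEuclideanLin_dataCov]
    simp_rw [hY]
  have hbig : ∀ i, i < Module.finrank ℝ V → m + μ₀ / 2 ≤ singVal (dataCov Y) i := fun i hi =>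
    h.le_singularValues hS hs hsμ hν hi
  have hp : (f Y).1 = Module.finrank ℝ V := by
    rw [hf.rank_eq]
    refine rankEst_eq_of_gap _ _ hV1 (by omega) (lo := m - s ^ 2 - ν) (hi := m + ν) ?_ ?_ ?_
    · have := hbig (Module.finrank ℝ V - 1) (by omega)
      linarith
    · linarith
    · intro i hi hin
      exact h.singularValues_mem hS hi (by simpa using hin)
  have hcols : Orthonormal ℝ fun j =>
      (WithLp.toLp 2 ((f Y).2.col j) : EuclideanSpace ℝ (Fin n)) := by
    rw [orthonormal_iff_ite]
    intro i j
    have := congrFun (congrFun (hf.orthonormal Y) i) j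
    rw [Matrix.one_apply] at this
    rw [← this]
    simp [PiLp.inner_apply, Matrix.mul_apply, mul_comm]
  have hε0 : 0 ≤ 2 * s / √(μ₀ / 2) + ν / (μ₀ / 2) := by positivity
  have hclose : ∀ e ∈ Vᗮ, ∀ b, inner ℝ e (Matrix.toEuclideanLin (f Y).2 b) ≤ ε * ‖e‖ * ‖b‖ := by
    intro e he b
    rw [toEuclideanLin_eq_sum_col]
    refine (h.inner_eigenvectors_le hS hμ hs hsμ hν hν0 hcols
      (θ := fun j => singVal (dataCov Y) j) (fun j => hbig j (hp ▸ j.2))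
      (fun j => ?_) he b).trans ?_
    · have := hf.eigenvector Y j
      ext i
      exact congrFun this i
    · gcongr
  have hadj : ∀ b, LinearMap.adjoint (Matrix.toEuclideanLin (f Y).2)
      (Matrix.toEuclideanLin (f Y).2 b) = b := by
    intro b
    rw [← toEuclideanLin_transpose_eq_adjoint, ← toEuclideanLin_mul_apply, hf.orthonormal,
      Matrix.toLpLin_one, LinearMap.id_apply]
  refine ⟨hf.orthonormal Y, hp.symm, fun x hx => ?_, fun x hx => ?_⟩ <;>
    rw [toEuclideanLin_transpose_eq_adjoint]
  · exact (norm_sub_proj_le_of_close V hp.symm _ hadj (hε0.trans hε) hε2 hclose hx).1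
  · exact (norm_sub_proj_le_of_close V hp.symm _ hadj (hε0.trans hε) hε2 hclose hx).2

namespace IsFrameNear

variable {n p : ℕ} {V : Submodule ℝ (EuclideanSpace ℝ (Fin n))} {Φ : Matrix (Fin n) (Fin p) ℝ}
  {ε : ℝ}

theorem norm_toEuclideanLin (h : IsFrameNear V Φ ε) (b : EuclideanSpace ℝ (Fin p)) :
    ‖Matrix.toEuclideanLin Φ b‖ = ‖b‖ := by
  have : ‖Matrix.toEuclideanLin Φ b‖ ^ 2 = ‖b‖ ^ 2 := by
    rw [← real_inner_self_eq_norm_sq, inner_toEuclideanLin_left, ← toEuclideanLin_mul_apply,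
      h.orthonormal, Matrix.toLpLin_one, LinearMap.id_apply, real_inner_self_eq_norm_sq]
  exact (pow_left_inj₀ (norm_nonneg _) (norm_nonneg _) two_ne_zero).1 this

/-- Lifting an approximation `Z` of `Φᵀ X` by `Φ`: the error of the frame enters relative to the
size of `Z` rather than to that of `X`. -/
theorem norm_sub_mul_le {r : ℕ} (h : IsFrameNear V Φ ε) (hε : 0 ≤ ε)
    {X : Matrix (Fin n) (Fin r) ℝ}
    (hX : LinearMap.range (Matrix.toEuclideanLin X) ≤ V) (Z : Matrix (Fin p) (Fin r) ℝ) :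
    ‖X - Φ * Z‖ ≤ (1 + 2 * ε) * ‖Φᵀ * X - Z‖ + 2 * ε * ‖Φ * Z‖ := by
  rw [Matrix.l2_opNorm_def]
  refine ContinuousLinearMap.opNorm_le_bound _ (by positivity) fun v => ?_
  change ‖Matrix.toEuclideanLin (X - Φ * Z) v‖ ≤ _
  set x := Matrix.toEuclideanLin X v with hx
  have hxV : x ∈ V := hX (LinearMap.mem_range_self _ _)
  set y := Matrix.toEuclideanLin Φᵀ x with hy
  set w := Matrix.toEuclideanLin Z v with hw
  have e1 : Matrix.toEuclideanLin (X - Φ * Z) v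
      = (x - Matrix.toEuclideanLin Φ y) + Matrix.toEuclideanLin Φ (y - w) := by
    rw [map_sub, LinearMap.sub_apply, toEuclideanLin_mul_apply, map_sub]
    abel
  have e2 : y - w = Matrix.toEuclideanLin (Φᵀ * X - Z) v := by
    rw [map_sub, LinearMap.sub_apply, toEuclideanLin_mul_apply]
  have e3 : ‖y - w‖ ≤ ‖Φᵀ * X - Z‖ * ‖v‖ := by rw [e2]; exact norm_toEuclideanLin_le _ _
  have e4 : ‖w‖ ≤ ‖Φ * Z‖ * ‖v‖ := by
    rw [← h.norm_toEuclideanLin w, hw, ← toEuclideanLin_mul_apply]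
    exact norm_toEuclideanLin_le _ _
  have e5 : ‖y‖ ≤ ‖y - w‖ + ‖w‖ := by
    calc ‖y‖ = ‖(y - w) + w‖ := by rw [sub_add_cancel]
      _ ≤ _ := norm_add_le _ _
  rw [e1]
  calc ‖(x - Matrix.toEuclideanLin Φ y) + Matrix.toEuclideanLin Φ (y - w)‖
      ≤ ‖x - Matrix.toEuclideanLin Φ y‖ + ‖Matrix.toEuclideanLin Φ (y - w)‖ := norm_add_le _ _
    _ ≤ 2 * ε * ‖y‖ + ‖y - w‖ := by
        rw [h.norm_toEuclideanLin]
        gcongr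
        exact h.norm_sub_le x hxV
    _ ≤ 2 * ε * (‖Φᵀ * X - Z‖ * ‖v‖ + ‖Φ * Z‖ * ‖v‖) + ‖Φᵀ * X - Z‖ * ‖v‖ := by
        gcongr
        linarith
    _ = _ := by ring

/-- The lifted estimate is as good as the estimate for the projected system, up to the error of the
frame. -/
theorem paramError_le {r m : ℕ} (h : IsFrameNear V Φ ε) (hε : 0 ≤ ε) (M : LTISystem r n m)
    (hC : LinearMap.range (Matrix.toEuclideanLin M.C) ≤ V) (S : Matrix (Fin r) (Fin r) ℝ)
    (e : Params r p m) :
    paramError M S (e.1, e.2.1, Φ * e.2.2)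
      ≤ (1 + 2 * ε) * paramError (projSystem M Φ) S e + 2 * ε * ‖Φ * e.2.2‖ := by
  have h0 : 0 ≤ 2 * ε * ‖Φ * e.2.2‖ := by positivity
  have hCS : LinearMap.range (Matrix.toEuclideanLin (M.C * S)) ≤ V := by
    rintro _ ⟨v, rfl⟩
    rw [toEuclideanLin_mul_apply]
    exact hC (LinearMap.mem_range_self _ _)
  have h1 := h.norm_sub_mul_le hε hCS e.2.2
  rw [← Matrix.mul_assoc] at h1
  set D := paramError (projSystem M Φ) S e with hD
  have hA : ‖S⁻¹ * M.A * S - e.1‖ ≤ D := le_max_left _ _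
  have hB : ‖S⁻¹ * M.B - e.2.1‖ ≤ D := (le_max_left _ _).trans (le_max_right _ _)
  have hCC : ‖Φᵀ * M.C * S - e.2.2‖ ≤ D := (le_max_right _ _).trans (le_max_right _ _)
  have hD0 : 0 ≤ D := (norm_nonneg _).trans hA
  have hD1 : D ≤ (1 + 2 * ε) * D := by nlinarith
  refine max_le (by linarith) (max_le (by linarith) (h1.trans ?_))
  gcongr

end IsFrameNear

/-! ### The projected system and the oracle -/

instance instBorelSpaceRealMatrix {a b : Type*} [Countable a] [Countable b] :
    BorelSpace (Matrix a b ℝ) :=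
  inferInstanceAs (BorelSpace (a → b → ℝ))

section Measurability

variable {r n m T p : ℕ}

theorem isCompact_setOf_det_ge (k : ℕ) :
    IsCompact {S : Matrix (Fin r) (Fin r) ℝ | (∀ i j, S i j ∈ Set.Icc (-(k : ℝ)) k) ∧
      1 / ((k : ℝ) + 1) ≤ |S.det|} := by
  have h1 : IsCompact {S : Fin r → Fin r → ℝ | ∀ i j, S i j ∈ Set.Icc (-(k : ℝ)) k} := by
    have := isCompact_univ_pi (X := fun _ : Fin r => Fin r → ℝ) fun _ => isCompact_univ_pi
      fun _ : Fin r => isCompact_Icc (a := -(k : ℝ)) (b := k)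
    refine (congrArg IsCompact (Set.ext fun S => ?_)).mp this
    simp only [Set.mem_pi, Set.mem_univ, true_implies, Set.mem_ofPred_eq]
  have h1 : IsCompact {S : Matrix (Fin r) (Fin r) ℝ | ∀ i j, S i j ∈ Set.Icc (-(k : ℝ)) k} := h1
  exact h1.inter_right (isClosed_le continuous_const (continuous_id.matrix_det.abs))

/-- Whether an estimate matches the system up to a change of coordinates is a measurable property:
the invertible matrices are a countable union of compact sets. -/
theorem measurableSet_exists_paramError_le (M : LTISystem r n m) (c : ℝ) :
    MeasurableSet {e : Params r n m | ∃ S : Matrix (Fin r) (Fin r) ℝ, IsUnit S ∧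
      paramError M S e ≤ c} := by
  set K : ℕ → Set (Matrix (Fin r) (Fin r) ℝ) := fun k =>
    {S | (∀ i j, S i j ∈ Set.Icc (-(k : ℝ)) k) ∧ 1 / ((k : ℝ) + 1) ≤ |S.det|} with hK
  have hdet : ∀ k, ∀ S ∈ K k, S.det ≠ 0 := by
    intro k S hS h0
    have := hS.2
    rw [h0, abs_zero] at this
    have h1 : (0 : ℝ) < 1 / ((k : ℝ) + 1) := by positivity
    linarith
  have hunion : {e : Params r n m | ∃ S : Matrix (Fin r) (Fin r) ℝ, IsUnit S ∧
      paramError M S e ≤ c} = ⋃ k, {e | ∃ S : K k, paramError M S e ≤ c} := by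
    ext e
    simp only [Set.mem_ofPred_eq, Set.mem_iUnion]
    constructor
    · rintro ⟨S, hS, h⟩
      have hd : 0 < |S.det| := abs_pos.2 ((Matrix.isUnit_iff_isUnit_det S).1 hS).ne_zero
      obtain ⟨k₁, hk₁⟩ := exists_nat_ge (∑ i, ∑ j, |S i j|)
      obtain ⟨k₂, hk₂⟩ := exists_nat_one_div_lt hd
      refine ⟨max k₁ k₂, ⟨S, fun i j => abs_le.1 ?_, ?_⟩, h⟩
      · calc |S i j| ≤ ∑ j, |S i j| :=
              Finset.single_le_sum (f := fun j => |S i j|) (fun j _ => abs_nonneg _)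
                (Finset.mem_univ j)
          _ ≤ ∑ i, ∑ j, |S i j| :=
              Finset.single_le_sum (f := fun i => ∑ j, |S i j|)
                (fun i _ => Finset.sum_nonneg fun j _ => abs_nonneg _) (Finset.mem_univ i)
          _ ≤ k₁ := hk₁
          _ ≤ _ := by exact_mod_cast le_max_left _ _
      · refine le_trans ?_ hk₂.le
        have : (k₂ : ℝ) ≤ (max k₁ k₂ : ℕ) := by exact_mod_cast le_max_right _ _
        gcongr
    · rintro ⟨k, ⟨S, hS⟩, h⟩
      exact ⟨S, (Matrix.isUnit_iff_isUnit_det S).2 (hdet k S hS).isUnit, h⟩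
  rw [hunion]
  refine MeasurableSet.iUnion fun k => IsClosed.measurableSet ?_
  have hcomp : CompactSpace (K k) := isCompact_iff_compactSpace.1 (isCompact_setOf_det_ge k)
  have hinv : Continuous fun S : K k => (S : Matrix (Fin r) (Fin r) ℝ)⁻¹ := by
    simp_rw [Matrix.inv_def, Ring.inverse_eq_inv']
    exact (Continuous.inv₀ continuous_subtype_val.matrix_det fun S => hdet k S S.2).smul
      continuous_subtype_val.matrix_adjugate
  have hcont : Continuous fun q : K k × Params r n m => paramError M q.1 q.2 := by
    have h1 : Continuous fun q : K k × Params r n m => (q.1 : Matrix (Fin r) (Fin r) ℝ) :=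
      continuous_subtype_val.comp continuous_fst
    have h2 : Continuous fun q : K k × Params r n m => (q.1 : Matrix (Fin r) (Fin r) ℝ)⁻¹ :=
      hinv.comp continuous_fst
    unfold paramError
    refine (Continuous.norm ?_).max ((Continuous.norm ?_).max (Continuous.norm ?_))
    · exact ((h2.matrix_mul continuous_const).matrix_mul h1).sub (by fun_prop)
    · exact (h2.matrix_mul continuous_const).sub (by fun_prop)
    · exact (continuous_const.matrix_mul h1).sub (by fun_prop)
  have : {e : Params r n m | ∃ S : K k, paramError M S e ≤ c}
      = Prod.snd '' {q : K k × Params r n m | paramError M q.1 q.2 ≤ c} := by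
    ext e
    simp
  rw [this]
  exact isClosedMap_snd_of_compactSpace _ (isClosed_le hcont continuous_const)

theorem measurable_ioData (M : LTISystem r n m) :
    Measurable (ioData M : Noise r n m T → IOData n m T) := by
  have : Continuous (ioData M : Noise r n m T → IOData n m T) := by
    refine continuous_fst.prodMk (continuous_pi fun t => ?_)
    have h : (fun ω : Noise r n m T => output M ω t)
        = fun ω => signal M t (ω.1, ω.2.1) + ω.2.2 t := by
      ext1 ω
      rw [signal_apply, output]
    change Continuous fun ω : Noise r n m T => output M ω t
    rw [h]
    fun_prop
  exact this.measurable

end Measurability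

section Projection

variable {r n m T p : ℕ}

/-- Projecting the observation noises turns the law for `M` into the law for the projected
system. -/
theorem measurePreserving_projNoise (M : LTISystem r n m) (hSe : M.Se.PosSemidef)
    (Su : Matrix (Fin m) (Fin m) ℝ) (Φ : Matrix (Fin n) (Fin p) ℝ) :
    MeasurePreserving (fun ω : Noise r n m T =>
        ((ω.1, ω.2.1, fun t => Matrix.toEuclideanLin Φᵀ (ω.2.2 t)) : Noise r p m T))
      (noiseLaw M Su T) (noiseLaw (projSystem M Φ) Su T) := by
  have h1 : MeasurePreserving (Matrix.toEuclideanLin Φᵀ) (multivariateGaussian 0 M.Se)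
      (multivariateGaussian 0 (Φᵀ * M.Se * Φ)) := by
    refine ⟨(LinearMap.continuous_of_finiteDimensional _).measurable, ?_⟩
    rw [map_toEuclideanLin_multivariateGaussian hSe, Matrix.transpose_transpose]
  have h2 := measurePreserving_pi (ι := Fin (T + 1)) _ _ fun _ => h1
  exact (MeasurePreserving.id _).prod ((MeasurePreserving.id _).prod h2)

theorem projData_ioData (M : LTISystem r n m) (Φ : Matrix (Fin n) (Fin p) ℝ) (ω : Noise r n m T) :
    projData Φ (ioData M ω) = ioData (projSystem M Φ)
      (ω.1, ω.2.1, fun t => Matrix.toEuclideanLin Φᵀ (ω.2.2 t)) := by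
  refine Prod.ext rfl (funext fun t => ?_)
  change Matrix.toEuclideanLin Φᵀ (Matrix.toEuclideanLin M.C (state M ω t) + ω.2.2 t)
    = Matrix.toEuclideanLin (Φᵀ * M.C) (state M ω t) + Matrix.toEuclideanLin Φᵀ (ω.2.2 t)
  rw [map_add, toEuclideanLin_mul_apply]

theorem rank_eq_iff_forall_toEuclideanLin {α : Type*} [Fintype α] [DecidableEq α]
    (X : Matrix α (Fin r) ℝ) :
    X.rank = r ↔ ∀ x, Matrix.toEuclideanLin X x = 0 → x = 0 := by
  have h := LinearMap.finrank_range_add_finrank_ker (Matrix.toEuclideanLin X)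
  rw [range_toEuclideanLin_finrank, finrank_euclideanSpace_fin] at h
  rw [← LinearMap.ker_eq_bot', ← Submodule.finrank_eq_zero]
  omega

theorem toEuclideanLin_obsvMatrix_eq_zero_iff {A : Matrix (Fin r) (Fin r) ℝ}
    {C : Matrix (Fin n) (Fin r) ℝ} {d : ℕ} {x : EuclideanSpace ℝ (Fin r)} :
    Matrix.toEuclideanLin (obsvMatrix A C d) x = 0
      ↔ ∀ i : Fin d, Matrix.toEuclideanLin C (Matrix.toEuclideanLin (A ^ (i : ℕ)) x) = 0 := by
  simp_rw [← toEuclideanLin_mul_apply]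
  constructor
  · intro h i
    ext j
    exact congrFun (congrArg WithLp.ofLp h) (i, j)
  · intro h
    ext ij
    exact congrFun (congrArg WithLp.ofLp (h ij.1)) ij.2

/-- Observability survives the projection, as `Φᵀ` is injective on the column space of `C`. -/
theorem IsFrameNear.isMinimal_projSystem {V : Submodule ℝ (EuclideanSpace ℝ (Fin n))}
    {Φ : Matrix (Fin n) (Fin p) ℝ} {ε : ℝ} (h : IsFrameNear V Φ ε) {M : LTISystem r n m}
    (hC : LinearMap.range (Matrix.toEuclideanLin M.C) ≤ V) (hM : IsMinimal M) :
    IsMinimal (projSystem M Φ) := by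
  refine ⟨hM.1, (rank_eq_iff_forall_toEuclideanLin _).2 fun x hx => ?_⟩
  refine (rank_eq_iff_forall_toEuclideanLin _).1 hM.2 x
    (toEuclideanLin_obsvMatrix_eq_zero_iff.2 fun i => ?_)
  have h1 := toEuclideanLin_obsvMatrix_eq_zero_iff.1 hx i
  refine h.injOn _ (hC (LinearMap.mem_range_self _ _)) ?_
  rw [← toEuclideanLin_mul_apply]
  exact h1

end Projection

section Polynomials

/-- The polynomial with the absolute values of the coefficients; it is monotone on non-negative
arguments. -/
noncomputable def absPoly {ι : Type*} (p : MvPolynomial ι ℝ) : MvPolynomial ι ℝ :=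
  ∑ d ∈ p.support, MvPolynomial.monomial d |p.coeff d|

theorem eval_absPoly {ι : Type*} (p : MvPolynomial ι ℝ) (y : ι → ℝ) :
    MvPolynomial.eval y (absPoly p) = ∑ d ∈ p.support, |p.coeff d| * d.prod fun i k => y i ^ k := by
  rw [absPoly, map_sum]
  exact Finset.sum_congr rfl fun d _ => MvPolynomial.eval_monomial

theorem abs_eval_le_eval_absPoly {ι : Type*} (p : MvPolynomial ι ℝ) {x y : ι → ℝ}
    (h : ∀ i, |x i| ≤ y i) : |MvPolynomial.eval x p| ≤ MvPolynomial.eval y (absPoly p) := by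
  rw [eval_absPoly, MvPolynomial.eval_eq]
  refine (Finset.abs_sum_le_sum_abs _ _).trans (Finset.sum_le_sum fun d _ => ?_)
  rw [abs_mul, Finset.abs_prod]
  refine mul_le_mul_of_nonneg_left ?_ (abs_nonneg _)
  refine Finset.prod_le_prod (fun i _ => abs_nonneg _) fun i _ => ?_
  rw [abs_pow]
  exact pow_le_pow_left₀ (abs_nonneg _) (h i) _

/-- The polynomial `p` with absolute coefficients, evaluated at `(r, r, m)`. The middle
argument stands for the observation dimension of the projected system, which is at most `r`. -/
noncomputable def dominatingPoly (p : MvPolynomial (Fin 3) ℝ) : MvPolynomial (Fin 2) ℝ :=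
  MvPolynomial.bind₁ ![.X 0, .X 0, .X 1] (absPoly p)

theorem polyVal₃_le_polyVal₂ (p : MvPolynomial (Fin 3) ℝ) {r n m r' m' : ℕ} (hr : r ≤ r')
    (hn : n ≤ r') (hm : m ≤ m') : |polyVal₃ p r n m| ≤ polyVal₂ (dominatingPoly p) r' m' := by
  have h : polyVal₂ (dominatingPoly p) r' m'
      = MvPolynomial.eval ![(r' : ℝ), (r' : ℝ), (m' : ℝ)] (absPoly p) := by
    rw [polyVal₂, dominatingPoly, ← MvPolynomial.coe_aeval_eq_eval]
    change MvPolynomial.aeval _ _ = _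
    rw [MvPolynomial.aeval_bind₁, ← MvPolynomial.coe_aeval_eq_eval]
    change MvPolynomial.aeval _ _ = MvPolynomial.aeval _ _
    congr 2
    ext i
    fin_cases i <;> simp
  rw [h]
  refine abs_eval_le_eval_absPoly p fun i => ?_
  fin_cases i <;> simp <;> assumption

end Polynomials

/-- The fit of the projected data succeeds with high probability, for a fixed frame. The event is
witnessed by a measurable set, as the set of data on which the fit succeeds need not be measurable
a priori. -/
theorem exists_measurableSet_projFit {p₁ p₂ : MvPolynomial (Fin 3) ℝ} (O : SysIdOracle p₁ p₂)
    {r n m T p r' m' : ℕ} {M : LTISystem r n m} {Su : Matrix (Fin m) (Fin m) ℝ} {δ ψ ρ ε : ℝ}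
    {Φ : Matrix (Fin n) (Fin p) ℝ}
    (hΦ : IsFrameNear (LinearMap.range (Matrix.toEuclideanLin M.C)) Φ ε) (hε0 : 0 ≤ ε)
    (hε : ε ≤ 1 / 2) (hr : 0 < r) (hrr : r ≤ r') (hmm : m ≤ m') (hM : IsMinimal M)
    (hA : IsStableMatrix M.A ψ ρ) (hSw : M.Sw.PosSemidef) (hSe : M.Se.PosSemidef) (hSu : Su.PosDef)
    (hT : 1 ≤ T) (hδ0 : 0 < δ) (hδ : δ < Real.exp (-1))
    (hκ : O.κ₁ (projSystem M Φ) Su T δ * polyVal₂ (dominatingPoly p₁) r' m' ≤ T) :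
    ∃ B : Set (Noise r n m T), MeasurableSet B ∧ ENNReal.ofReal (1 - δ) ≤ noiseLaw M Su T B ∧
      ∀ ω ∈ B, ∃ S : Matrix (Fin r) (Fin r) ℝ, IsUnit S ∧
        paramError M S (projFit O r δ Φ (ioData M ω)) ≤
          2 * (O.κ₂ (projSystem M Φ) Su T δ * √(polyVal₂ (dominatingPoly p₂ ^ 2) r' m' / T))
          + 2 * ε * ‖(projFit O r δ Φ (ioData M ω)).2.2‖ := by
  have hpr : p ≤ r := by
    rw [← hΦ.finrank_eq, range_toEuclideanLin_finrank]
    exact (Matrix.rank_le_card_width _).trans (by simp)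
  have hSe' : (projSystem M Φ).Se.PosSemidef := by
    have := hSe.conjTranspose_mul_mul_same Φ
    rwa [Matrix.conjTranspose_eq_transpose_of_trivial] at this
  have hT0 : (0 : ℝ) < T := by exact_mod_cast hT
  have h := O.guarantee (projSystem M Φ) Su T δ hr (hΦ.isMinimal_projSystem le_rfl hM) ⟨ψ, ρ, hA⟩
    hSw hSe' hSu hT hδ0 hδ (le_trans (mul_le_mul_of_nonneg_left
      ((le_abs_self _).trans (polyVal₃_le_polyVal₂ p₁ hrr (hpr.trans hrr) hmm))
      (O.κ₁_nonneg _ _ _ _)) hκ)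
  set c := polyVal₃ p₂ r p m / √T * O.κ₂ (projSystem M Φ) Su T δ with hc
  have hcle : c ≤ O.κ₂ (projSystem M Φ) Su T δ * √(polyVal₂ (dominatingPoly p₂ ^ 2) r' m' / T) := by
    have h1 := polyVal₃_le_polyVal₂ p₂ hrr (hpr.trans hrr) hmm
    have h2 : polyVal₂ (dominatingPoly p₂ ^ 2) r' m' = polyVal₂ (dominatingPoly p₂) r' m' ^ 2 := by
      simp [polyVal₂]
    rw [h2, Real.sqrt_div (sq_nonneg _), Real.sqrt_sq ((abs_nonneg _).trans h1), hc, mul_comm]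
    have := O.κ₂_nonneg (projSystem M Φ) Su T δ
    have h3 := (le_abs_self _).trans h1
    gcongr
  have hmeas : MeasurableSet {ω : Noise r p m T | ∃ S : Matrix (Fin r) (Fin r) ℝ, IsUnit S ∧
      paramError (projSystem M Φ) S (O.est r p m T δ (ioData (projSystem M Φ) ω)) ≤ c} :=
    ((O.measurable_est r p m T δ).comp (measurable_ioData (projSystem M Φ)))
      (measurableSet_exists_paramError_le (projSystem M Φ) c)
  have hmp := measurePreserving_projNoise (T := T) M hSe Su Φ
  rw [← hmp.measure_preimage hmeas.nullMeasurableSet] at h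
  refine ⟨_, hmp.measurable hmeas, h, ?_⟩
  rintro ω ⟨S, hS, hle⟩
  refine ⟨S, hS, ?_⟩
  rw [← projData_ioData] at hle
  refine (hΦ.paramError_le hε0 M le_rfl S _).trans ?_
  have h0 : 0 ≤ paramError (projSystem M Φ) S (O.est r p m T δ (projData Φ (ioData M ω))) :=
    (norm_nonneg _).trans (le_max_left _ _)
  have h1 : (1 + 2 * ε) * paramError (projSystem M Φ) S (O.est r p m T δ (projData Φ (ioData M ω)))
      ≤ 2 * (O.κ₂ (projSystem M Φ) Su T δ * √(polyVal₂ (dominatingPoly p₂ ^ 2) r' m' / T)) := by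
    gcongr
    · linarith
    · exact hle.trans hcle
  exact add_le_add h1 le_rfl

/-! ### The sample size -/

/-- The conditions on the sample size as polynomial inequalities in its fourth root `x`. -/
theorem sample_size_polynomial {x y u φ : ℝ} (hφ0 : 0 < φ) (hφ1 : φ ≤ 1) (hy : 1 ≤ y)
    (hx : 362 * y ≤ φ * x) (huy : u ≤ y ^ 2) :
    100 * u ≤ x ^ 4 ∧ 64 * (192 * u) ≤ φ * x ^ 4 / 64 ∧ 320 * (y * x ^ 2) ≤ φ * x ^ 4 / 64 ∧
    x ^ 3 < φ * x ^ 4 / 64 / 2 - 80 * (y * x ^ 2) ∧ 2 * (80 * (y * x ^ 2)) + 192 * u ≤ x ^ 3 ∧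
    22000 * y ≤ φ * x ^ 2 := by
  have hx0 : 0 < x := by
    by_contra h
    nlinarith
  have hxy : 362 * y ≤ x := hx.trans (mul_le_of_le_one_left hx0.le hφ1)
  have hx362 : 362 ≤ x := by linarith
  have hyx2 : 362 ^ 2 * y ^ 2 ≤ φ * x ^ 2 := by
    calc 362 ^ 2 * y ^ 2 = (362 * y) * (362 * y) := by ring
      _ ≤ (φ * x) * x := by gcongr
      _ = φ * x ^ 2 := by ring
  have hx2 : 362 ^ 2 ≤ x ^ 2 := by gcongr
  have hy2 : y ≤ y ^ 2 := by nlinarith only [hy]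
  have hφx3 : 362 * x ^ 3 ≤ φ * x ^ 4 := by
    calc 362 * x ^ 3 ≤ (362 * y) * x ^ 3 := by gcongr; linarith
      _ ≤ φ * x * x ^ 3 := by gcongr
      _ = _ := by ring
  have hyx3 : 362 * (y * x ^ 2) ≤ x ^ 3 := by
    calc 362 * (y * x ^ 2) = 362 * y * x ^ 2 := by ring
      _ ≤ x * x ^ 2 := by gcongr
      _ = _ := by ring
  have hx3pos : 0 < x ^ 3 := by positivity
  have h64 : 362 ^ 2 * y ^ 2 * 362 ^ 2 ≤ φ * x ^ 4 := by
    calc 362 ^ 2 * y ^ 2 * 362 ^ 2 ≤ φ * x ^ 2 * x ^ 2 := by gcongr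
      _ = _ := by ring
  have hφx4 : φ * x ^ 4 ≤ x ^ 4 := mul_le_of_le_one_left (by positivity) hφ1
  have hyx4 : 362 ^ 2 * (y * x ^ 2) ≤ φ * x ^ 4 := by
    calc 362 ^ 2 * (y * x ^ 2) ≤ 362 ^ 2 * (y ^ 2 * x ^ 2) := by gcongr
      _ = 362 ^ 2 * y ^ 2 * x ^ 2 := by ring
      _ ≤ φ * x ^ 2 * x ^ 2 := by gcongr
      _ = _ := by ring
  have hyy : 362 ^ 2 * y ^ 2 ≤ x ^ 2 := by
    calc 362 ^ 2 * y ^ 2 = (362 * y) ^ 2 := by ring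
      _ ≤ _ := by gcongr
  have h23 : x ^ 2 ≤ x ^ 3 := pow_le_pow_right₀ (by linarith) (by norm_num)
  refine ⟨?_, ?_, ?_, ?_, ?_, ?_⟩ <;> linarith

/-- The conditions under which regular samples determine the rank and the column space, as a
consequence of a lower bound on the total length `τ` of the trajectories. In terms of the fourth
root of `τ` all of them are polynomial. -/
theorem sample_size_conditions {n : ℕ} (hn : 1 ≤ n) {lam φ L τ : ℝ} (hlam : 1 ≤ lam) (hφ0 : 0 < φ)
    (hφ1 : φ ≤ 1) (hL : 1 ≤ L) (hτ : 2 ^ 34 * (lam ^ 4 * n ^ 2 * L ^ 2) / φ ^ 4 ≤ τ) :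
    25 * (n * L) ≤ τ ∧
    64 * (4 * √(12 * lam * n * L)) ^ 2 ≤ φ * τ / 64 ∧
    4 * (8 * (10 * lam * √(τ * n * L))) ≤ φ * τ / 64 ∧
    τ ^ (3 / 4 : ℝ) < φ * τ / 64 / 2 - 8 * (10 * lam * √(τ * n * L)) ∧
    2 * (8 * (10 * lam * √(τ * n * L))) + (4 * √(12 * lam * n * L)) ^ 2 ≤ τ ^ (3 / 4 : ℝ) ∧
    2 * (4 * √(12 * lam * n * L)) / √(φ * τ / 64 / 2)
      + 8 * (10 * lam * √(τ * n * L)) / (φ * τ / 64 / 2)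
      ≤ 11000 * (lam / φ * √L * √(n / τ)) ∧
    11000 * (lam / φ * √L * √(n / τ)) ≤ 1 / 2 := by
  have hn1 : (1 : ℝ) ≤ n := by exact_mod_cast hn
  have hlam0 : 0 < lam := by linarith
  have hL0 : 0 < L := by linarith
  have hτ0 : 0 < τ := lt_of_lt_of_le (by positivity) hτ
  set x := τ ^ (1 / 4 : ℝ) with hx
  have hx0 : 0 < x := Real.rpow_pos_of_pos hτ0 _
  have hx4 : τ = x ^ 4 := by
    rw [hx, ← Real.rpow_natCast, ← Real.rpow_mul hτ0.le]; norm_num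
  have hx3 : τ ^ (3 / 4 : ℝ) = x ^ 3 := by
    rw [hx, ← Real.rpow_natCast, ← Real.rpow_mul hτ0.le]; norm_num
  set a := √(n * L) with ha
  have ha2 : a ^ 2 = n * L := Real.sq_sqrt (by positivity)
  have hnL : 1 ≤ (n : ℝ) * L := one_le_mul_of_one_le_of_one_le hn1 hL
  have ha1 : 1 ≤ a := Real.one_le_sqrt.2 hnL
  have hsτ : √(τ * n * L) = x ^ 2 * a := by
    rw [mul_assoc, Real.sqrt_mul hτ0.le, ← ha, hx4, show x ^ 4 = (x ^ 2) ^ 2 by ring,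
      Real.sqrt_sq (by positivity)]
  have hs2 : (4 * √(12 * lam * n * L)) ^ 2 = 192 * (lam * a ^ 2) := by
    rw [mul_pow, Real.sq_sqrt (by positivity), ha2]; ring
  have hq : √L * √(n / τ) = a / x ^ 2 := by
    rw [← Real.sqrt_mul hL0.le, ← mul_div_assoc, Real.sqrt_div (by positivity), mul_comm L, ← ha,
      hx4, show x ^ 4 = (x ^ 2) ^ 2 by ring, Real.sqrt_sq (by positivity)]
  -- `362 ^ 4 ≤ 2 ^ 34`
  have hmain : 362 * (lam * a) ≤ φ * x := by
    refine le_of_pow_le_pow_left₀ (n := 4) (by norm_num) (by positivity) ?_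
    rw [div_le_iff₀ (by positivity), hx4] at hτ
    have e : (362 * (lam * a)) ^ 4 = 362 ^ 4 * (lam ^ 4 * n ^ 2 * L ^ 2) := by
      rw [mul_pow, mul_pow, show a ^ 4 = (a ^ 2) ^ 2 by ring, ha2]; ring
    have : 0 ≤ lam ^ 4 * (n : ℝ) ^ 2 * L ^ 2 := by positivity
    rw [e, mul_pow]
    nlinarith
  set y := lam * a with hy
  have hy1 : 1 ≤ y := one_le_mul_of_one_le_of_one_le hlam ha1
  have hla : lam * a ^ 2 ≤ y ^ 2 := by
    rw [hy, mul_pow]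
    gcongr
    nlinarith
  obtain ⟨h1, h2, h3, h4, h5, h6⟩ := sample_size_polynomial hφ0 hφ1 hy1 hmain hla
  have eν : 8 * (10 * lam * (x ^ 2 * a)) = 80 * (y * x ^ 2) := by rw [hy]; ring
  have ha2y : a ^ 2 ≤ lam * a ^ 2 := le_mul_of_one_le_left (by positivity) hlam
  rw [hsτ, hs2, hx3, mul_assoc (lam / φ), hq, hx4]
  refine ⟨?_, h2, ?_, ?_, ?_, ?_, ?_⟩
  · rw [← ha2]
    linarith
  · rw [eν]
    linarith
  · rw [eν]
    exact h4
  · rw [eν]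
    exact h5
  · have e1 : 2 * (4 * √(12 * lam * n * L)) / √(φ * x ^ 4 / 64 / 2)
        ≤ 320 * (lam / φ * (a / x ^ 2)) := by
      rw [div_le_iff₀ (Real.sqrt_pos.2 (by positivity))]
      refine le_of_sq_le_sq ?_ (by positivity)
      have hsq : √(φ * x ^ 4 / 64 / 2) ^ 2 = φ * x ^ 4 / 64 / 2 := Real.sq_sqrt (by positivity)
      rw [mul_pow 2, hs2, mul_pow _ (√_), hsq, mul_pow 320]
      have e : (320 : ℝ) ^ 2 * (lam / φ * (a / x ^ 2)) ^ 2 * (φ * x ^ 4 / 64 / 2)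
          = 800 * (lam / φ * (lam * a ^ 2)) := by
        field_simp
        ring
      have e' : 1 ≤ lam / φ := by rw [le_div_iff₀ hφ0]; linarith
      have e'' : 0 ≤ lam * a ^ 2 := by positivity
      rw [e]
      nlinarith
    have e2 : 8 * (10 * lam * (x ^ 2 * a)) / (φ * x ^ 4 / 64 / 2)
        = 10240 * (lam / φ * (a / x ^ 2)) := by
      field_simp
      ring
    have : 0 ≤ lam / φ * (a / x ^ 2) := by positivity
    linarith
  · have e : 11000 * (lam / φ * (a / x ^ 2)) = 11000 * y / (φ * x ^ 2) := by
      rw [hy]; field_simp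
    rw [e, div_le_iff₀ (by positivity)]
    linarith

/-- With `D = 1 - ρ ^ 2`, the signal covariance is of order `Ψ / D ^ 2`; its logarithm is
controlled by the one in `κ₃`, where `D` occurs to the first power only, because the
square of `Λ` dominates. -/
theorem log_gramian_le {Ψ D Λ : ℝ} (hΨ : 1 ≤ Ψ) (hD0 : 0 < D) (hD1 : D ≤ 1)
    (hΛ : Ψ / D * 1.69 ≤ Λ) :
    1 ≤ Ψ / D ^ 2 ∧ 1 / 2 ≤ Real.log Λ ∧ Real.log (16 * (Ψ / D ^ 2)) ≤ 16 * Real.log Λ ^ 2 := by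
  have hΨD : 1 ≤ Ψ / D := by rw [le_div_iff₀ hD0]; linarith
  have hΛ1 : Ψ / D ≤ Λ := by linarith
  have hΛ2 : 1.69 ≤ Λ := by linarith
  have hΛ0 : 0 < Λ := by linarith
  have hℓ1 : 1 / 2 ≤ Real.log Λ := by
    rw [Real.le_log_iff_exp_le hΛ0]
    refine le_trans (le_of_sq_le_sq ?_ (by norm_num)) hΛ2
    rw [← Real.exp_nat_mul]
    have := Real.exp_one_lt_d9
    norm_num
    linarith
  have hD2 : D ^ 2 ≤ 1 := pow_le_one₀ hD0.le hD1
  refine ⟨by rw [le_div_iff₀ (by positivity)]; linarith, hℓ1, ?_⟩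
  have hGΛ : Ψ / D ^ 2 ≤ Λ ^ 2 := by
    calc Ψ / D ^ 2 ≤ Ψ ^ 2 / D ^ 2 := by gcongr; exact le_self_pow₀ hΨ (by norm_num)
      _ = (Ψ / D) ^ 2 := by rw [div_pow]
      _ ≤ _ := by gcongr
  have h1 : Real.log (16 * (Ψ / D ^ 2)) ≤ Real.log (16 * Λ ^ 2) :=
    Real.log_le_log (by positivity) (by gcongr)
  have h2 : Real.log (16 * Λ ^ 2) = 4 * Real.log 2 + 2 * Real.log Λ := by
    rw [Real.log_mul (by norm_num) (by positivity), Real.log_pow,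
      show (16 : ℝ) = 2 ^ 4 by norm_num, Real.log_pow]
    norm_num
  have h3 := Real.log_two_lt_d9
  nlinarith

/-- The second term of `κ₃` dominates both requirements on the total length of the trajectories. -/
theorem le_of_kappa_le {K r n : ℕ} (hK : 2 ≤ K) (hr : 1 ≤ r) {lam φ lam' φu φC φR C W A ρ δ τ : ℝ}
    (hlam : 1 ≤ lam) (hlam' : lam ≤ lam') (hφu : 0 < φu) (hφC : 0 < φC) (hφR : 0 < φR)
    (hφ' : φu * φC ^ 2 * φR ^ 2 ≤ φ) (hφ1 : φ ≤ 1) (hC : 1 ≤ C) (hW : 1 ≤ W) (hA : 1 ≤ A)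
    (hρ0 : 0 < ρ) (hρ1 : ρ < 1) (hδ0 : 0 < δ) (hδ : δ < Real.exp (-1))
    (hτ : 2 ^ 36 * ((lam' ^ 2 * C ^ 2 * W * A ^ 2 / ((1 - ρ ^ 2) * φu ^ 2 * φC ^ 4 * φR ^ 4)) ^ 2 *
      Real.log (C ^ 2 * W * A ^ 4 / (1 - ρ ^ 2) * r * Real.log (K * r / δ)) ^ 2 *
      Real.log (K * r / δ) ^ 4 * (n : ℝ) ^ 2 * (r : ℝ) ^ 3) ≤ τ) :
    ∃ G ℓ : ℝ, 1 ≤ G ∧ 1 / 2 ≤ ℓ ∧ Real.log (16 * G) ≤ 16 * ℓ ^ 2 ∧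
      W * C ^ 2 * (2 * A / (1 - ρ)) ^ 2 ≤ 16 * G ∧
      2 ^ 34 * (lam ^ 4 * n ^ 2 * Real.log (1 / δ) ^ 2) / φ ^ 4 ≤ τ ∧
      2 ^ 18 * (G * r * ℓ ^ 2 * n * Real.log (1 / δ)) / φ ^ 2 ≤ τ := by
  have hK1 : (2 : ℝ) ≤ K := by exact_mod_cast hK
  have hr1 : (1 : ℝ) ≤ r := by exact_mod_cast hr
  have hρ : 0 < 1 - ρ ^ 2 := by nlinarith only [hρ0, hρ1]
  have hρ' : 1 - ρ ^ 2 ≤ 1 := by nlinarith only [hρ0]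
  set L := Real.log (1 / δ) with hL
  have hδL : δ = Real.exp (-L) := by rw [hL, one_div, Real.log_inv, neg_neg, Real.exp_log hδ0]
  have hL1 : 1 ≤ L := by
    rw [hδL, Real.exp_lt_exp] at hδ
    linarith
  set J := Real.log (K * r / δ) with hJ
  have hJL : Real.log 2 + L ≤ J := by
    rw [hJ, hL, ← Real.log_mul (by norm_num) (by positivity)]
    refine Real.log_le_log (by positivity) ?_
    rw [mul_one_div]
    gcongr
    nlinarith only [hK1, hr1]
  have hlog2 := Real.log_two_gt_d9
  have hJ1 : 1.69 ≤ J := by linarith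
  set Λ := C ^ 2 * W * A ^ 4 / (1 - ρ ^ 2) * r * J with hΛ
  set Ψ := C ^ 2 * W * A ^ 2 with hΨ
  have hC2 : 1 ≤ C ^ 2 := one_le_pow₀ hC
  have hA2 : 1 ≤ A ^ 2 := one_le_pow₀ hA
  have hΨ1 : 1 ≤ Ψ := one_le_mul_of_one_le_of_one_le (one_le_mul_of_one_le_of_one_le hC2 hW) hA2
  have hΛΨ : Ψ / (1 - ρ ^ 2) * J ≤ Λ := by
    have e : Λ = Ψ / (1 - ρ ^ 2) * J * (A ^ 2 * r) := by rw [hΛ, hΨ]; ring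
    rw [e]
    refine le_mul_of_one_le_right (by positivity) (one_le_mul_of_one_le_of_one_le hA2 hr1)
  set ℓ := Real.log Λ with hℓ
  set G := Ψ / (1 - ρ ^ 2) ^ 2 with hG
  obtain ⟨hG1, hℓ1, hlogG⟩ := log_gramian_le hΨ1 hρ hρ' (Λ := Λ)
    (le_trans (mul_le_mul_of_nonneg_left hJ1 (by positivity)) hΛΨ)
  have hℓ2 : 1 / 4 ≤ ℓ ^ 2 := by nlinarith only [hℓ1]
  have hGA : W * C ^ 2 * (2 * A / (1 - ρ)) ^ 2 ≤ 16 * G := by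
    have e : W * C ^ 2 * (2 * A / (1 - ρ)) ^ 2 = G * (4 * (1 + ρ) ^ 2) := by
      have : 1 - ρ ≠ 0 := by linarith
      have h' : 1 + ρ ≠ 0 := by linarith
      rw [hG, hΨ, show 1 - ρ ^ 2 = (1 - ρ) * (1 + ρ) by ring]
      field_simp
      ring
    rw [e, mul_comm 16]
    refine mul_le_mul_of_nonneg_left ?_ (by linarith only [hG1])
    nlinarith only [hρ0, hρ1]
  refine ⟨G, ℓ, hG1, hℓ1, hlogG, hGA, ?_, ?_⟩ <;> refine le_trans ?_ hτ
  all_goals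
    set φ' := φu * φC ^ 2 * φR ^ 2 with hφ'def
    have hφ'0 : 0 < φ' := by positivity
    have hφ0 : 0 < φ := hφ'0.trans_le hφ'
    have hQ : (lam' ^ 2 * C ^ 2 * W * A ^ 2 / ((1 - ρ ^ 2) * φu ^ 2 * φC ^ 4 * φR ^ 4)) ^ 2
        = lam' ^ 4 * G * Ψ / φ' ^ 4 := by
      rw [hφ'def, hG, hΨ]
      field_simp
    have hQ' : lam ^ 4 * G / φ ^ 4 ≤ lam' ^ 4 * G * Ψ / φ' ^ 4 := by
      calc lam ^ 4 * G / φ ^ 4 ≤ lam' ^ 4 * G / φ' ^ 4 := by gcongr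
        _ ≤ lam' ^ 4 * G * Ψ / φ' ^ 4 := div_le_div_of_nonneg_right
          (le_mul_of_one_le_right (by positivity) hΨ1) (by positivity)
    have hJL' : L ≤ J := by linarith
    have hJ4 : L ^ 2 ≤ J ^ 4 := by
      calc L ^ 2 ≤ J ^ 2 := by gcongr
        _ ≤ J ^ 4 := pow_le_pow_right₀ (by linarith) (by norm_num)
    rw [hQ]
  · calc 2 ^ 34 * (lam ^ 4 * n ^ 2 * L ^ 2) / φ ^ 4
        = 2 ^ 36 * ((lam ^ 4 * 1 / φ ^ 4) * (1 / 4) * L ^ 2 * n ^ 2 * 1) := by ring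
      _ ≤ 2 ^ 36 * ((lam ^ 4 * G / φ ^ 4) * ℓ ^ 2 * J ^ 4 * n ^ 2 * (r : ℝ) ^ 3) := by
          gcongr
          exact one_le_pow₀ hr1
      _ ≤ _ := by gcongr
  · have hn : (n : ℝ) ≤ n ^ 2 := by
      rcases Nat.eq_zero_or_pos n with h | h
      · simp [h]
      · have : (1 : ℝ) ≤ n := by exact_mod_cast h
        exact le_self_pow₀ this (by norm_num)
    have hLJ : L ≤ J ^ 4 := (le_self_pow₀ hL1 (by norm_num)).trans hJ4
    have hrr : (r : ℝ) ≤ r ^ 3 := le_self_pow₀ hr1 (by norm_num)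
    have hlam4 : 1 ≤ lam ^ 4 := one_le_pow₀ hlam
    have hφ4 : φ ^ 4 ≤ φ ^ 2 := pow_le_pow_of_le_one hφ0.le hφ1 (by norm_num)
    calc 2 ^ 18 * (G * r * ℓ ^ 2 * n * L) / φ ^ 2
        = 2 ^ 18 * ((1 * G / φ ^ 2) * ℓ ^ 2 * L * n * r) := by ring
      _ ≤ 2 ^ 36 * ((lam ^ 4 * G / φ ^ 4) * ℓ ^ 2 * J ^ 4 * n ^ 2 * (r : ℝ) ^ 3) := by
          gcongr <;> norm_num
      _ ≤ _ := by gcongr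

/-! ### The constants of a family of systems -/

theorem fold_max_mono {ι : Type*} {s t : Finset ι} (h : s ⊆ t) (f : ι → ℝ) (b : ℝ) :
    s.fold max b f ≤ t.fold max b f :=
  Finset.fold_max_le _ |>.2 ⟨Finset.le_fold_max _ |>.2 (.inl le_rfl),
    fun x hx => Finset.le_fold_max _ |>.2 (.inr ⟨x, h hx, le_rfl⟩)⟩

theorem fold_min_anti {ι : Type*} {s t : Finset ι} (h : s ⊆ t) (f : ι → ℝ) (b : ℝ) :
    t.fold min b f ≤ s.fold min b f :=
  Finset.le_fold_min _ |>.2 ⟨Finset.fold_min_le _ |>.2 (.inl le_rfl),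
    fun x hx => Finset.fold_min_le _ |>.2 (.inr ⟨x, h hx, le_rfl⟩)⟩

theorem le_fold_max_of_mem {ι : Type*} {s : Finset ι} (f : ι → ℝ) (b : ℝ) {x : ι} (hx : x ∈ s) :
    f x ≤ s.fold max b f :=
  Finset.le_fold_max _ |>.2 (.inr ⟨x, hx, le_rfl⟩)

theorem fold_min_le_of_mem {ι : Type*} {s : Finset ι} (f : ι → ℝ) (b : ℝ) {x : ι} (hx : x ∈ s) :
    s.fold min b f ≤ f x :=
  Finset.fold_min_le _ |>.2 (.inr ⟨x, hx, le_rfl⟩)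

theorem le_fold_max_self {ι : Type*} (s : Finset ι) (f : ι → ℝ) (b : ℝ) : b ≤ s.fold max b f :=
  Finset.le_fold_max _ |>.2 (.inl le_rfl)

theorem fold_min_le_self {ι : Type*} (s : Finset ι) (f : ι → ℝ) (b : ℝ) : s.fold min b f ≤ b :=
  Finset.fold_min_le _ |>.2 (.inl le_rfl)

theorem fold_min_one_pos {ι : Type*} (s : Finset ι) {f : ι → ℝ} (h : ∀ x, 0 < f x) :
    0 < s.fold min 1 f :=
  Finset.lt_fold_min _ |>.2 ⟨one_pos, fun x _ => h x⟩

namespace MetaProblem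

variable {K n : ℕ} {P : MetaProblem K n}

theorem r_le_rmax (k : Fin K) : P.r k ≤ P.rmax := Finset.le_sup (f := P.r) (Finset.mem_univ k)

theorem m_le_mmax (k : Fin K) : P.m k ≤ P.mmax := Finset.le_sup (f := P.m) (Finset.mem_univ k)

namespace Valid

theorem sigmaMin_ctrbMatrix_pos (h : P.Valid) (k : Fin K) :
    0 < sigmaMin (ctrbMatrix (P.A k) (P.B k) P.rmax) := by
  refine sigmaMin_pos _ ?_
  exact (h.r_pos k).trans_eq (rank_ctrbMatrix_eq (h.minimal k).1 (r_le_rmax k)).symm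

theorem m_pos (h : P.Valid) (k : Fin K) : 0 < P.m k := by
  have h1 : (ctrbMatrix (P.A k) (P.B k) (P.r k)).rank = P.r k := (h.minimal k).1
  have h2 := Matrix.rank_le_card_width (ctrbMatrix (P.A k) (P.B k) (P.r k))
  have h3 := h.r_pos k
  rw [h1, Fintype.card_prod, Fintype.card_fin, Fintype.card_fin] at h2
  exact Nat.pos_of_mul_pos_left (lt_of_lt_of_le h3 h2)

theorem sigmaMin_Su_pos (h : P.Valid) (k : Fin K) : 0 < sigmaMin (P.Su k) := by
  refine sigmaMin_pos _ ?_
  rw [Matrix.rank_of_isUnit _ (h.Su_pd k).isUnit, Fintype.card_fin]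
  exact h.m_pos k

theorem rank_C_pos (h : P.Valid) (k : Fin K) : 0 < (P.C k).rank := by
  rw [← range_toEuclideanLin_finrank]
  by_contra h0
  have h1 : LinearMap.range (Matrix.toEuclideanLin (P.C k)) = ⊥ :=
    Submodule.finrank_eq_zero.1 (by omega)
  have h2 : ∀ x, Matrix.toEuclideanLin (P.C k) x = 0 := fun x =>
    (Submodule.mem_bot ℝ).1 (h1 ▸ LinearMap.mem_range_self _ x)
  have h3 : ∀ x : EuclideanSpace ℝ (Fin (P.r k)), x = 0 := fun x =>
    (rank_eq_iff_forall_toEuclideanLin _).1 (h.minimal k).2 x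
      (toEuclideanLin_obsvMatrix_eq_zero_iff.2 fun i => h2 _)
  have h4 := congrArg (fun v => v ⟨0, h.r_pos k⟩)
    (h3 (EuclideanSpace.single (⟨0, h.r_pos k⟩ : Fin (P.r k)) (1 : ℝ)))
  simp at h4

theorem sigmaMin_C_pos (h : P.Valid) (k : Fin K) : 0 < sigmaMin (P.C k) :=
  sigmaMin_pos _ (h.rank_C_pos k)

theorem range_toEuclideanLin_eq (h : P.Valid) (k l : Fin K) :
    LinearMap.range (Matrix.toEuclideanLin (P.C k))
      = LinearMap.range (Matrix.toEuclideanLin (P.C l)) := by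
  have key : ∀ k l, LinearMap.range (Matrix.toEuclideanLin (P.C k))
      ≤ LinearMap.range (Matrix.toEuclideanLin (P.C l)) := by
    rintro k l _ ⟨x, rfl⟩
    have h1 : (P.C k).mulVecLin x.ofLp ∈ LinearMap.range (P.C l).mulVecLin := by
      rw [← h.col_eq k l]
      exact LinearMap.mem_range_self _ _
    obtain ⟨y, hy⟩ := h1
    refine ⟨WithLp.toLp 2 y, ?_⟩
    ext i
    exact congrFun hy i
  exact le_antisymm (key k l) (key l k)

end Valid

theorem kappa_second_pos {K r : ℕ} (hK : 1 ≤ K) (hr : 1 ≤ r) {lam φu φC φR C W A ρ δ : ℝ}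
    (hlam : 1 ≤ lam) (hφu : 0 < φu) (hφC : 0 < φC) (hφR : 0 < φR) (hC : 1 ≤ C) (hW : 1 ≤ W)
    (hA : 1 ≤ A) (hρ0 : 0 < ρ) (hρ1 : ρ < 1) (hδ0 : 0 < δ) (hδ : δ < Real.exp (-1)) :
    0 < (lam ^ 2 * C ^ 2 * W * A ^ 2 / ((1 - ρ ^ 2) * φu ^ 2 * φC ^ 4 * φR ^ 4)) ^ 2 *
      Real.log (C ^ 2 * W * A ^ 4 / (1 - ρ ^ 2) * r * Real.log (K * r / δ)) ^ 2 *
      Real.log (K * r / δ) ^ 4 := by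
  have hK1 : (1 : ℝ) ≤ K := by exact_mod_cast hK
  have hr1 : (1 : ℝ) ≤ r := by exact_mod_cast hr
  have hρ : 0 < 1 - ρ ^ 2 := by nlinarith only [hρ0, hρ1]
  have hρ' : 1 - ρ ^ 2 < 1 := by nlinarith only [hρ0]
  have hJ : 1 ≤ Real.log (K * r / δ) := by
    rw [Real.le_log_iff_exp_le (by positivity), le_div_iff₀ hδ0]
    calc Real.exp 1 * δ ≤ Real.exp 1 * Real.exp (-1) := by gcongr
      _ = 1 := by rw [← Real.exp_add]; simp
      _ ≤ K * r := one_le_mul_of_one_le_of_one_le hK1 hr1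
  have hΛ : 1 < C ^ 2 * W * A ^ 4 / (1 - ρ ^ 2) * r * Real.log (K * r / δ) := by
    have h1 : 1 < C ^ 2 * W * A ^ 4 / (1 - ρ ^ 2) := by
      rw [lt_div_iff₀ hρ, one_mul]
      exact hρ'.trans_le (one_le_mul_of_one_le_of_one_le
        (one_le_mul_of_one_le_of_one_le (one_le_pow₀ hC) hW) (one_le_pow₀ hA))
    rw [mul_assoc]
    exact h1.trans_le (le_mul_of_one_le_right (by linarith) (one_le_mul_of_one_le_of_one_le hr1 hJ))
  have := Real.log_pos hΛ
  positivity

/-- The lower bound for the excitation of the observer space by a single time step, over the set `s`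
of systems. -/
noncomputable def excitation (P : MetaProblem K n) (s : Finset (Fin K)) : ℝ :=
  P.φu s * P.φC s ^ 2 * P.φR s ^ 2

namespace Valid

theorem φu_pos (h : P.Valid) (s : Finset (Fin K)) : 0 < P.φu s :=
  fold_min_one_pos s h.sigmaMin_Su_pos

theorem φC_pos (h : P.Valid) (s : Finset (Fin K)) : 0 < P.φC s :=
  fold_min_one_pos s h.sigmaMin_C_pos

theorem φR_pos (h : P.Valid) (s : Finset (Fin K)) : 0 < P.φR s :=
  fold_min_one_pos s h.sigmaMin_ctrbMatrix_pos

theorem excitation_pos (h : P.Valid) (s : Finset (Fin K)) : 0 < P.excitation s :=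
  mul_pos (mul_pos (h.φu_pos s) (pow_pos (h.φC_pos s) 2)) (pow_pos (h.φR_pos s) 2)

theorem excitation_le_one (h : P.Valid) (s : Finset (Fin K)) : P.excitation s ≤ 1 :=
  mul_le_one₀ (mul_le_one₀ (fold_min_le_self _ _ _) (sq_nonneg _)
    (pow_le_one₀ (h.φC_pos s).le (fold_min_le_self _ _ _))) (sq_nonneg _)
    (pow_le_one₀ (h.φR_pos s).le (fold_min_le_self _ _ _))

theorem excitation_anti (h : P.Valid) {s t : Finset (Fin K)} (hst : s ⊆ t) :
    P.excitation t ≤ P.excitation s := by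
  have h1 : P.φu t ≤ P.φu s := fold_min_anti hst _ _
  have h2 : P.φC t ≤ P.φC s := fold_min_anti hst _ _
  have h3 : P.φR t ≤ P.φR s := fold_min_anti hst _ _
  have h4 := (h.φC_pos t).le
  have h5 := (h.φR_pos t).le
  have h6 := (h.φu_pos s).le
  unfold excitation
  gcongr

theorem excitation_le (h : P.Valid) {s : Finset (Fin K)} {k : Fin K} (hk : k ∈ s) :
    P.excitation s ≤ sigmaMin (P.Su k) * sigmaMin (ctrbMatrix (P.A k) (P.B k) P.rmax) ^ 2
      * sigmaMin (P.C k) ^ 2 := by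
  have h1 : P.φu s ≤ sigmaMin (P.Su k) := fold_min_le_of_mem _ _ hk
  have h2 : P.φC s ≤ sigmaMin (P.C k) := fold_min_le_of_mem _ _ hk
  have h3 : P.φR s ≤ sigmaMin (ctrbMatrix (P.A k) (P.B k) P.rmax) :=
    fold_min_le_of_mem (fun k => sigmaMin (ctrbMatrix (P.A k) (P.B k) P.rmax)) _ hk
  have h4 := (h.φC_pos s).le
  have h5 := (h.φR_pos s).le
  have h6 : 0 ≤ sigmaMin (P.Su k) := sigmaMin_nonneg _
  calc P.excitation s = P.φu s * P.φR s ^ 2 * P.φC s ^ 2 := by unfold excitation; ring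
    _ ≤ _ := by gcongr

theorem rmax_pos (h : P.Valid) (k₀ : Fin K) : 1 ≤ P.rmax := (h.r_pos k₀).trans_le (r_le_rmax k₀)

theorem two_le_n (h : P.Valid) (k₀ : Fin K) : 2 ≤ n := by
  have := h.r_pos k₀
  have := h.r_lt k₀
  omega

end Valid

/-- The second term of `κ₃`. -/
noncomputable def kappaSecond (P : MetaProblem K n) (ψA ρA δ : ℝ) : ℝ :=
  (P.ψη Finset.univ ^ 2 * P.ψC Finset.univ ^ 2 * P.ψw Finset.univ * ψA ^ 2 /
      ((1 - ρA ^ 2) * P.φu Finset.univ ^ 2 * P.φC Finset.univ ^ 4 * P.φR Finset.univ ^ 4)) ^ 2 *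
    Real.log (P.ψC Finset.univ ^ 2 * P.ψw Finset.univ * ψA ^ 4 / (1 - ρA ^ 2) * P.rmax *
      Real.log (K * P.rmax / δ)) ^ 2 *
    Real.log (K * P.rmax / δ) ^ 4

theorem kappaSecond_le_of_κ₃_le {ψA ρA δ τ : ℝ} {k₀ : Fin K}
    (hκ : 2 ^ 36 * (P.κ₃ k₀ ψA ρA δ * (n : ℝ) ^ 2 * (P.rmax : ℝ) ^ 3) ≤ τ) :
    2 ^ 36 * (P.kappaSecond ψA ρA δ * (n : ℝ) ^ 2 * (P.rmax : ℝ) ^ 3) ≤ τ := by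
  have h : P.kappaSecond ψA ρA δ ≤ P.κ₃ k₀ ψA ρA δ := le_max_right _ _
  refine le_trans ?_ hκ
  gcongr

/-- The requirement on the total length fails for a single system, where that length is `0`. -/
theorem two_le_of_kappaSecond_le (hP : P.Valid) {ψA ρA δ : ℝ} {k₀ : Fin K} (hψA : 1 ≤ ψA)
    (hρ0 : 0 < ρA) (hρ1 : ρA < 1) (hδ0 : 0 < δ) (hδ : δ < Real.exp (-1))
    (hκ : 2 ^ 36 * (P.kappaSecond ψA ρA δ * (n : ℝ) ^ 2 * (P.rmax : ℝ) ^ 3) ≤ P.Trest k₀) :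
    2 ≤ K := by
  by_contra hK
  have hK1 : K = 1 := by have := k₀.pos; omega
  subst hK1
  have h0 : P.Trest k₀ = 0 := by
    rw [Trest]
    refine Finset.sum_eq_zero fun k _ => absurd (Subsingleton.elim _ _) k.2
  have h1 : 0 < P.kappaSecond ψA ρA δ := kappa_second_pos le_rfl (hP.rmax_pos k₀)
    (le_fold_max_self _ _ _) (hP.φu_pos _) (hP.φC_pos _) (hP.φR_pos _) (le_fold_max_self _ _ _)
    (le_fold_max_self _ _ _) hψA hρ0 hρ1 hδ0 hδ
  have hn0 : 0 < (n : ℝ) := by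
    have := hP.two_le_n k₀
    exact_mod_cast (by omega : 0 < n)
  have hr0 : 0 < (P.rmax : ℝ) := by exact_mod_cast hP.rmax_pos k₀
  have h3 : (0 : ℝ) < 2 ^ 36 := by norm_num
  have h4 := mul_pos h3 (mul_pos (mul_pos h1 (pow_pos hn0 2)) (pow_pos hr0 3))
  rw [h0, Nat.cast_zero] at hκ
  exact absurd h4 (not_lt.2 hκ)

theorem sum_Trest_add (hK : 1 ≤ K) (k₀ : Fin K) (x : ℝ) :
    ∑ k : {k // k ≠ k₀}, ((P.T k : ℝ) + x) = P.Trest k₀ + (K - 1) * x := by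
  have hcard : Fintype.card {k // k ≠ k₀} = K - 1 := by simp
  rw [Finset.sum_add_distrib, Finset.sum_const, Finset.card_univ, hcard, nsmul_eq_mul,
    Nat.cast_sub hK, Nat.cast_one, Trest, Nat.cast_sum]

theorem half_Trest_le (hK : 2 ≤ K) {k₀ : Fin K} (hT : 2 * (K - 1) * P.rmax ≤ P.Trest k₀) :
    (P.Trest k₀ : ℝ) / 2 ≤ ∑ k : {k // k ≠ k₀}, ((P.T k : ℝ) + 1 - P.rmax) := by
  have h := sum_Trest_add (P := P) (by omega : 1 ≤ K) k₀ (1 - P.rmax)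
  have hTR : ((2 * (K - 1) * P.rmax : ℕ) : ℝ) ≤ (P.Trest k₀ : ℕ) := by exact_mod_cast hT
  push_cast [Nat.cast_sub (by omega : 1 ≤ K)] at hTR
  have hK2 : (2 : ℝ) ≤ K := by exact_mod_cast hK
  simp only [add_sub_assoc]
  rw [h]
  linarith

theorem sum_le_two_mul_Trest (hK : 2 ≤ K) (hr : 1 ≤ P.rmax) {k₀ : Fin K}
    (hT : 2 * (K - 1) * P.rmax ≤ P.Trest k₀) :
    ∑ k : {k // k ≠ k₀}, ((P.T k : ℝ) + 1) ≤ 2 * P.Trest k₀ := by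
  have hTR : ((2 * (K - 1) * P.rmax : ℕ) : ℝ) ≤ (P.Trest k₀ : ℕ) := by exact_mod_cast hT
  push_cast [Nat.cast_sub (by omega : 1 ≤ K)] at hTR
  have hK2 : (2 : ℝ) ≤ K := by exact_mod_cast hK
  have hr1 : (1 : ℝ) ≤ P.rmax := by exact_mod_cast hr
  rw [sum_Trest_add (by omega)]
  nlinarith only [hTR, hK2, hr1]

/-- The column space approximation of the other systems finds a frame of the common observer space,
up to an angle proportional to `κ₄ √(n / T)`. -/
theorem measure_not_isFrameNear_le (hP : P.Valid) {ψA ρA δ : ℝ} {k₀ : Fin K}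
    {colApprox : (∀ k : {k // k ≠ k₀}, Fin (P.T k + 1) → EuclideanSpace ℝ (Fin n)) →
        (p : ℕ) × Matrix (Fin n) (Fin p) ℝ}
    (hA : ∀ k, IsStableMatrix (P.A k) ψA ρA) (hcol : IsColApprox colApprox)
    (hδ0 : 0 < δ) (hδ : δ < Real.exp (-1)) (hT : 2 * (K - 1) * P.rmax ≤ P.Trest k₀)
    (hκ : 2 ^ 36 * (P.κ₃ k₀ ψA ρA δ * (n : ℝ) ^ 2 * (P.rmax : ℝ) ^ 3) ≤ P.Trest k₀) :
    (Measure.pi fun k : {k // k ≠ k₀} => noiseLaw (P.sys k) (P.Su k) (P.T k)).real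
      {ω | ¬ IsFrameNear (LinearMap.range (Matrix.toEuclideanLin (P.C k₀)))
        (colApprox fun k => output (P.sys k) (ω k)).2
        (11000 * (P.κ₄ k₀ δ * √((n : ℝ) / P.Trest k₀)))} ≤ δ / 2 ∧
    11000 * (P.κ₄ k₀ δ * √((n : ℝ) / P.Trest k₀)) ≤ 1 / 2 := by
  obtain ⟨hψA, hρ0, hρ1, -⟩ := id (hA k₀)
  have hr1 := hP.rmax_pos k₀
  have hn2 := hP.two_le_n k₀
  have hκ' := kappaSecond_le_of_κ₃_le hκ
  have hK := two_le_of_kappaSecond_le hP hψA hρ0 hρ1 hδ0 hδ hκ'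
  set s : Finset (Fin K) := {k₀}ᶜ with hs
  have hφ0 := hP.excitation_pos s
  have hφ1 := hP.excitation_le_one s
  have hlam : 1 ≤ P.ψη s := le_fold_max_self _ _ _
  obtain ⟨G, ℓ, hG1, hℓ, hGℓ, hG', hτ1, hτ2⟩ := le_of_kappa_le hK hr1 hlam
    (fold_max_mono (Finset.subset_univ s) _ _ : P.ψη s ≤ P.ψη Finset.univ)
    (hP.φu_pos Finset.univ) (hP.φC_pos Finset.univ) (hP.φR_pos Finset.univ)
    (hP.excitation_anti (Finset.subset_univ s)) hφ1
    (le_fold_max_self Finset.univ _ 1 : 1 ≤ P.ψC Finset.univ)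
    (le_fold_max_self Finset.univ _ 1 : 1 ≤ P.ψw Finset.univ) hψA hρ0 hρ1 hδ0 hδ hκ'
  set L := Real.log (1 / δ) with hL
  have hδL : δ = Real.exp (-L) := by rw [hL, one_div, Real.log_inv, neg_neg, Real.exp_log hδ0]
  have hL1 : 1 ≤ L := by
    rw [hδL, Real.exp_lt_exp] at hδ
    linarith
  obtain ⟨c1, c2, c3, c4, c5, c6, c7⟩ :=
    sample_size_conditions (by omega : 1 ≤ n) hlam hφ0 hφ1 hL1 hτ1
  have hκ₄ : P.κ₄ k₀ δ * √((n : ℝ) / P.Trest k₀)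
      = P.ψη s / P.excitation s * √L * √((n : ℝ) / P.Trest k₀) := rfl
  rw [hκ₄]
  refine ⟨?_, c7⟩
  set V := LinearMap.range (Matrix.toEuclideanLin (P.C k₀)) with hV
  have hVd : Module.finrank ℝ V = (P.C k₀).rank := range_toEuclideanLin_finrank _
  have hVr : Module.finrank ℝ V ≤ P.r k₀ := by
    rw [hVd]
    exact (Matrix.rank_le_card_width _).trans (by simp)
  have hms : ∀ k : {k // k ≠ k₀}, (k : Fin K) ∈ s := fun k => by simp [hs, k.2]
  have hmain := measure_not_sampleRegularity_pooled_le_exp (κ := {k // k ≠ k₀})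
    (T := fun k => P.T k) (M := fun k => P.sys k) (Su := fun k => P.Su k) (σ := fun k => P.σ k)
    (fun k => rfl) (fun k => hP.Su_pd k) (fun k => hP.Sw_psd k) (fun k => (hP.minimal k).1)
    hr1 (fun k => r_le_rmax k.1) (V := V) (hVr.trans (r_le_rmax k₀)) hn2
    (fun k => hP.range_toEuclideanLin_eq k k₀) hφ0 hφ1 (fun k => hP.excitation_le (hms k))
    (fun k => hA k) (w := P.ψw Finset.univ) (c := P.ψC Finset.univ)
    (fun k => le_fold_max_of_mem (fun k => ‖P.Sw k + P.B k * P.Su k * (P.B k)ᵀ‖) _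
      (Finset.mem_univ k.1))
    (fun k => le_fold_max_of_mem (fun k => ‖P.C k‖) _ (Finset.mem_univ k.1))
    hG1 hG' hL1 hℓ hGℓ (zero_lt_one.trans_le hlam)
    (fun k => le_fold_max_of_mem (fun k => P.σ k ^ 2) _ (hms k))
    (τ := P.Trest k₀) (half_Trest_le hK hT) (sum_le_two_mul_Trest hK hr1 hT) c1 hτ2
  rw [hδL]
  refine le_trans (measureReal_mono ?_) hmain
  intro ω hω hreg
  have hτpos : 0 < (P.Trest k₀ : ℝ) := by
    have hn0 : (0 : ℝ) < n := by exact_mod_cast (by omega : 0 < n)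
    exact (mul_pos (by norm_num) (mul_pos hn0 (zero_lt_one.trans_le hL1))).trans_le c1
  have hμ0 : 0 < P.excitation s * P.Trest k₀ / 64 := div_pos (mul_pos hφ0 hτpos) (by norm_num)
  have hν0 : 0 ≤ 8 * (10 * P.ψη s * √(P.Trest k₀ * n * L)) := by
    have := zero_le_one.trans hlam
    positivity
  exact hω (hcol.isFrameNear (Y := fun k => output (P.sys k) (ω k)) (V := V)
    (z := fun i => Matrix.toEuclideanLin (P.C i.1) (state (P.sys i.1) (ω i.1) i.2))
    (η := fun i => (ω i.1).2.2 i.2) (fun i => rfl) hreg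
    (hVd ▸ hP.rank_C_pos k₀) (hVr.trans_lt (hP.r_lt k₀)) hμ0 (by positivity) c2 c3 hν0 c4 c5 c6 c7)

end MetaProblem

/-! ### The law of all the systems -/

/-- A lower bound on the probability of an event under the joint law of all the systems: with high
probability over the other systems, the event contains an event of high probability for the
distinguished system. -/
theorem MetaProblem.le_law_of_sections {K n : ℕ} (P : MetaProblem K n) (k₀ : Fin K)
    {S : Set (∀ k, Noise (P.r k) n (P.m k) (P.T k))}
    {A : Set (∀ k : {k // k ≠ k₀}, Noise (P.r k) n (P.m k) (P.T k))} {α b : ENNReal}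
    (hA : (Measure.pi fun k : {k // k ≠ k₀} => noiseLaw (P.sys k) (P.Su k) (P.T k)) Aᶜ ≤ α)
    (hS : ∀ x ∈ A, ∃ B : Set (Noise (P.r k₀) n (P.m k₀) (P.T k₀)), MeasurableSet B ∧
      b ≤ noiseLaw (P.sys k₀) (P.Su k₀) (P.T k₀) B ∧
      ∀ ω : (∀ k, Noise (P.r k) n (P.m k) (P.T k)), (fun k : {k // k ≠ k₀} => ω k) = x →
        ω k₀ ∈ B → ω ∈ S) :
    (1 - α) * b ≤ P.law S := by
  classical
  set e := MeasurableEquiv.piEquivPiSubtypeProd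
    (fun k => Noise (P.r k) n (P.m k) (P.T k)) (fun k => k ≠ k₀) with he
  have hmp := measurePreserving_piEquivPiSubtypeProd
    (fun k => noiseLaw (P.sys k) (P.Su k) (P.T k)) (fun k => k ≠ k₀)
  have h1 : P.law S = ((Measure.pi fun k : {k // k ≠ k₀} =>
      noiseLaw (P.sys k) (P.Su k) (P.T k)).prod (Measure.pi fun k : {k // ¬ k ≠ k₀} =>
      noiseLaw (P.sys k) (P.Su k) (P.T k))) (e.symm ⁻¹' S) := by
    rw [← hmp.measure_preimage_equiv, ← Set.preimage_comp]
    change P.law S = P.law _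
    congr 1
    ext ω
    simp [he]
  rw [h1]
  refine prod_measure_ge_of_sections _ _ A _ α b hA fun x hx => ?_
  obtain ⟨B, hB, hbB, hBS⟩ := hS x hx
  have hk₀ : ¬ (k₀ ≠ k₀) := fun h => h rfl
  have h2 := (measurePreserving_eval (fun k : {k // ¬ k ≠ k₀} =>
      noiseLaw (P.sys k) (P.Su k) (P.T k)) ⟨k₀, hk₀⟩).measure_preimage hB.nullMeasurableSet
  refine hbB.trans (h2.symm.le.trans (measure_mono fun y hy => ?_))
  have h3 : e (e.symm (x, y)) = (x, y) := e.apply_symm_apply _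
  refine hBS _ (congrArg Prod.fst h3) ?_
  have h4 := congrFun (congrArg Prod.snd h3) ⟨k₀, hk₀⟩
  change e.symm (x, y) k₀ = y ⟨k₀, hk₀⟩ at h4
  rw [h4]
  exact hy

theorem theorem3 :
    ∃ c : ℝ, 0 < c ∧
    ∀ p₁ p₂ : MvPolynomial (Fin 3) ℝ, ∃ q₁ q₂ : MvPolynomial (Fin 2) ℝ,
    ∀ (O : SysIdOracle p₁ p₂) (K n : ℕ) (P : MetaProblem K n) (ψA ρA δ : ℝ) (k₀ : Fin K)
      (colApprox : (∀ k : {k // k ≠ k₀}, Fin (P.T k + 1) → EuclideanSpace ℝ (Fin n)) →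
        (p : ℕ) × Matrix (Fin n) (Fin p) ℝ),
      P.Valid →
      (∀ k, IsStableMatrix (P.A k) ψA ρA) →
      IsColApprox colApprox →
      0 < δ → δ < Real.exp (-1) →
      1 ≤ P.T k₀ →
      2 * (K - 1) * P.rmax ≤ P.Trest k₀ →
      c * (P.κ₃ k₀ ψA ρA δ * (n : ℝ) ^ 2 * (P.rmax : ℝ) ^ 3) ≤ P.Trest k₀ →
      ENNReal.ofReal (1 - δ) ≤ P.law
        {ω |
          let Φ := (colApprox (P.outputsExcept k₀ ω)).2
          let Mhat := projSystem (P.sys k₀) Φ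
          let e := projFit O (P.r k₀) (δ / 2) Φ (ioData (P.sys k₀) (ω k₀))
          O.κ₁ Mhat (P.Su k₀) (P.T k₀) (δ / 2) * polyVal₂ q₁ P.rmax P.mmax ≤ P.T k₀ →
          ∃ S : Matrix (Fin (P.r k₀)) (Fin (P.r k₀)) ℝ, IsUnit S ∧
            paramError (P.sys k₀) S e ≤
              c * (O.κ₂ Mhat (P.Su k₀) (P.T k₀) (δ / 2) *
                    √(polyVal₂ q₂ P.rmax P.mmax / P.T k₀) +
                  P.κ₄ k₀ δ * √((n : ℝ) / P.Trest k₀) * ‖e.2.2‖)} := by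
  refine ⟨2 ^ 36, by norm_num, fun p₁ p₂ => ⟨dominatingPoly p₁, dominatingPoly p₂ ^ 2, ?_⟩⟩
  intro O K n P ψA ρA δ k₀ colApprox hP hA hcol hδ0 hδ hT hTr hκ
  obtain ⟨hgood, hε⟩ := MetaProblem.measure_not_isFrameNear_le hP hA hcol hδ0 hδ hTr hκ
  set ε := 11000 * (P.κ₄ k₀ δ * √((n : ℝ) / P.Trest k₀)) with hεdef
  have hκ₄ : 0 ≤ P.κ₄ k₀ δ * √((n : ℝ) / P.Trest k₀) := by
    have h1 : 0 ≤ P.ψη {k₀}ᶜ := zero_le_one.trans (le_fold_max_self _ _ _)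
    have h2 : 0 ≤ P.φu {k₀}ᶜ := (fold_min_one_pos _ hP.sigmaMin_Su_pos).le
    unfold MetaProblem.κ₄
    positivity
  have hε0 : 0 ≤ ε := by positivity
  have hprob : ENNReal.ofReal (1 - δ)
      ≤ (1 - ENNReal.ofReal (δ / 2)) * ENNReal.ofReal (1 - δ / 2) := by
    have hδ1 : δ < 1 := hδ.trans
      ((Real.exp_lt_exp.2 (by norm_num : (-1 : ℝ) < 0)).trans_eq Real.exp_zero)
    rw [← ENNReal.ofReal_one, ← ENNReal.ofReal_sub _ (by linarith),
      ← ENNReal.ofReal_mul (by linarith)]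
    refine ENNReal.ofReal_le_ofReal ?_
    nlinarith
  refine hprob.trans (P.le_law_of_sections k₀
    (A := {x | IsFrameNear (LinearMap.range (Matrix.toEuclideanLin (P.C k₀)))
        (colApprox fun k => output (P.sys k) (x k)).2 ε}) ?_ ?_)
  · rw [← ENNReal.ofReal_toReal (measure_ne_top _ _)]
    exact ENNReal.ofReal_le_ofReal hgood
  · intro x hx
    set Φ := (colApprox fun k => output (P.sys k) (x k)).2 with hΦ
    by_cases hκ₁ : O.κ₁ (projSystem (P.sys k₀) Φ) (P.Su k₀) (P.T k₀) (δ / 2)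
        * polyVal₂ (dominatingPoly p₁) P.rmax P.mmax ≤ P.T k₀
    · obtain ⟨B, hBm, hB, hBS⟩ := exists_measurableSet_projFit O (M := P.sys k₀) hx hε0 hε
        (hP.r_pos k₀) (MetaProblem.r_le_rmax k₀) (MetaProblem.m_le_mmax k₀) (hP.minimal k₀) (hA k₀)
        (hP.Sw_psd k₀) (Matrix.PosSemidef.one.smul (sq_nonneg (P.σ k₀))) (hP.Su_pd k₀) hT
        (half_pos hδ0) (by linarith) hκ₁
      refine ⟨B, hBm, hB, ?_⟩
      rintro ω rfl hω _
      obtain ⟨S, hS, hle⟩ := hBS _ hω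
      refine ⟨S, hS, hle.trans ?_⟩
      have h1 : 0 ≤ O.κ₂ (projSystem (P.sys k₀) Φ) (P.Su k₀) (P.T k₀) (δ / 2)
          * √(polyVal₂ (dominatingPoly p₂ ^ 2) P.rmax P.mmax / P.T k₀) :=
        mul_nonneg (O.κ₂_nonneg _ _ _ _) (Real.sqrt_nonneg _)
      have h2 : 0 ≤ P.κ₄ k₀ δ * √((n : ℝ) / P.Trest k₀)
          * ‖(projFit O (P.r k₀) (δ / 2) Φ (ioData (P.sys k₀) (ω k₀))).2.2‖ :=
        mul_nonneg hκ₄ (norm_nonneg _)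
      change _ ≤ 2 ^ 36 * (O.κ₂ (projSystem (P.sys k₀) Φ) (P.Su k₀) (P.T k₀) (δ / 2)
          * √(polyVal₂ (dominatingPoly p₂ ^ 2) P.rmax P.mmax / P.T k₀)
          + P.κ₄ k₀ δ * √((n : ℝ) / P.Trest k₀)
            * ‖(projFit O (P.r k₀) (δ / 2) Φ (ioData (P.sys k₀) (ω k₀))).2.2‖)
      rw [hεdef]
      linarith
    -- the claim is void when the oracle asks for a longer trajectory
    · refine ⟨Set.univ, MeasurableSet.univ, ?_, ?_⟩
      · rw [measure_univ, ← ENNReal.ofReal_one]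
        exact ENNReal.ofReal_le_ofReal (by linarith)
      · rintro ω rfl _ h
        exact absurd h hκ₁
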